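/- Fix $n\ge 1$. Let $\mathfrak g=\mathfrak g(D^{(1)}_{2n+2})$ be the complex affine Lie algebra with Chevalley generators $e_i,f_i,\alpha_i^\vee$ $(0\le i\le 2n+2)$ and scaling element $d$, with Cartan matrix $a_{ii}=2$, $a_{02}=a_{20}=-1$, $a_{i,i+1}=a_{i+1,i}=-1$ $(1\le i\le 2n)$, $a_{2n,2n+2}=a_{2n+2,2n}=-1$, $a_{ij}=0$ otherwise, and $[d,e_i]=\delta_{i0}e_0$, $[d,f_i]=-\delta_{i0}f_0$, $[d,\alpha_i^\vee]=0$. Let $\mathfrak h=\bigoplus_j\mathbb C\alpha_j^\vee\oplus\mathbb Cd$, let $\mathfrak n_+$ be generated by the $e_i$, $\mathfrak b_+=\mathfrak h\oplus\mathfrak n_+$, and let $(\cdot|\cdot)$ be the normalized invariant form, so $(\alpha_i^\vee|\alpha_j^\vee)=a_{ij}$, $(d|\alpha_j^\vee)=\delta_{0j}$. Write $e_{i,j}=[e_i,e_j]$, $e_{i,j,k}=[e_i,[e_j,e_k]]$, $\mathcal I=\{2,4,\dots,2n\}$, $\mathcal J'=\{3,5,\dots,2n-1\}$, $\mathcal J=\{0,1,2n+1,2n+2\}\cup\mathcal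 J'$, and $N=2n+2$. **Similarity reduction.** Let $\vartheta\in\mathfrak h$ satisfy $(\vartheta|\alpha_i^\vee)=0$ $(i\in\mathcal I)$, $(\vartheta|\alpha_j^\vee)=1$ $(j\in\mathcal J)$ (gradation of type $(1,1,0,1,0,\dots,1,0,1,1)$), and $$\Lambda_1=e_0+e_{1,2}+\sum_{j\in\mathcal J'}(e_j+e_{j-1,j,j+1})+e_{2n+1}+e_{2n,2n+2},\qquad \Lambda_2=e_1+e_{0,2}+\sum_{j\in\mathcal J'}(e_{j-1,j}+e_{j,j+1})+e_{2n+2}+e_{2n,2n+1}.$$ The similarity reduction of the Drinfeld–Sokolov hierarchy on a connected open set $D\subseteq\mathbb C^2$ is the system $$[\partial_{t_1}-B_1,\partial_{t_2}-B_2]=0,\quad [\partial_{t_k}-B_k,\mathcal M]=0\ (k=1,2),\quad \mathcal M=\vartheta-t_1B_1-t_2B_2,$$ $$B_k=\sum_{i=0}^{2n+2}u_{k,i}\alpha_i^\vee+\sum_{i\in\mathcal I}(x_{k,i}e_i+y_{k,i}f_i)+\Lambda_k,$$ for holomorphic functions $u_{k,i},x_{k,i},y_{k,i}$ on $D$. **Gauge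 into the Borel subalgebra.** Put $\mathcal M^+=e^{\mathrm{ad}\Gamma_3}e^{\mathrm{ad}\Gamma_2}e^{\mathrm{ad}\Gamma_1}\mathcal M$ and $\partial_{t_k}-B_k^+=e^{\mathrm{ad}\Gamma_3}e^{\mathrm{ad}\Gamma_2}e^{\mathrm{ad}\Gamma_1}(\partial_{t_k}-B_k)$, where: * $\Gamma_1=\sum_{i\in\mathcal I}\gamma_ie_i$ with $\gamma_2=t_2/t_1$, $\gamma_{2i+2}=(t_1+t_2\gamma_{2i})/(t_2+t_1\gamma_{2i})$; * $\Gamma_2=\sum_k g_k\alpha_k^\vee+g_d\,d$, with $g_k$ holomorphic on $D$ and $g_d$ constant, is such that $e^{\mathrm{ad}\Gamma_2}e^{\mathrm{ad}\Gamma_1}(-t_1\Lambda_1-t_2\Lambda_2)$ equals $$e_0+b_1e_1+\sum_{j\in\mathcal J'}b_je_j+b_{2n+1}e_{2n+1}+b_{2n+2}e_{2n+2}+e_{1,2}+\sum_{j\in\mathcal J'}(e_{j-1,j}+e_{j,j+1})+e_{2n,2n+1}+e_{2n,2n+2}$$ for some functions $b_j$ on $D$; * $\Gamma_3=\sum_{i\in\mathcal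 I}\eta_if_i$, with $\eta_i$ holomorphic on $D$, is such that $\mathcal M^+,B_1^+,B_2^+$ take values in $\mathfrak b_+$. Put $c_1=b_1$, $c_j=-\sum_{i=1}^{n-1}b_{2i+1}-b_j$ $(j=2n+1,2n+2)$, $s_1=(c_{2n+2}-c_1)/N$, $s_2=(c_{2n+2}-c_{2n+1})/N$, and $\lambda_{2i}=\eta_{2i}-\sum_{j=1}^{i-1}b_{2j+1}$. **Sasano's system.** For parameters with $\alpha_0+\alpha_1+\sum_{j=2}^{2n}2\alpha_j+\alpha_{2n+1}+\alpha_{2n+2}=1$ put $$\beta_{i,0}=\alpha_1+\sum_{j=1}^{i-1}\alpha_{2j+1},\quad \beta_{i,1}=\alpha_0+\sum_{j=1}^{i-1}2\alpha_{2j}+\sum_{j=1}^{i-1}\alpha_{2j+1},$$ $$\beta_{i,3}=\sum_{j=i}^{n-1}\alpha_{2j+1}+\sum_{j=i+1}^n2\alpha_{2j}+\alpha_{2n+1},\quad \beta_{i,4}=\sum_{j=i}^{n-1}\alpha_{2j+1}+\alpha_{2n+2},$$ (extended by the same formulas with empty sums equal to $0$), $$H_i=q_i(q_i-1)(q_i-s)p_i^2-\{(\beta_{i,0}-1)q_i(q_i-1)+\beta_{i,3}q_i(q_i-s)+\beta_{i,4}(q_i-1)(q_i-s)\}p_i+\alpha_{2i}(\alpha_{2i}+\beta_{i,1})q_i,$$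 $$H=\sum_{i=1}^nH_i+\sum_{1\le i<j\le n}2(q_i-s)p_iq_j\{(q_j-1)p_j+\alpha_{2j}\}.$$ Sasano's system is $s(s-1)\frac{dq_i}{ds}=\{H,q_i\}$, $s(s-1)\frac{dp_i}{ds}=\{H,p_i\}$ $(1\le i\le n)$, where $\{p_i,q_j\}=\delta_{ij}$, $\{p_i,p_j\}=\{q_i,q_j\}=0$. **The ODE.** For $\kappa\in\mathfrak h$ put $\alpha_j=(\kappa|\alpha_j^\vee)/N$, and for functions $q_i,p_i$ of $s$ put $$\mathcal M^+=\kappa+\sum_{i=0}^{2n+2}N\varphi_ie_i+\sum_{i=1}^{2n}e_{i,i+1}+e_{2n,2n+2},$$ $\varphi_0=\frac1N$, $\varphi_1=q_1-s$, $\varphi_{2i+1}=q_{i+1}-q_i$ $(1\le i\le n-1)$, $\varphi_{2j}=-p_j/N$ $(1\le j\le n)$, $\varphi_{2n+1}=1-q_n$, $\varphi_{2n+2}=-q_n$. Let $$B=u+\sum_{i=0}^{2n+2}x_ie_i+y_1e_{0,2}+\sum_{i=2}^{2n}y_ie_{i,i+1}+y_{2n+1}e_{2n,2n+2}+\sum_{j\in\mathcal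 J'}y_1e_{j-1,j,j+1},$$ where $$x_0=\tfrac{q_1-s}N,\quad x_1=s(s-1),\quad x_{2i+1}=s(s-1)-(q_i-s)(q_{i+1}-s),\quad x_{2n+1}=(s-1)q_n,\quad x_{2n+2}=s(q_n-1),$$ $$y_1=\tfrac1{N^2},\quad y_{2i}=\tfrac{q_{i+1}-s}N,\quad y_{2i+1}=-\tfrac{q_i-s}N,\quad y_{2n}=-\tfrac{s-1}N,\quad y_{2n+1}=-\tfrac sN\qquad(1\le i\le n-1),$$ $$-Nx_{2i}=\sum_{j=1}^{i-1}2\{(q_j-s)p_j+\alpha_{2j}\}+(q_i-s)p_i+\alpha_{2i}+\alpha_0+\sum_{j=1}^{i-1}\alpha_{2j+1}\qquad(1\le i\le n),$$ and $u\in\bigoplus_j\mathbb C\alpha_j^\vee$ has, with $S_i=\sum_{j=1}^i2(q_j-s)p_j$ and $T_i=\sum_{j=i}^n2q_j\{(q_j-1)p_j+\alpha_{2j}\}$, the values $$\begin{aligned} (u|\alpha_0^\vee)&=\alpha_0(q_1-s),\\ (u|\alpha_1^\vee)&=\alpha_0(q_1+s-1)+T_1+(2\alpha_2+\beta_{1,3})(s-1)+\beta_{1,4}s,\\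 (u|\alpha_{2i+1}^\vee)&=(S_i+\beta_{i,1}+2\alpha_{2i})(q_i+q_{i+1}-1)+\alpha_{2i+1}(q_{i+1}+s-1)+T_{i+1}\\&\quad+(2\alpha_{2i+2}+\beta_{i+1,3})(s-1)+\beta_{i+1,4}s\qquad(1\le i\le n-1),\\ (u|\alpha_{2n+1}^\vee)&=(S_n+\beta_{n,1}+2\alpha_{2n})q_n+\alpha_{2n+2}s,\\ (u|\alpha_{2n+2}^\vee)&=(S_n+\beta_{n,1}+2\alpha_{2n})(q_n-1)+\alpha_{2n+1}(s-1),\\ -(u|\alpha_{2i}^\vee)&=\{S_{i-1}+(q_i-s)p_i+\beta_{i,1}+\alpha_{2i}\}(2q_i-1)+q_i\{(q_i-1)p_i+\alpha_{2i}\}+T_{i+1}\\&\quad+(\alpha_{2i}+\beta_{i,3})(s-1)+\beta_{i,4}s\qquad(1\le i\le n). \end{aligned}$$ These values determine $u$, hence $B$, up to a multiple of the central element. The ODE is $\left[s(s-1)\frac{d}{ds}-B,\mathcal M^+\right]=0$. **Theorem.** 1. Every choice of complex parameters with $\alpha_0+\alpha_1+\sum_{j=2}^{2n}2\alpha_j+\alpha_{2n+1}+\alpha_{2n+2}=1$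 is of the form $\alpha_j=(\kappa|\alpha_j^\vee)/N$ for some $\kappa\in\mathfrak h$. 2. For every $\kappa\in\mathfrak h$ whose parameters $\alpha_j=(\kappa|\alpha_j^\vee)/N$ satisfy this normalization, every open $U\subseteq\mathbb C$ and all functions $q_i,p_i$ on $U$, the ODE $\left[s(s-1)\frac d{ds}-B,\mathcal M^+\right]=0$ holds on $U$ if and only if $(q_i,p_i)$ solves Sasano's system with parameters $\alpha_j$ on $U$. 3. The ODE is the similarity reduction, gauged into $\mathfrak b_+$ and restricted to $s_2=1$. That is, for every solution of the similarity reduction on $D$ and every gauge as above there are a constant $\kappa\in\mathfrak h$, with $\alpha_j=(\kappa|\alpha_j^\vee)/N$ normalized as above, and functions $\mu_i$ $(i\in\mathcal I)$ on $D$ such that on $D$ one has $\partial_{t_k}\mathcal M^+=[B_k^+,\mathcal M^+]$ and $$\begin{aligned}\mathcal M^+&=\kappa+\sum_{i\in\mathcal I}\mu_ie_i+e_0+(c_1-\lambda_2)e_1+\sum_{j\in\mathcal J'}(\lambda_{j-1}-\lambda_{j+1})e_j+(\lambda_{2n}-c_{2n+1})e_{2n+1}+(\lambda_{2n}-c_{2n+2})e_{2n+2}\\&\quad+e_{1,2}+\sum_{j\in\mathcal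 J'}(e_{j-1,j}+e_{j,j+1})+e_{2n,2n+1}+e_{2n,2n+2}.\end{aligned}$$ Moreover, for every open $U\subseteq\mathbb C\setminus\{0,1\}$ and every holomorphic $T=(T_1,T_2):U\to D$ with $s_1(T(s))=s$ and $s_2(T(s))=1$, the functions $q_i(s)=\frac{c_{2n+2}-\lambda_{2i}}{2n+2}(T(s))$, $p_i(s)=-\mu_{2i}(T(s))$ satisfy: $\mathcal M^+(T(s))$ is the operator $\mathcal M^+$ of the ODE; $s(s-1)\sum_kT_k'(s)B_k^+(T(s))$ is an operator $B$ of the ODE; the ODE holds on $U$; and $(q_i,p_i)$ solves Sasano's system on $U$ with parameters $\alpha_j$. -/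

import Mathlib

noncomputable section

namespace CoupledPVI

open Finset

/-! ### The affine Lie algebra of type `D^{(1)}_{2n+2}` -/

/-- The generalized Cartan matrix `(a_{ij})_{0 ≤ i, j ≤ 2n+2}` of type `D^{(1)}_{2n+2}`. -/
def cartan (n i j : ℕ) : ℤ :=
  if i = j then 2
  else if (i = 0 ∧ j = 2) ∨ (j = 0 ∧ i = 2)
      ∨ (1 ≤ i ∧ i ≤ 2 * n ∧ j = i + 1) ∨ (1 ≤ j ∧ j ≤ 2 * n ∧ i = j + 1)
      ∨ (i = 2 * n ∧ j = 2 * n + 2) ∨ (j = 2 * n ∧ i = 2 * n + 2) then -1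
  else 0

/-- Symbols for the Chevalley generators `e_i`, `f_i`, `α_i^∨` and the scaling element `d`. -/
inductive Gen (n : ℕ) : Type
  | e : Fin (2 * n + 3) → Gen n
  | f : Fin (2 * n + 3) → Gen n
  | h : Fin (2 * n + 3) → Gen n
  | d : Gen n

/-- The fundamental relations, as elements of the free Lie algebra that are to vanish. -/
inductive SerreRel (n : ℕ) : FreeLieAlgebra ℂ (Gen n) → Prop
  | hh (i j : Fin (2 * n + 3)) :
      SerreRel n ⁅FreeLieAlgebra.of ℂ (Gen.h i), FreeLieAlgebra.of ℂ (Gen.h j)⁆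
  | he (i j : Fin (2 * n + 3)) :
      SerreRel n (⁅FreeLieAlgebra.of ℂ (Gen.h i), FreeLieAlgebra.of ℂ (Gen.e j)⁆
        - (cartan n i j : ℂ) • FreeLieAlgebra.of ℂ (Gen.e j))
  | hf (i j : Fin (2 * n + 3)) :
      SerreRel n (⁅FreeLieAlgebra.of ℂ (Gen.h i), FreeLieAlgebra.of ℂ (Gen.f j)⁆
        + (cartan n i j : ℂ) • FreeLieAlgebra.of ℂ (Gen.f j))
  | ef_same (i : Fin (2 * n + 3)) :
      SerreRel n (⁅FreeLieAlgebra.of ℂ (Gen.e i), FreeLieAlgebra.of ℂ (Gen.f i)⁆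
        - FreeLieAlgebra.of ℂ (Gen.h i))
  | ef_ne (i j : Fin (2 * n + 3)) (hij : i ≠ j) :
      SerreRel n ⁅FreeLieAlgebra.of ℂ (Gen.e i), FreeLieAlgebra.of ℂ (Gen.f j)⁆
  | serre_e (i j : Fin (2 * n + 3)) (hij : i ≠ j) :
      SerreRel n (((LieAlgebra.ad ℂ (FreeLieAlgebra ℂ (Gen n)) (FreeLieAlgebra.of ℂ (Gen.e i)))
        ^ (1 - cartan n i j).toNat) (FreeLieAlgebra.of ℂ (Gen.e j)))
  | serre_f (i j : Fin (2 * n + 3)) (hij : i ≠ j) :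
      SerreRel n (((LieAlgebra.ad ℂ (FreeLieAlgebra ℂ (Gen n)) (FreeLieAlgebra.of ℂ (Gen.f i)))
        ^ (1 - cartan n i j).toNat) (FreeLieAlgebra.of ℂ (Gen.f j)))
  | dh (i : Fin (2 * n + 3)) :
      SerreRel n ⁅FreeLieAlgebra.of ℂ (Gen.d : Gen n), FreeLieAlgebra.of ℂ (Gen.h i)⁆
  | de_zero :
      SerreRel n (⁅FreeLieAlgebra.of ℂ (Gen.d : Gen n), FreeLieAlgebra.of ℂ (Gen.e 0)⁆
        - FreeLieAlgebra.of ℂ (Gen.e 0))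
  | df_zero :
      SerreRel n (⁅FreeLieAlgebra.of ℂ (Gen.d : Gen n), FreeLieAlgebra.of ℂ (Gen.f 0)⁆
        + FreeLieAlgebra.of ℂ (Gen.f 0))
  | de_ne (i : Fin (2 * n + 3)) (hi : i ≠ 0) :
      SerreRel n ⁅FreeLieAlgebra.of ℂ (Gen.d : Gen n), FreeLieAlgebra.of ℂ (Gen.e i)⁆
  | df_ne (i : Fin (2 * n + 3)) (hi : i ≠ 0) :
      SerreRel n ⁅FreeLieAlgebra.of ℂ (Gen.d : Gen n), FreeLieAlgebra.of ℂ (Gen.f i)⁆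

/-- The ideal generated by the fundamental relations. -/
def relIdeal (n : ℕ) : LieIdeal ℂ (FreeLieAlgebra ℂ (Gen n)) :=
  LieSubmodule.lieSpan ℂ (FreeLieAlgebra ℂ (Gen n)) {x | SerreRel n x}

/-- The affine Lie algebra `𝔤 = 𝔤(D^{(1)}_{2n+2})`. -/
abbrev AffD (n : ℕ) : Type := FreeLieAlgebra ℂ (Gen n) ⧸ relIdeal n

/-- The image in `𝔤` of a generator. -/
def gen (n : ℕ) (x : Gen n) : AffD n := LieSubmodule.Quotient.mk (FreeLieAlgebra.of ℂ x)

/-- `e_k` for `0 ≤ k ≤ 2n+2` (and `0` for larger `k`). -/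
def chE (n k : ℕ) : AffD n := if hk : k < 2 * n + 3 then gen n (Gen.e ⟨k, hk⟩) else 0

/-- `f_k` for `0 ≤ k ≤ 2n+2` (and `0` for larger `k`). -/
def chF (n k : ℕ) : AffD n := if hk : k < 2 * n + 3 then gen n (Gen.f ⟨k, hk⟩) else 0

/-- `α_k^∨` for `0 ≤ k ≤ 2n+2` (and `0` for larger `k`). -/
def chH (n k : ℕ) : AffD n := if hk : k < 2 * n + 3 then gen n (Gen.h ⟨k, hk⟩) else 0

/-- The scaling element `d`. -/
def chD (n : ℕ) : AffD n := gen n Gen.d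

/-- `e_{i,j} = [e_i, e_j]`. -/
def e2 (n i j : ℕ) : AffD n := ⁅chE n i, chE n j⁆

/-- `e_{i,j,k} = [e_i, [e_j, e_k]]`. -/
def e3 (n i j k : ℕ) : AffD n := ⁅chE n i, ⁅chE n j, chE n k⁆⁆

/-- The element `∑_k c_k α_k^∨ + a d` of the Cartan subalgebra `𝔥`. -/
def hElt (n : ℕ) (c : ℕ → ℂ) (a : ℂ) : AffD n :=
  ∑ k ∈ range (2 * n + 3), c k • chH n k + a • chD n

/-- The value `(h | α_j^∨)` of the normalized invariant form at `h = ∑_k c_k α_k^∨ + a d`,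
from `(α_k^∨ | α_j^∨) = a_{kj}` and `(d | α_j^∨) = δ_{0,j}`. -/
def hForm (n : ℕ) (c : ℕ → ℂ) (a : ℂ) (j : ℕ) : ℂ :=
  ∑ k ∈ range (2 * n + 3), c k * (cartan n k j : ℂ) + if j = 0 then a else 0

/-- The Borel subalgebra `𝔟₊ = 𝔥 ⊕ 𝔫₊`, with `𝔫₊` the subalgebra generated by the `e_i`. -/
def borel (n : ℕ) : Submodule ℂ (AffD n) :=
  Submodule.span ℂ (Set.range (chH n) ∪ {chD n})
    ⊔ (LieSubalgebra.lieSpan ℂ (AffD n) (Set.range (chE n))).toSubmodule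

/-- `ϑ = ∑_k c_k α_k^∨ + a d` defines the gradation of type `(1,1,0,1,0,…,1,0,1,1)`:
`(ϑ | α_j^∨) = 0` for `j ∈ {2,4,…,2n}`, and `= 1` for `j ∈ {0,1,3,5,…,2n+1,2n+2}`. -/
def IsTheta (n : ℕ) (c : ℕ → ℂ) (a : ℂ) : Prop :=
  (∀ i ∈ Icc 1 n, hForm n c a (2 * i) = 0) ∧
  hForm n c a 0 = 1 ∧ (∀ i ∈ Icc 0 n, hForm n c a (2 * i + 1) = 1) ∧
  hForm n c a (2 * n + 2) = 1

/-- The elements `Λ₁` (index `0`) and `Λ₂` (index `1`) of degree one of the Heisenberg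
subalgebra of type `(1,1,0,1,0,…,1,0,1,1)`. -/
def Lam (n : ℕ) (k : Fin 2) : AffD n :=
  if k = 0 then
    chE n 0 + e2 n 1 2
      + ∑ i ∈ Ico 1 n, (chE n (2 * i + 1) + e3 n (2 * i) (2 * i + 1) (2 * i + 2))
      + chE n (2 * n + 1) + e2 n (2 * n) (2 * n + 2)
  else
    chE n 1 + e2 n 0 2
      + ∑ i ∈ Ico 1 n, (e2 n (2 * i) (2 * i + 1) + e2 n (2 * i + 1) (2 * i + 2))
      + chE n (2 * n + 2) + e2 n (2 * n) (2 * n + 1)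

/-! ### Calculus for functions with values in a complex vector space

All functions to which this is applied take their values in finite-dimensional subspaces, where
testing against all linear functionals gives the usual derivative and the usual sum. -/

section Calculus

variable {V : Type*} [AddCommGroup V] [Module ℂ V]

/-- `F` has derivative `F'` at `z`. -/
def HasDerivW (F : ℂ → V) (F' : V) (z : ℂ) : Prop :=
  ∀ φ : Module.Dual ℂ V, HasDerivAt (fun w => φ (F w)) (φ F') z

/-- `F : ℂ² → V` has partial derivative `F'` in the direction `t_k` at `t`. -/
def HasPartialW (k : Fin 2) (F : (Fin 2 → ℂ) → V) (F' : V) (t : Fin 2 → ℂ) : Prop :=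
  HasDerivW (fun z => F (Function.update t k z)) F' (t k)

/-- The series `∑_m a_m` has sum `v`. -/
def HasSumW (a : ℕ → V) (v : V) : Prop :=
  ∀ φ : Module.Dual ℂ V, HasSum (fun m => φ (a m)) (φ v)

open Classical in
/-- The sum of the series `∑_m a_m` (and `0` if it does not converge). -/
def sumW (a : ℕ → V) : V := if h : ∃ v, HasSumW a v then h.choose else 0

end Calculus

/-- The partial derivative of a scalar function in the direction `t_k`. -/
def pd (k : Fin 2) (f : (Fin 2 → ℂ) → ℂ) (t : Fin 2 → ℂ) : ℂ :=
  deriv (fun z => f (Function.update t k z)) (t k)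

/-- `exp(ad Γ)(X) = ∑_m (ad Γ)^m(X) / m!`. -/
def expAd (n : ℕ) (Γ X : AffD n) : AffD n :=
  sumW fun m => ((m.factorial : ℂ)⁻¹) • ((LieAlgebra.ad ℂ (AffD n) Γ) ^ m) X

/-- The gauge transform of a connection coefficient: if `∂ - B' = exp(ad Γ)(∂ - B)` and
`Γ' = ∂Γ`, then `B' = exp(ad Γ)(B) + ∑_m (ad Γ)^m(Γ') / (m+1)!`. -/
def gaugeConn (n : ℕ) (Γ Γ' B : AffD n) : AffD n :=
  expAd n Γ B +
    sumW fun m => (((m + 1).factorial : ℂ)⁻¹) • ((LieAlgebra.ad ℂ (AffD n) Γ) ^ m) Γ'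

/-! ### The similarity reduction of the Drinfeld–Sokolov hierarchy -/

/-- `B_k = ∑_i u_{k,i} α_i^∨ + ∑_{i ∈ {2,4,…,2n}} (x_{k,i} e_i + y_{k,i} f_i) + Λ_k`. -/
def opB (n : ℕ) (u x y : Fin 2 → ℕ → (Fin 2 → ℂ) → ℂ) (k : Fin 2) (t : Fin 2 → ℂ) : AffD n :=
  ∑ i ∈ range (2 * n + 3), u k i t • chH n i
    + ∑ i ∈ Icc 1 n, (x k (2 * i) t • chE n (2 * i) + y k (2 * i) t • chF n (2 * i))
    + Lam n k

/-- `𝓜 = ϑ - t₁ B₁ - t₂ B₂`, with `ϑ = ∑_k c_k α_k^∨ + a d`. -/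
def opM (n : ℕ) (c : ℕ → ℂ) (a : ℂ) (u x y : Fin 2 → ℕ → (Fin 2 → ℂ) → ℂ)
    (t : Fin 2 → ℂ) : AffD n :=
  hElt n c a - ∑ k : Fin 2, t k • opB n u x y k t

/-- The similarity reduction on `D ⊆ ℂ²`, for holomorphic coefficient functions:
`[∂₁ - B₁, ∂₂ - B₂] = 0` and `[∂_k - B_k, 𝓜] = 0` for `k = 1, 2`. -/
structure IsSimilarityReduction (n : ℕ) (D : Set (Fin 2 → ℂ)) (c : ℕ → ℂ) (a : ℂ)
    (u x y : Fin 2 → ℕ → (Fin 2 → ℂ) → ℂ) : Prop where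
  diff_u : ∀ k, ∀ i ∈ range (2 * n + 3), DifferentiableOn ℂ (u k i) D
  diff_x : ∀ k, ∀ i ∈ Icc 1 n, DifferentiableOn ℂ (x k (2 * i)) D
  diff_y : ∀ k, ∀ i ∈ Icc 1 n, DifferentiableOn ℂ (y k (2 * i)) D
  zero_curvature : ∀ t ∈ D, ∃ P Q : AffD n,
    HasPartialW 0 (opB n u x y 1) P t ∧ HasPartialW 1 (opB n u x y 0) Q t ∧
      P - Q = ⁅opB n u x y 0 t, opB n u x y 1 t⁆
  lax : ∀ t ∈ D, ∀ k,
    HasPartialW k (opM n c a u x y) ⁅opB n u x y k t, opM n c a u x y t⁆ t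

/-! ### The gauge transformation into the Borel subalgebra -/

/-- `gam t i` is `γ_{2i}`: `γ₂ = t₂/t₁`, `γ_{2i+2} = (t₁ + t₂ γ_{2i}) / (t₂ + t₁ γ_{2i})`. -/
def gam (t : Fin 2 → ℂ) : ℕ → ℂ
  | 0 => 0
  | 1 => t 1 / t 0
  | (i + 2) => (t 0 + t 1 * gam t (i + 1)) / (t 1 + t 0 * gam t (i + 1))

/-- `∑_{i=1}^n v_i e_{2i}`. -/
def evenE (n : ℕ) (v : ℕ → ℂ) : AffD n := ∑ i ∈ Icc 1 n, v i • chE n (2 * i)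

/-- `∑_{i=1}^n v_i f_{2i}`. -/
def evenF (n : ℕ) (v : ℕ → ℂ) : AffD n := ∑ i ∈ Icc 1 n, v i • chF n (2 * i)

/-- `exp(ad Γ₃) exp(ad Γ₂) exp(ad Γ₁) 𝓜` with `Γ₁ = ∑ γ_{2i} e_{2i}`,
`Γ₂ = ∑ g_k α_k^∨ + g_d d` and `Γ₃ = ∑ η_{2i} f_{2i}` (`η i` stands for `η_{2i}`). -/
def gaugedM (n : ℕ) (c : ℕ → ℂ) (a : ℂ) (u x y : Fin 2 → ℕ → (Fin 2 → ℂ) → ℂ)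
    (g : ℕ → (Fin 2 → ℂ) → ℂ) (gd : ℂ) (η : ℕ → (Fin 2 → ℂ) → ℂ) (t : Fin 2 → ℂ) : AffD n :=
  expAd n (evenF n fun i => η i t)
    (expAd n (hElt n (fun k => g k t) gd)
      (expAd n (evenE n (gam t)) (opM n c a u x y t)))

/-- The coefficient `B_k⁺` of `d - 𝓑⁺ = exp(ad Γ₃) exp(ad Γ₂) exp(ad Γ₁) (d - 𝓑)`. -/
def gaugedB (n : ℕ) (u x y : Fin 2 → ℕ → (Fin 2 → ℂ) → ℂ)
    (g : ℕ → (Fin 2 → ℂ) → ℂ) (gd : ℂ) (η : ℕ → (Fin 2 → ℂ) → ℂ)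
    (k : Fin 2) (t : Fin 2 → ℂ) : AffD n :=
  gaugeConn n (evenF n fun i => η i t) (evenF n fun i => pd k (η i) t)
    (gaugeConn n (hElt n (fun j => g j t) gd) (hElt n (fun j => pd k (g j) t) 0)
      (gaugeConn n (evenE n (gam t)) (evenE n fun i => pd k (fun r => gam r i) t)
        (opB n u x y k t)))

/-- The normal form `e₀ + b₁ e₁ + ∑_j b_j e_j + b_{2n+1} e_{2n+1} + b_{2n+2} e_{2n+2}
+ e_{1,2} + ∑_j (e_{j-1,j} + e_{j,j+1}) + e_{2n,2n+1} + e_{2n,2n+2}` (`j = 3,5,…,2n-1`). -/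
def normalForm (n : ℕ) (b : ℕ → ℂ) : AffD n :=
  chE n 0 + b 1 • chE n 1 + ∑ i ∈ Ico 1 n, b (2 * i + 1) • chE n (2 * i + 1)
    + b (2 * n + 1) • chE n (2 * n + 1) + b (2 * n + 2) • chE n (2 * n + 2)
    + e2 n 1 2 + ∑ i ∈ Ico 1 n, (e2 n (2 * i) (2 * i + 1) + e2 n (2 * i + 1) (2 * i + 2))
    + e2 n (2 * n) (2 * n + 1) + e2 n (2 * n) (2 * n + 2)

/-- The gauge parameters bring the part `-t₁ Λ₁ - t₂ Λ₂` of `𝓜` to normal form before the last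
step, and `𝓜⁺`, `𝓑⁺` take values in `𝔟₊`. -/
structure IsBorelGauge (n : ℕ) (D : Set (Fin 2 → ℂ)) (c : ℕ → ℂ) (a : ℂ)
    (u x y : Fin 2 → ℕ → (Fin 2 → ℂ) → ℂ) (g : ℕ → (Fin 2 → ℂ) → ℂ) (gd : ℂ)
    (b η : ℕ → (Fin 2 → ℂ) → ℂ) : Prop where
  diff_g : ∀ k ∈ range (2 * n + 3), DifferentiableOn ℂ (g k) D
  diff_η : ∀ i ∈ Icc 1 n, DifferentiableOn ℂ (η i) D
  normal : ∀ t ∈ D,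
    expAd n (hElt n (fun k => g k t) gd)
      (expAd n (evenE n (gam t)) (-(∑ k : Fin 2, t k • Lam n k))) = normalForm n fun j => b j t
  mem_M : ∀ t ∈ D, gaugedM n c a u x y g gd η t ∈ borel n
  mem_B : ∀ t ∈ D, ∀ k, gaugedB n u x y g gd η k t ∈ borel n

/-- `c₁ = b₁`, and `c_j = -∑_{i=1}^{n-1} b_{2i+1} - b_j` for `j = 2n+1, 2n+2`. -/
def cc (n : ℕ) (b : ℕ → ℂ) (j : ℕ) : ℂ :=
  if j = 1 then b 1 else -(∑ i ∈ Ico 1 n, b (2 * i + 1)) - b j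

/-- `s₁ = (c_{2n+2} - c₁)/(2n+2)`. -/
def s1 (n : ℕ) (b : ℕ → ℂ) : ℂ := (cc n b (2 * n + 2) - cc n b 1) / (2 * n + 2)

/-- `s₂ = (c_{2n+2} - c_{2n+1})/(2n+2)`. -/
def s2 (n : ℕ) (b : ℕ → ℂ) : ℂ := (cc n b (2 * n + 2) - cc n b (2 * n + 1)) / (2 * n + 2)

/-- `lam b η i` is `λ_{2i} = η_{2i} - ∑_{j=1}^{i-1} b_{2j+1}`. -/
def lam (b η : ℕ → ℂ) (i : ℕ) : ℂ := η i - ∑ j ∈ Ico 1 i, b (2 * j + 1)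

/-- `κ + ∑ μ_{2i} e_{2i} + e₀ + (c₁ - λ₂) e₁ + ∑_j (λ_{j-1} - λ_{j+1}) e_j
+ (λ_{2n} - c_{2n+1}) e_{2n+1} + (λ_{2n} - c_{2n+2}) e_{2n+2} + e_{1,2}
+ ∑_j (e_{j-1,j} + e_{j,j+1}) + e_{2n,2n+1} + e_{2n,2n+2}` (`j = 3,5,…,2n-1`), where
`μ i`, `l i` stand for `μ_{2i}`, `λ_{2i}` and `κ = ∑_k κ_k α_k^∨ + κ_d d`. -/
def borelM (n : ℕ) (κ : ℕ → ℂ) (κd : ℂ) (μ l : ℕ → ℂ) (c : ℕ → ℂ) : AffD n :=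
  hElt n κ κd + evenE n μ + chE n 0 + (c 1 - l 1) • chE n 1
    + ∑ i ∈ Ico 1 n, (l i - l (i + 1)) • chE n (2 * i + 1)
    + (l n - c (2 * n + 1)) • chE n (2 * n + 1) + (l n - c (2 * n + 2)) • chE n (2 * n + 2)
    + e2 n 1 2 + ∑ i ∈ Ico 1 n, (e2 n (2 * i) (2 * i + 1) + e2 n (2 * i + 1) (2 * i + 2))
    + e2 n (2 * n) (2 * n + 1) + e2 n (2 * n) (2 * n + 2)

/-! ### Sasano's Hamiltonian system -/

/-- `α₀ + α₁ + ∑_{j=2}^{2n} 2α_j + α_{2n+1} + α_{2n+2} = 1`. -/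
def Normalized (n : ℕ) (α : ℕ → ℂ) : Prop :=
  α 0 + α 1 + ∑ j ∈ Icc 2 (2 * n), 2 * α j + α (2 * n + 1) + α (2 * n + 2) = 1

/-- `β_{i,0}`. -/
def beta0 (α : ℕ → ℂ) (i : ℕ) : ℂ := α 1 + ∑ j ∈ Ico 1 i, α (2 * j + 1)

/-- `β_{i,1}`. -/
def beta1 (α : ℕ → ℂ) (i : ℕ) : ℂ :=
  α 0 + ∑ j ∈ Ico 1 i, 2 * α (2 * j) + ∑ j ∈ Ico 1 i, α (2 * j + 1)

/-- `β_{i,3}`. -/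
def beta3 (n : ℕ) (α : ℕ → ℂ) (i : ℕ) : ℂ :=
  ∑ j ∈ Ico i n, α (2 * j + 1) + ∑ j ∈ Icc (i + 1) n, 2 * α (2 * j) + α (2 * n + 1)

/-- `β_{i,4}`. -/
def beta4 (n : ℕ) (α : ℕ → ℂ) (i : ℕ) : ℂ := ∑ j ∈ Ico i n, α (2 * j + 1) + α (2 * n + 2)

/-- The Hamiltonian `H_i` of the sixth Painlevé equation. -/
def hamPVI (n : ℕ) (α : ℕ → ℂ) (s : ℂ) (i : ℕ) (q p : ℂ) : ℂ :=
  q * (q - 1) * (q - s) * p ^ 2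
    - ((beta0 α i - 1) * q * (q - 1) + beta3 n α i * q * (q - s)
        + beta4 n α i * (q - 1) * (q - s)) * p
    + α (2 * i) * (α (2 * i) + beta1 α i) * q

/-- The coupled Hamiltonian `H`. -/
def ham (n : ℕ) (α : ℕ → ℂ) (s : ℂ) (q p : ℕ → ℂ) : ℂ :=
  ∑ i ∈ Icc 1 n, hamPVI n α s i (q i) (p i)
    + ∑ i ∈ Icc 1 n, ∑ j ∈ Icc (i + 1) n,
        2 * (q i - s) * p i * q j * ((q j - 1) * p j + α (2 * j))

/-- `∂F/∂q_k`. -/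
def dq (k : ℕ) (F : (ℕ → ℂ) → (ℕ → ℂ) → ℂ) (q p : ℕ → ℂ) : ℂ :=
  deriv (fun z => F (Function.update q k z) p) (q k)

/-- `∂F/∂p_k`. -/
def dp (k : ℕ) (F : (ℕ → ℂ) → (ℕ → ℂ) → ℂ) (q p : ℕ → ℂ) : ℂ :=
  deriv (fun z => F q (Function.update p k z)) (p k)

/-- The Poisson bracket in `q_1, …, q_n, p_1, …, p_n` with
`{p_i, q_j} = δ_{ij}`, `{p_i, p_j} = {q_i, q_j} = 0`. -/
def poisson (n : ℕ) (F G : (ℕ → ℂ) → (ℕ → ℂ) → ℂ) (q p : ℕ → ℂ) : ℂ :=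
  ∑ k ∈ Icc 1 n, (dp k F q p * dq k G q p - dq k F q p * dp k G q p)

/-- `(q, p)` solves `s(s-1) dq_i/ds = {H, q_i}`, `s(s-1) dp_i/ds = {H, p_i}` on `U`
(only the functions `q i`, `p i` with `1 ≤ i ≤ n` matter). -/
def IsSasanoSolution (n : ℕ) (U : Set ℂ) (α : ℕ → ℂ) (q p : ℕ → ℂ → ℂ) : Prop :=
  ∀ s ∈ U, ∀ i ∈ Icc 1 n, ∃ q' p' : ℂ,
    HasDerivAt (q i) q' s ∧ HasDerivAt (p i) p' s ∧
    s * (s - 1) * q' = poisson n (ham n α s) (fun Q _ => Q i) (fun j => q j s) (fun j => p j s) ∧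
    s * (s - 1) * p' = poisson n (ham n α s) (fun _ P => P i) (fun j => q j s) (fun j => p j s)

/-! ### The ordinary differential equation `[s(s-1) d/ds - B, 𝓜⁺] = 0` -/

/-- The parameters `α_j = (κ | α_j^∨)/(2n+2)`. -/
def alph (n : ℕ) (κ : ℕ → ℂ) (κd : ℂ) (j : ℕ) : ℂ := hForm n κ κd j / (2 * n + 2)

/-- The variables `φ_0, …, φ_{2n+2}`. -/
def phi (n : ℕ) (s : ℂ) (q p : ℕ → ℂ) (k : ℕ) : ℂ :=
  if k = 0 then 1 / (2 * n + 2)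
  else if k = 1 then q 1 - s
  else if k = 2 * n + 1 then 1 - q n
  else if k = 2 * n + 2 then -q n
  else if k % 2 = 0 then -p (k / 2) / (2 * n + 2)
  else q (k / 2 + 1) - q (k / 2)

/-- `𝓜⁺ = κ + ∑_{k=0}^{2n+2} (2n+2) φ_k e_k + ∑_{i=1}^{2n} e_{i,i+1} + e_{2n,2n+2}`. -/
def laxM (n : ℕ) (κ : ℕ → ℂ) (κd : ℂ) (s : ℂ) (q p : ℕ → ℂ) : AffD n :=
  hElt n κ κd + ∑ k ∈ range (2 * n + 3), ((2 * n + 2) * phi n s q p k) • chE n k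
    + ∑ i ∈ Icc 1 (2 * n), e2 n i (i + 1) + e2 n (2 * n) (2 * n + 2)

/-- `S_i = ∑_{j=1}^{i} 2 (q_j - s) p_j`. -/
def sumS (s : ℂ) (q p : ℕ → ℂ) (i : ℕ) : ℂ := ∑ j ∈ Icc 1 i, 2 * ((q j - s) * p j)

/-- `T_i = ∑_{j=i}^{n} 2 q_j {(q_j - 1) p_j + α_{2j}}`. -/
def sumT (n : ℕ) (α : ℕ → ℂ) (q p : ℕ → ℂ) (i : ℕ) : ℂ :=
  ∑ j ∈ Icc i n, 2 * (q j * ((q j - 1) * p j + α (2 * j)))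

/-- The coefficient `x_{2i}` of `e_{2i}` in `B`. -/
def xEven (n : ℕ) (α : ℕ → ℂ) (s : ℂ) (q p : ℕ → ℂ) (i : ℕ) : ℂ :=
  -(∑ j ∈ Ico 1 i, 2 * ((q j - s) * p j + α (2 * j)) + (q i - s) * p i + α (2 * i) + α 0
      + ∑ j ∈ Ico 1 i, α (2 * j + 1)) / (2 * n + 2)

/-- The part of `B` outside the Cartan subalgebra. -/
def laxBnil (n : ℕ) (α : ℕ → ℂ) (s : ℂ) (q p : ℕ → ℂ) : AffD n :=
  ((q 1 - s) / (2 * n + 2)) • chE n 0 + (s * (s - 1)) • chE n 1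
    + ∑ i ∈ Ico 1 n, (s * (s - 1) - (q i - s) * (q (i + 1) - s)) • chE n (2 * i + 1)
    + ((s - 1) * q n) • chE n (2 * n + 1) + (s * (q n - 1)) • chE n (2 * n + 2)
    + evenE n (xEven n α s q p)
    + (1 / (2 * n + 2) ^ 2 : ℂ) • e2 n 0 2
    + ∑ i ∈ Ico 1 n,
        (((q (i + 1) - s) / (2 * n + 2)) • e2 n (2 * i) (2 * i + 1)
          + (-(q i - s) / (2 * n + 2)) • e2 n (2 * i + 1) (2 * i + 2))
    + (-(s - 1) / (2 * n + 2)) • e2 n (2 * n) (2 * n + 1)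
    + (-s / (2 * n + 2)) • e2 n (2 * n) (2 * n + 2)
    + ∑ i ∈ Ico 1 n, (1 / (2 * n + 2) ^ 2 : ℂ) • e3 n (2 * i) (2 * i + 1) (2 * i + 2)

/-- The value `(u | α_{2i}^∨)` for the Cartan part `u` of `B` (`1 ≤ i ≤ n`). -/
def uEven (n : ℕ) (α : ℕ → ℂ) (s : ℂ) (q p : ℕ → ℂ) (i : ℕ) : ℂ :=
  -((sumS s q p (i - 1) + (q i - s) * p i + beta1 α i + α (2 * i)) * (2 * q i - 1)
    + q i * ((q i - 1) * p i + α (2 * i)) + sumT n α q p (i + 1)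
    + (α (2 * i) + beta3 n α i) * (s - 1) + beta4 n α i * s)

/-- The value `(u | α_{2i+1}^∨)` for the Cartan part `u` of `B` (`1 ≤ i ≤ n - 1`). -/
def uOdd (n : ℕ) (α : ℕ → ℂ) (s : ℂ) (q p : ℕ → ℂ) (i : ℕ) : ℂ :=
  (sumS s q p i + beta1 α i + 2 * α (2 * i)) * (q i + q (i + 1) - 1)
    + α (2 * i + 1) * (q (i + 1) + s - 1) + sumT n α q p (i + 1)
    + (2 * α (2 * i + 2) + beta3 n α (i + 1)) * (s - 1) + beta4 n α (i + 1) * s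

/-- The values `(u | α_k^∨)`, `0 ≤ k ≤ 2n+2`, for the Cartan part `u` of `B`. -/
def uForm (n : ℕ) (α : ℕ → ℂ) (s : ℂ) (q p : ℕ → ℂ) (k : ℕ) : ℂ :=
  if k = 0 then α 0 * (q 1 - s)
  else if k = 1 then
    α 0 * (q 1 + s - 1) + sumT n α q p 1 + (2 * α 2 + beta3 n α 1) * (s - 1) + beta4 n α 1 * s
  else if k = 2 * n + 1 then
    (sumS s q p n + beta1 α n + 2 * α (2 * n)) * q n + α (2 * n + 2) * s
  else if k = 2 * n + 2 then
    (sumS s q p n + beta1 α n + 2 * α (2 * n)) * (q n - 1) + α (2 * n + 1) * (s - 1)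
  else if k % 2 = 0 then uEven n α s q p (k / 2)
  else uOdd n α s q p (k / 2)

/-- `B = u + (nilpotent part)`, with `u = ∑ u_k α_k^∨` having the prescribed values
`(u | α_k^∨)`. This fixes `B` up to a multiple of the central element. -/
def IsLaxB (n : ℕ) (α : ℕ → ℂ) (s : ℂ) (q p : ℕ → ℂ) (B : AffD n) : Prop :=
  ∃ u : ℕ → ℂ, (∀ k ∈ range (2 * n + 3), hForm n u 0 k = uForm n α s q p k) ∧
    B = hElt n u 0 + laxBnil n α s q p

/-- `[s(s-1) d/ds - B, 𝓜⁺] = 0` on `U`, that is, `s(s-1) d𝓜⁺/ds = [B, 𝓜⁺]`. -/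
def IsLaxSolution (n : ℕ) (U : Set ℂ) (κ : ℕ → ℂ) (κd : ℂ) (q p : ℕ → ℂ → ℂ) : Prop :=
  ∀ s ∈ U, ∃ B M' : AffD n,
    IsLaxB n (alph n κ κd) s (fun i => q i s) (fun i => p i s) B ∧
    HasDerivW (fun z => laxM n κ κd z (fun i => q i z) (fun i => p i z)) M' s ∧
    (s * (s - 1)) • M' = ⁅B, laxM n κ κd s (fun i => q i s) (fun i => p i s)⁆

end CoupledPVI

end

open CoupledPVI

/-!
The theorem is proved by writing every operator in explicit coordinates and comparing coefficients.
All operators that occur lie in the span of the Cartan subalgebra, of the `e_{2i}` and `f_{2i}`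
(degree zero in the gradation of type `(1,1,0,1,0,…,1,0,1,1)`), and of the root vectors of degree one.
The latter fall into `n + 1` blocks of four vectors, on which the commuting copies of `𝔰𝔩₂` generated
by the `e_{2i}`, `f_{2i}` act in a simple way. The structure `Coord` records the coefficients and `elt`
is the element with given coefficients. Brackets with elements of degree zero, the exponentials of
`ad Γ₁`, `ad Γ₂`, `ad Γ₃` (`expE`, `expH`, `expF`), and derivatives are computed on `Coord`.

*Independence.* The Lie algebra is given by generators and relations, so that comparing coefficients
needs a representation. The loop realization `loopRep` by the Lie algebra `𝔰𝔬_{4n+4}` with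
coefficients in Laurent polynomials, extended by the degree operator, sends the root vectors in
question to matrices with disjoint supports; hence the coefficients of an element are unique
(`coef_eq_of_elt_eq`). Elements of the Borel subalgebra act by triangular matrices and have no
component along the `f_{2i}` (`coord_y_eq_zero`). The loop realization kills the central element, so
the Cartan part is not compared there: it is only compared within `𝔤`.

*The ODE is Sasano's system.* Bracketing with an element of the Cartan subalgebra which defines the
gradation (`exists_grading`) separates the degrees in the Lax equation. The part of degree two vanishes
identically, because neighbouring blocks of `B` and `𝓜⁺` satisfy a few bilinear identities
(`blockSum_lie_eq_zero`, `laxB_degOne_lie`). The rest is a list of scalar equations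
(`laxMDeriv_eq_iff`). Those without derivatives, `LaxAlg`, are satisfied by the prescribed
coefficients of `B` (`laxAlg_uForm`), and determine these up to the value of the Cartan part at the
imaginary root `δ` (`LaxAlg.unique`). Those with derivatives, `LaxDyn`, say that the velocity of
`(q, p)` is the Hamiltonian vector field (`laxDyn_ham`, `LaxDyn.eq_ham`). For the Cartan part of `B`
to exist its prescribed values have to vanish at `δ`, which they do (`sum_uForm`). The normalization of
the parameters says that `δ` takes the value `2n+2` at `κ`, that is, that `κ` has the coefficient
`2n+2` at `d` (`normalized_iff`, `exists_alph_eq`).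

*The similarity reduction.* Lax equations are preserved by gauge transformations, also along curves
(`exists_hasDerivC_gauge`), so that `𝓜⁺` satisfies the Lax equation with the `B_k⁺`. A bracket in
`𝔟₊` has no component in the Cartan subalgebra, so that the Cartan part of `𝓜⁺` is constant
(`hElt_gaugedMCoord_eq`); its coefficient at `d` is that of `ϑ`, namely `2n+2` (`theta_d`).

The normalization of `Γ₁` and `Γ₂` amounts to scalar equations `NormalEqs` for the values `E_j` of
the torus element `exp(Γ₂)` at the simple roots. With the scale `G = -t₁E₁` they give
`b_1 = G γ_2`, `b_{2i+1} = G (γ_{2i+2} - γ_{2i})`, and, defining `γ_{2n+2}` by the same recursion,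
`(2n+2) s₁ γ_{2n+2} = -G` and `(2n+2)(s₁ - s₂) = -G γ_{2n+2}`. Moreover `s₂` is a constant multiple of
`(t₂² - t₁²)^{n+1}` (`NormalEqs.s2_eq`), the constant being the value of the torus element at `δ`.
So `t₂² - t₁²` is stationary along a curve with `s₂ = 1`, and if `s₁` is the parameter then the velocity
is `-(t₂, t₁)/G` (`curve_velocity`). With this velocity the part of degree one of
`s(s-1) ∑ T_k' B_k⁺` is that of the operator `B` of the ODE (`gaugedBCoord_blocks_eq`). Its other
coefficients need not be computed: they satisfy `LaxAlg`, since `𝓜⁺` satisfies the Lax equation, and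
the coefficient of `d` is zero, so that they are those of `B` by uniqueness (`isLaxB_of_curve`).
-/

namespace CoupledPVI

open Finset

/-! ### The loop realization -/

section loopRealization

attribute [local instance] LieRing.ofAssociativeRing

/-- The loop space; the coordinate `(a, m)` belongs to the basis vector `z ^ m v_a`. All integers are
allowed as `a`, not only the `4n+4` indices of the natural representation: the superfluous
coordinates do no harm. Infinite sums of basis vectors are allowed as well. -/
def LoopSpace : Type := ℤ × ℤ → ℂ

noncomputable instance : AddCommGroup LoopSpace := inferInstanceAs (AddCommGroup (ℤ × ℤ → ℂ))

noncomputable instance : Module ℂ LoopSpace := inferInstanceAs (Module ℂ (ℤ × ℤ → ℂ))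

@[ext] lemma LoopSpace.ext {f g : LoopSpace} (h : ∀ a : ℤ × ℤ, f a = g a) : f = g := funext h

namespace LoopSpace

lemma add_apply (f g : LoopSpace) (a : ℤ × ℤ) : (f + g) a = f a + g a := rfl

lemma sub_apply (f g : LoopSpace) (a : ℤ × ℤ) : (f - g) a = f a - g a := rfl

lemma smul_apply (c : ℂ) (f : LoopSpace) (a : ℤ × ℤ) : (c • f) a = c * f a := rfl

lemma zero_apply (a : ℤ × ℤ) : (0 : LoopSpace) a = 0 := rfl

end LoopSpace

/-- The coordinate functionals on the loop space. -/
def loopCoord (a : ℤ × ℤ) : LoopSpace →ₗ[ℂ] ℂ where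
  toFun f := f a
  map_add' _ _ := rfl
  map_smul' _ _ := rfl

/-- The operator `z ^ k E_{x,y}`. -/
noncomputable def matUnit (x y k : ℤ) : Module.End ℂ LoopSpace where
  toFun f a := if a.1 = x then f (y, a.2 - k) else 0
  map_add' f g := by
    ext a
    change (if _ then f _ + g _ else 0) = (if _ then f _ else 0) + (if _ then g _ else 0)
    split_ifs <;> simp
  map_smul' c f := by
    ext a
    change (if _ then c * f _ else 0) = c * (if _ then f _ else 0)
    split_ifs <;> simp

lemma matUnit_apply (x y k : ℤ) (f : LoopSpace) (a : ℤ × ℤ) :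
    matUnit x y k f a = if a.1 = x then f (y, a.2 - k) else 0 := rfl

lemma matUnit_mul (x y k w v l : ℤ) :
    matUnit x y k * matUnit w v l = if y = w then matUnit x v (k + l) else 0 := by
  ext f a
  rw [Module.End.mul_apply, matUnit_apply]
  split_ifs with h1 h2 h2
  · simp [matUnit_apply, h1, h2, sub_sub]
  · simp [matUnit_apply, h2, LoopSpace.zero_apply]
  · simp [matUnit_apply, h1]
  · simp [LoopSpace.zero_apply]

/-- The degree operator `z d/dz`. -/
noncomputable def loopDeg : Module.End ℂ LoopSpace where
  toFun f a := (a.2 : ℂ) * f a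
  map_add' f g := by ext a; exact mul_add _ _ _
  map_smul' c f := by ext a; exact mul_left_comm _ _ _

lemma loopDeg_apply (f : LoopSpace) (a : ℤ × ℤ) : loopDeg f a = (a.2 : ℂ) * f a := rfl

/-- `z ^ k (E_{x,y} - E_{-y,-x})`, a root vector or a Cartan element of the loop algebra of the
even orthogonal Lie algebra; negative indices stand for the dual basis vectors. -/
noncomputable def soUnit (x y k : ℤ) : Module.End ℂ LoopSpace :=
  matUnit x y k - matUnit (-y) (-x) k

lemma soUnit_neg (x y k : ℤ) : soUnit (-y) (-x) k = -soUnit x y k := by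
  simp [soUnit]

lemma soUnit_self_neg (x k : ℤ) : soUnit x (-x) k = 0 := by
  simp [soUnit]

lemma loopDeg_soUnit (x y k : ℤ) : ⁅loopDeg, soUnit x y k⁆ = (k : ℂ) • soUnit x y k := by
  ext f a
  simp only [Ring.lie_def, LinearMap.sub_apply, Module.End.mul_apply, soUnit,
    LoopSpace.sub_apply, loopDeg_apply, map_sub, matUnit_apply, LinearMap.smul_apply,
    LoopSpace.smul_apply]
  split_ifs <;> push_cast <;> ring

lemma soUnit_lie (x y k w v l : ℤ) :
    ⁅soUnit x y k, soUnit w v l⁆ =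
      (if y = w then soUnit x v (k + l) else 0) - (if v = x then soUnit w y (k + l) else 0)
      - (if y = -v then soUnit x (-w) (k + l) else 0)
      + (if x = -w then soUnit (-v) y (k + l) else 0) := by
  simp only [soUnit, Ring.lie_def, mul_sub, sub_mul, matUnit_mul, neg_inj, neg_neg, add_comm l k]
  have e1 : (-x = w) ↔ (x = -w) := by omega
  have e2 : (-w = x) ↔ (x = -w) := by omega
  have e3 : (v = -y) ↔ (y = -v) := by omega
  have e5 : (w = y) ↔ (y = w) := by omega
  have e6 : (x = v) ↔ (v = x) := by omega
  simp only [e1, e2, e3, e5, e6]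
  split_ifs <;> abel

lemma soUnit_diag_lie (a w v l : ℤ) :
    ⁅soUnit a a 0, soUnit w v l⁆ =
      (((if a = w then 1 else 0) - (if a = -w then 1 else 0) - (if a = v then 1 else 0)
        + (if a = -v then 1 else 0) : ℤ) : ℂ) • soUnit w v l := by
  rw [soUnit_lie]
  have h1 : (if a = w then soUnit a v (0 + l) else 0)
      = (((if a = w then 1 else 0 : ℤ)) : ℂ) • soUnit w v l := by
    split_ifs with h <;> simp [h]
  have h2 : (if v = a then soUnit w a (0 + l) else 0)
      = (((if a = v then 1 else 0 : ℤ)) : ℂ) • soUnit w v l := by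
    simp only [eq_comm (a := v) (b := a)]
    split_ifs with h <;> simp [h]
  have h3 : (if a = -v then soUnit a (-w) (0 + l) else 0)
      = -(((if a = -v then 1 else 0 : ℤ)) : ℂ) • soUnit w v l := by
    split_ifs with h
    · rw [h, soUnit_neg, zero_add]; push_cast; module
    · simp
  have h4 : (if a = -w then soUnit (-v) a (0 + l) else 0)
      = -(((if a = -w then 1 else 0 : ℤ)) : ℂ) • soUnit w v l := by
    split_ifs with h
    · rw [h, soUnit_neg, zero_add]; push_cast; module
    · simp
  rw [h1, h2, h3, h4]
  push_cast
  module

/-- The root vector of the simple root with index `i` is `soUnit (rowIx n i) (colIx n i)` with the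
loop degree `degIx i`: the simple roots are `δ - ε₁ - ε₂`, `ε_i - ε_{i+1}` and
`ε_{2n+1} + ε_{2n+2}`. -/
def rowIx (n i : ℕ) : ℤ := if i = 0 then -2 else if i = 2 * n + 2 then 2 * n + 1 else i

/-- The column index of the root vector of the `i`-th simple root. -/
def colIx (n i : ℕ) : ℤ := if i = 0 then 1 else if i = 2 * n + 2 then -(2 * n + 2) else i + 1

/-- The loop degree of the root vector of the `i`-th simple root. -/
def degIx (i : ℕ) : ℤ := if i = 0 then 1 else 0

/-- The images of the generators in the loop realization. -/
noncomputable def loopGen (n : ℕ) : Gen n → Module.End ℂ LoopSpace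
  | Gen.e i => soUnit (rowIx n i) (colIx n i) (degIx i)
  | Gen.f i => soUnit (colIx n i) (rowIx n i) (-degIx i)
  | Gen.h i => soUnit (rowIx n i) (rowIx n i) 0 - soUnit (colIx n i) (colIx n i) 0
  | Gen.d => loopDeg

lemma index_cases {n i : ℕ} (h : i < 2 * n + 3) :
    (i = 0 ∧ rowIx n i = -2 ∧ colIx n i = 1) ∨
    ((1 ≤ i ∧ i ≤ 2 * n + 1) ∧ rowIx n i = i ∧ colIx n i = i + 1) ∨
    (i = 2 * n + 2 ∧ rowIx n i = 2 * n + 1 ∧ colIx n i = -(2 * n + 2)) := by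
  unfold rowIx colIx
  split_ifs <;> omega

/-- Adjacency of two nodes of the Dynkin diagram. -/
def Adj (n i j : ℕ) : Prop := (i = 0 ∧ j = 2) ∨ (j = 0 ∧ i = 2)
      ∨ (1 ≤ i ∧ i ≤ 2 * n ∧ j = i + 1) ∨ (1 ≤ j ∧ j ≤ 2 * n ∧ i = j + 1)
      ∨ (i = 2 * n ∧ j = 2 * n + 2) ∨ (j = 2 * n ∧ i = 2 * n + 2)

lemma cartan_self (n i : ℕ) : cartan n i i = 2 := if_pos rfl

lemma cartan_adj {n i j : ℕ} (hij : i ≠ j) (h : Adj n i j) : cartan n i j = -1 := by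
  rw [cartan, if_neg hij]; exact if_pos h

lemma cartan_not_adj {n i j : ℕ} (hij : i ≠ j) (h : ¬Adj n i j) : cartan n i j = 0 := by
  rw [cartan, if_neg hij]; exact if_neg h

/-- The Cartan integer as a pairing of roots. -/
lemma cartan_eq_weight {n i j : ℕ} (hn : 1 ≤ n) (hi : i < 2 * n + 3) (hj : j < 2 * n + 3) :
    cartan n i j =
      (((if rowIx n i = rowIx n j then 1 else 0) - (if rowIx n i = -rowIx n j then 1 else 0)
        - (if rowIx n i = colIx n j then 1 else 0) + (if rowIx n i = -colIx n j then 1 else 0))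
      - ((if colIx n i = rowIx n j then 1 else 0) - (if colIx n i = -rowIx n j then 1 else 0)
        - (if colIx n i = colIx n j then 1 else 0)
        + (if colIx n i = -colIx n j then 1 else 0)) : ℤ) := by
  have hc : cartan n i j = 2 ∧ i = j ∨ cartan n i j = -1 ∧ i ≠ j ∧ Adj n i j ∨
      cartan n i j = 0 ∧ i ≠ j ∧ ¬Adj n i j := by
    by_cases h : i = j
    · exact Or.inl ⟨h ▸ cartan_self n i, h⟩
    · by_cases h' : Adj n i j
      · exact Or.inr (Or.inl ⟨cartan_adj h h', h, h'⟩)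
      · exact Or.inr (Or.inr ⟨cartan_not_adj h h', h, h'⟩)
  generalize cartan n i j = c at hc ⊢
  simp only [Adj] at hc
  have hi' := index_cases hi
  have hj' := index_cases hj
  generalize rowIx n i = x at *
  generalize colIx n i = y at *
  generalize rowIx n j = w at *
  generalize colIx n j = v at *
  obtain h1 | h1 | h1 := hi' <;> obtain h2 | h2 | h2 := hj' <;>
    obtain ⟨h1, rfl, rfl⟩ := h1 <;> obtain ⟨h2, rfl, rfl⟩ := h2 <;>
    grind (splits := 30)

lemma ite_soUnit_eq_zero {p : Prop} [Decidable p] {x y k : ℤ} (h : p → y = -x) :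
    (if p then soUnit x y k else 0) = 0 := by
  split_ifs with hp
  · rw [h hp, soUnit_self_neg]
  · rfl

lemma soUnit_lie_eq_zero {x y k w v l : ℤ} (h1 : y = w → v = -x) (h2 : v = x → y = -w)
    (h3 : y = -v → -w = -x) (h4 : x = -w → y = - -v) :
    ⁅soUnit x y k, soUnit w v l⁆ = 0 := by
  rw [soUnit_lie, ite_soUnit_eq_zero h1, ite_soUnit_eq_zero h2, ite_soUnit_eq_zero h3,
    ite_soUnit_eq_zero h4]
  simp

/-- Simple root vectors with orthogonal roots commute. -/
lemma loop_comm {n i j : ℕ} (hn : 1 ≤ n) (hi : i < 2 * n + 3) (hj : j < 2 * n + 3)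
    (h : ¬Adj n i j) (k l : ℤ) :
    ⁅soUnit (rowIx n i) (colIx n i) k, soUnit (rowIx n j) (colIx n j) l⁆ = 0 ∧
    ⁅soUnit (colIx n i) (rowIx n i) k, soUnit (colIx n j) (rowIx n j) l⁆ = 0 := by
  simp only [Adj] at h
  have hi' := index_cases hi
  have hj' := index_cases hj
  constructor <;> apply soUnit_lie_eq_zero <;> omega

/-- Positive and negative simple root vectors with different indices commute. -/
lemma loop_comm_opp {n i j : ℕ} (hn : 1 ≤ n) (hi : i < 2 * n + 3) (hj : j < 2 * n + 3)
    (hij : i ≠ j) (k l : ℤ) :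
    ⁅soUnit (rowIx n i) (colIx n i) k, soUnit (colIx n j) (rowIx n j) l⁆ = 0 := by
  have hi' := index_cases hi
  have hj' := index_cases hj
  apply soUnit_lie_eq_zero <;> omega

lemma soUnit_lie_lie_eq_zero {x y k w v l : ℤ} (hxy : x ≠ y) (hx : x ≠ 0) (hy : y ≠ 0)
    (hxy' : x ≠ -y) (h : ¬ (y = w ∧ v = x)) (h' : ¬ (y = -v ∧ x = -w)) :
    ⁅soUnit x y k, ⁅soUnit x y k, soUnit w v l⁆⁆ = 0 := by
  rw [soUnit_lie x y k w v l, lie_add, lie_sub, lie_sub]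
  have e1 : ⁅soUnit x y k, if y = w then soUnit x v (k + l) else 0⁆ = 0 := by
    split_ifs
    · apply soUnit_lie_eq_zero <;> omega
    · simp
  have e2 : ⁅soUnit x y k, if v = x then soUnit w y (k + l) else 0⁆ = 0 := by
    split_ifs
    · apply soUnit_lie_eq_zero <;> omega
    · simp
  have e3 : ⁅soUnit x y k, if y = -v then soUnit x (-w) (k + l) else 0⁆ = 0 := by
    split_ifs
    · apply soUnit_lie_eq_zero <;> omega
    · simp
  have e4 : ⁅soUnit x y k, if x = -w then soUnit (-v) y (k + l) else 0⁆ = 0 := by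
    split_ifs
    · apply soUnit_lie_eq_zero <;> omega
    · simp
  rw [e1, e2, e3, e4]
  simp

/-- The Serre relation for two different simple roots. -/
lemma loop_serre {n i j : ℕ} (hn : 1 ≤ n) (hi : i < 2 * n + 3) (hj : j < 2 * n + 3)
    (k l : ℤ) :
    ⁅soUnit (rowIx n i) (colIx n i) k,
      ⁅soUnit (rowIx n i) (colIx n i) k, soUnit (rowIx n j) (colIx n j) l⁆⁆ = 0 ∧
    ⁅soUnit (colIx n i) (rowIx n i) k,
      ⁅soUnit (colIx n i) (rowIx n i) k, soUnit (colIx n j) (rowIx n j) l⁆⁆ = 0 := by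
  have hi' := index_cases hi
  have hj' := index_cases hj
  constructor <;> apply soUnit_lie_lie_eq_zero <;> omega

lemma soUnit_lie_opp {x y : ℤ} (hxy' : x ≠ -y) (k : ℤ) :
    ⁅soUnit x y k, soUnit y x (-k)⁆ = soUnit x x 0 - soUnit y y 0 := by
  rw [soUnit_lie, if_pos rfl, if_pos rfl, if_neg (by omega), if_neg (by omega)]
  simp

lemma soUnit_diag_comm (a b : ℤ) : ⁅soUnit a a 0, soUnit b b 0⁆ = 0 := by
  rw [soUnit_diag_lie]
  convert zero_smul ℂ _ using 2
  rw [Int.cast_eq_zero]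
  ring

lemma rowIx_ne_neg_colIx {n i : ℕ} (hi : i < 2 * n + 3) : rowIx n i ≠ -colIx n i := by
  have hi' := index_cases hi
  omega

lemma ad_sq_apply {L : Type*} [LieRing L] [LieAlgebra ℂ L] (x y : L) :
    ((LieAlgebra.ad ℂ L x) ^ 2) y = ⁅x, ⁅x, y⁆⁆ := by
  rw [pow_two, Module.End.mul_apply, LieAlgebra.ad_apply, LieAlgebra.ad_apply]

/-- The loop realization respects the fundamental relations. -/
lemma lift_loopGen_eq_zero {n : ℕ} (hn : 1 ≤ n) {r : FreeLieAlgebra ℂ (Gen n)}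
    (hr : SerreRel n r) : FreeLieAlgebra.lift ℂ (loopGen n) r = 0 := by
  have hcart : ∀ (i : Fin (2 * n + 3)) (w v l : ℤ), ⁅soUnit (rowIx n i) (rowIx n i) 0 -
      soUnit (colIx n i) (colIx n i) 0, soUnit w v l⁆ =
      (((((if rowIx n i = w then 1 else 0) - (if rowIx n i = -w then 1 else 0)
        - (if rowIx n i = v then 1 else 0) + (if rowIx n i = -v then 1 else 0))
      - ((if colIx n i = w then 1 else 0) - (if colIx n i = -w then 1 else 0)
        - (if colIx n i = v then 1 else 0)
        + (if colIx n i = -v then 1 else 0)) : ℤ)) : ℂ) • soUnit w v l := by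
    intro i w v l
    rw [sub_lie, soUnit_diag_lie, soUnit_diag_lie, ← sub_smul, ← Int.cast_sub]
  cases hr with
  | hh i j =>
    simp only [LieHom.map_lie, FreeLieAlgebra.lift_of_apply, loopGen, sub_lie, lie_sub,
      soUnit_diag_comm, sub_zero]
  | he i j =>
    simp only [LieHom.map_lie, map_sub, map_smul, FreeLieAlgebra.lift_of_apply, loopGen, hcart]
    rw [cartan_eq_weight hn i.2 j.2, sub_self]
  | hf i j =>
    simp only [LieHom.map_lie, map_add, map_smul, FreeLieAlgebra.lift_of_apply, loopGen, hcart]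
    rw [cartan_eq_weight hn i.2 j.2, ← add_smul, ← Int.cast_add]
    convert zero_smul ℂ _ using 2
    rw [Int.cast_eq_zero]
    ring
  | ef_same i =>
    simp only [LieHom.map_lie, map_sub, FreeLieAlgebra.lift_of_apply, loopGen]
    rw [soUnit_lie_opp (rowIx_ne_neg_colIx i.2), sub_self]
  | ef_ne i j hij =>
    simp only [LieHom.map_lie, FreeLieAlgebra.lift_of_apply, loopGen]
    exact loop_comm_opp hn i.2 j.2 (fun h => hij (Fin.ext h)) _ _
  | serre_e i j hij =>
    have hij' : (i : ℕ) ≠ j := fun h => hij (Fin.ext h)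
    by_cases h : Adj n i j
    · rw [cartan_adj hij' h]
      rw [show (1 - -1 : ℤ).toNat = 2 from rfl, ad_sq_apply]
      simp only [LieHom.map_lie, FreeLieAlgebra.lift_of_apply, loopGen]
      exact (loop_serre hn i.2 j.2 _ _).1
    · rw [cartan_not_adj hij' h]
      rw [show (1 - 0 : ℤ).toNat = 1 from rfl, pow_one, LieAlgebra.ad_apply]
      simp only [LieHom.map_lie, FreeLieAlgebra.lift_of_apply, loopGen]
      exact (loop_comm hn i.2 j.2 h _ _).1
  | serre_f i j hij =>
    have hij' : (i : ℕ) ≠ j := fun h => hij (Fin.ext h)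
    by_cases h : Adj n i j
    · rw [cartan_adj hij' h]
      rw [show (1 - -1 : ℤ).toNat = 2 from rfl, ad_sq_apply]
      simp only [LieHom.map_lie, FreeLieAlgebra.lift_of_apply, loopGen]
      exact (loop_serre hn i.2 j.2 _ _).2
    · rw [cartan_not_adj hij' h]
      rw [show (1 - 0 : ℤ).toNat = 1 from rfl, pow_one, LieAlgebra.ad_apply]
      simp only [LieHom.map_lie, FreeLieAlgebra.lift_of_apply, loopGen]
      exact (loop_comm hn i.2 j.2 h _ _).2
  | dh i =>
    simp only [LieHom.map_lie, FreeLieAlgebra.lift_of_apply, loopGen, lie_sub, loopDeg_soUnit]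
    simp
  | de_zero =>
    simp only [LieHom.map_lie, map_sub, FreeLieAlgebra.lift_of_apply, loopGen, loopDeg_soUnit]
    simp [degIx]
  | df_zero =>
    simp only [LieHom.map_lie, map_add, FreeLieAlgebra.lift_of_apply, loopGen, loopDeg_soUnit]
    simp [degIx]
  | de_ne i hi =>
    have hi' : (i : ℕ) ≠ 0 := fun h => hi (Fin.ext h)
    simp only [LieHom.map_lie, FreeLieAlgebra.lift_of_apply, loopGen, loopDeg_soUnit]
    simp [degIx, hi']
  | df_ne i hi =>
    have hi' : (i : ℕ) ≠ 0 := fun h => hi (Fin.ext h)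
    simp only [LieHom.map_lie, FreeLieAlgebra.lift_of_apply, loopGen, loopDeg_soUnit]
    simp [degIx, hi']

/-- The loop realization as a linear map on `𝔤`. -/
noncomputable def loopRep {n : ℕ} (hn : 1 ≤ n) : AffD n →ₗ[ℂ] Module.End ℂ LoopSpace :=
  (relIdeal n).toSubmodule.liftQ (FreeLieAlgebra.lift ℂ (loopGen n) : _ →ₗ[ℂ] _) (by
    have h : relIdeal n ≤ (FreeLieAlgebra.lift ℂ (loopGen n)).ker := by
      rw [relIdeal, LieSubmodule.lieSpan_le]
      intro r hr
      exact LieHom.mem_ker.2 (lift_loopGen_eq_zero hn hr)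
    intro x hx
    exact LieHom.mem_ker.1 (h hx))

lemma loopRep_lie {n : ℕ} (hn : 1 ≤ n) (x y : AffD n) :
    loopRep hn ⁅x, y⁆ = ⁅loopRep hn x, loopRep hn y⁆ := by
  induction x using Submodule.Quotient.induction_on with | H x => ?_
  induction y using Submodule.Quotient.induction_on with | H y => ?_
  exact LieHom.map_lie (FreeLieAlgebra.lift ℂ (loopGen n)) x y

lemma loopRep_gen {n : ℕ} (hn : 1 ≤ n) (x : Gen n) : loopRep hn (gen n x) = loopGen n x :=
  FreeLieAlgebra.lift_of_apply (R := ℂ) (loopGen n) x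

end loopRealization

/-! ### Relations among the Chevalley generators -/

lemma mk_eq_zero_of_rel {n : ℕ} {r : FreeLieAlgebra ℂ (Gen n)} (hr : SerreRel n r) :
    (LieSubmodule.Quotient.mk r : AffD n) = 0 :=
  LieSubmodule.Quotient.mk_eq_zero'.2 (LieSubmodule.subset_lieSpan hr)

lemma chE_of_lt {n k : ℕ} (hk : k < 2 * n + 3) : chE n k = gen n (Gen.e ⟨k, hk⟩) := dif_pos hk

lemma chF_of_lt {n k : ℕ} (hk : k < 2 * n + 3) : chF n k = gen n (Gen.f ⟨k, hk⟩) := dif_pos hk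

lemma chH_of_lt {n k : ℕ} (hk : k < 2 * n + 3) : chH n k = gen n (Gen.h ⟨k, hk⟩) := dif_pos hk

lemma chE_of_ge {n k : ℕ} (hk : ¬k < 2 * n + 3) : chE n k = 0 := dif_neg hk

lemma chF_of_ge {n k : ℕ} (hk : ¬k < 2 * n + 3) : chF n k = 0 := dif_neg hk

lemma chH_of_ge {n k : ℕ} (hk : ¬k < 2 * n + 3) : chH n k = 0 := dif_neg hk

lemma chH_lie_chH (n i j : ℕ) : ⁅chH n i, chH n j⁆ = 0 := by
  by_cases hi : i < 2 * n + 3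
  · by_cases hj : j < 2 * n + 3
    · rw [chH_of_lt hi, chH_of_lt hj]
      exact mk_eq_zero_of_rel (SerreRel.hh _ _)
    · rw [chH_of_ge hj, lie_zero]
  · rw [chH_of_ge hi, zero_lie]

lemma chH_lie_chE {n i : ℕ} (hi : i < 2 * n + 3) (j : ℕ) :
    ⁅chH n i, chE n j⁆ = (cartan n i j : ℂ) • chE n j := by
  by_cases hj : j < 2 * n + 3
  · rw [chH_of_lt hi, chE_of_lt hj]
    exact sub_eq_zero.1 (mk_eq_zero_of_rel (SerreRel.he ⟨i, hi⟩ ⟨j, hj⟩))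
  · rw [chE_of_ge hj, lie_zero, smul_zero]

lemma chH_lie_chF {n i : ℕ} (hi : i < 2 * n + 3) (j : ℕ) :
    ⁅chH n i, chF n j⁆ = -(cartan n i j : ℂ) • chF n j := by
  by_cases hj : j < 2 * n + 3
  · rw [chH_of_lt hi, chF_of_lt hj, neg_smul]
    exact eq_neg_of_add_eq_zero_left (mk_eq_zero_of_rel (SerreRel.hf ⟨i, hi⟩ ⟨j, hj⟩))
  · rw [chF_of_ge hj, lie_zero, smul_zero]

lemma chE_lie_chF_self (n i : ℕ) : ⁅chE n i, chF n i⁆ = chH n i := by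
  by_cases hi : i < 2 * n + 3
  · rw [chE_of_lt hi, chF_of_lt hi, chH_of_lt hi]
    exact sub_eq_zero.1 (mk_eq_zero_of_rel (SerreRel.ef_same ⟨i, hi⟩))
  · rw [chE_of_ge hi, chH_of_ge hi, zero_lie]

lemma chE_lie_chF {n i j : ℕ} (hij : i ≠ j) : ⁅chE n i, chF n j⁆ = 0 := by
  by_cases hi : i < 2 * n + 3
  · by_cases hj : j < 2 * n + 3
    · rw [chE_of_lt hi, chF_of_lt hj]
      exact mk_eq_zero_of_rel (SerreRel.ef_ne _ _ (by simpa [Fin.ext_iff] using hij))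
    · rw [chF_of_ge hj, lie_zero]
  · rw [chE_of_ge hi, zero_lie]

lemma chF_lie_chE {n i j : ℕ} (hij : i ≠ j) : ⁅chF n i, chE n j⁆ = 0 := by
  rw [← lie_skew, chE_lie_chF hij.symm, neg_zero]

lemma chF_lie_chE_self (n i : ℕ) : ⁅chF n i, chE n i⁆ = -chH n i := by
  rw [← lie_skew, chE_lie_chF_self]

lemma chE_lie_chE {n i j : ℕ} (h : ¬Adj n i j) : ⁅chE n i, chE n j⁆ = 0 := by
  by_cases hij : i = j
  · rw [hij, lie_self]
  by_cases hi : i < 2 * n + 3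
  · by_cases hj : j < 2 * n + 3
    · rw [chE_of_lt hi, chE_of_lt hj]
      have := mk_eq_zero_of_rel (SerreRel.serre_e ⟨i, hi⟩ ⟨j, hj⟩
        (by simpa [Fin.ext_iff] using hij))
      rwa [cartan_not_adj hij h, show (1 - 0 : ℤ).toNat = 1 from rfl, pow_one,
        LieAlgebra.ad_apply] at this
    · rw [chE_of_ge hj, lie_zero]
  · rw [chE_of_ge hi, zero_lie]

lemma chF_lie_chF {n i j : ℕ} (h : ¬Adj n i j) : ⁅chF n i, chF n j⁆ = 0 := by
  by_cases hij : i = j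
  · rw [hij, lie_self]
  by_cases hi : i < 2 * n + 3
  · by_cases hj : j < 2 * n + 3
    · rw [chF_of_lt hi, chF_of_lt hj]
      have := mk_eq_zero_of_rel (SerreRel.serre_f ⟨i, hi⟩ ⟨j, hj⟩
        (by simpa [Fin.ext_iff] using hij))
      rwa [cartan_not_adj hij h, show (1 - 0 : ℤ).toNat = 1 from rfl, pow_one,
        LieAlgebra.ad_apply] at this
    · rw [chF_of_ge hj, lie_zero]
  · rw [chF_of_ge hi, zero_lie]

lemma chE_serre (n i j : ℕ) : ⁅chE n i, ⁅chE n i, chE n j⁆⁆ = 0 := by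
  by_cases h : Adj n i j
  · by_cases hij : i = j
    · rw [hij, lie_self, lie_zero]
    by_cases hi : i < 2 * n + 3
    · by_cases hj : j < 2 * n + 3
      · rw [chE_of_lt hi, chE_of_lt hj]
        have := mk_eq_zero_of_rel (SerreRel.serre_e ⟨i, hi⟩ ⟨j, hj⟩
          (by simpa [Fin.ext_iff] using hij))
        rwa [cartan_adj hij h, show (1 - -1 : ℤ).toNat = 2 from rfl, ad_sq_apply] at this
      · rw [chE_of_ge hj, lie_zero, lie_zero]
    · rw [chE_of_ge hi, zero_lie]
  · rw [chE_lie_chE h, lie_zero]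

lemma chE_serre' (n i j : ℕ) : ⁅chE n i, ⁅chE n j, chE n i⁆⁆ = 0 := by
  rw [← lie_skew (chE n j), lie_neg, chE_serre, neg_zero]

lemma chD_lie_chH (n i : ℕ) : ⁅chD n, chH n i⁆ = 0 := by
  by_cases hi : i < 2 * n + 3
  · rw [chH_of_lt hi]
    exact mk_eq_zero_of_rel (SerreRel.dh _)
  · rw [chH_of_ge hi, lie_zero]

lemma chD_lie_chE (n i : ℕ) : ⁅chD n, chE n i⁆ = (if i = 0 then (1 : ℂ) else 0) • chE n i := by
  by_cases hi : i < 2 * n + 3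
  · rw [chE_of_lt hi]
    split_ifs with h
    · subst h
      rw [one_smul]
      exact sub_eq_zero.1 (mk_eq_zero_of_rel SerreRel.de_zero)
    · rw [zero_smul]
      exact mk_eq_zero_of_rel (SerreRel.de_ne _ (by simpa [Fin.ext_iff] using h))
  · rw [chE_of_ge hi, lie_zero, smul_zero]

lemma chD_lie_chF (n i : ℕ) : ⁅chD n, chF n i⁆ = -(if i = 0 then (1 : ℂ) else 0) • chF n i := by
  by_cases hi : i < 2 * n + 3
  · rw [chF_of_lt hi]
    split_ifs with h
    · subst h
      rw [neg_smul, one_smul]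
      exact eq_neg_of_add_eq_zero_left (mk_eq_zero_of_rel SerreRel.df_zero)
    · rw [neg_zero, zero_smul]
      exact mk_eq_zero_of_rel (SerreRel.df_ne _ (by simpa [Fin.ext_iff] using h))
  · rw [chF_of_ge hi, lie_zero, smul_zero]

/-! ### The Cartan subalgebra -/

lemma hElt_lie_chE (n : ℕ) (c : ℕ → ℂ) (a : ℂ) (j : ℕ) :
    ⁅hElt n c a, chE n j⁆ = hForm n c a j • chE n j := by
  rw [hElt, hForm, add_lie, sum_lie, smul_lie, chD_lie_chE, add_smul, sum_smul]
  congr 1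
  · refine sum_congr rfl fun k hk => ?_
    rw [smul_lie, chH_lie_chE (mem_range.1 hk), smul_smul]
  · rw [smul_smul, mul_ite, mul_one, mul_zero]

lemma hElt_lie_chF (n : ℕ) (c : ℕ → ℂ) (a : ℂ) (j : ℕ) :
    ⁅hElt n c a, chF n j⁆ = -hForm n c a j • chF n j := by
  rw [hElt, hForm, add_lie, sum_lie, smul_lie, chD_lie_chF, neg_add, add_smul, ← sum_neg_distrib,
    sum_smul]
  congr 1
  · refine sum_congr rfl fun k hk => ?_
    rw [smul_lie, chH_lie_chF (mem_range.1 hk), smul_smul, mul_neg]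
  · rw [smul_smul, mul_neg, mul_ite, mul_one, mul_zero]

lemma hElt_lie_chH (n : ℕ) (c : ℕ → ℂ) (a : ℂ) (j : ℕ) : ⁅hElt n c a, chH n j⁆ = 0 := by
  rw [hElt, add_lie, sum_lie, smul_lie, chD_lie_chH, smul_zero, add_zero]
  exact sum_eq_zero fun k _ => by rw [smul_lie, chH_lie_chH, smul_zero]

lemma hElt_lie_chD (n : ℕ) (c : ℕ → ℂ) (a : ℂ) : ⁅hElt n c a, chD n⁆ = 0 := by
  rw [hElt, add_lie, sum_lie, smul_lie, lie_self, smul_zero, add_zero]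
  refine sum_eq_zero fun k _ => ?_
  rw [smul_lie, ← lie_skew, chD_lie_chH, neg_zero, smul_zero]

lemma hElt_lie_hElt (n : ℕ) (c c' : ℕ → ℂ) (a a' : ℂ) : ⁅hElt n c a, hElt n c' a'⁆ = 0 := by
  rw [hElt.eq_1 n c' a', lie_add, lie_sum, lie_smul, hElt_lie_chD, smul_zero, add_zero]
  exact sum_eq_zero fun k _ => by rw [lie_smul, hElt_lie_chH, smul_zero]

/-! ### The component of degree one -/

/-- The vectors of degree one are grouped into blocks `0 ≤ i ≤ n` of four. The simple root vectors
`e_{2i}` act on the first index of block `i` and `e_{2i+2}` acts on its second index;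
`w00 n i` is annihilated by all `f_{2j}`. -/
noncomputable def w00 (n i : ℕ) : AffD n := if i = 0 then chE n 0 else chE n (2 * i + 1)

/-- The vector with indices `(0, 1)` of block `i`. -/
noncomputable def w01 (n i : ℕ) : AffD n :=
  if i = 0 then e2 n 0 2 else if i = n then chE n (2 * n + 2) else e2 n (2 * i + 1) (2 * i + 2)

/-- The vector with indices `(1, 0)` of block `i`. -/
noncomputable def w10 (n i : ℕ) : AffD n := if i = 0 then chE n 1 else e2 n (2 * i) (2 * i + 1)

/-- The vector with indices `(1, 1)` of block `i`. -/
noncomputable def w11 (n i : ℕ) : AffD n :=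
  if i = 0 then e2 n 1 2 else if i = n then e2 n (2 * n) (2 * n + 2)
  else e3 n (2 * i) (2 * i + 1) (2 * i + 2)

lemma w00_zero (n : ℕ) : w00 n 0 = chE n 0 := rfl
lemma w01_zero (n : ℕ) : w01 n 0 = ⁅chE n 0, chE n 2⁆ := rfl
lemma w10_zero (n : ℕ) : w10 n 0 = chE n 1 := rfl
lemma w11_zero (n : ℕ) : w11 n 0 = ⁅chE n 1, chE n 2⁆ := rfl

section blocks
variable {n i : ℕ}

lemma w00_pos (hi : i ≠ 0) : w00 n i = chE n (2 * i + 1) := if_neg hi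

lemma w10_pos (hi : i ≠ 0) : w10 n i = ⁅chE n (2 * i), chE n (2 * i + 1)⁆ := if_neg hi

lemma w01_mid (hi : i ≠ 0) (h : i ≠ n) : w01 n i = ⁅chE n (2 * i + 1), chE n (2 * i + 2)⁆ := by
  rw [w01, if_neg hi, if_neg h, e2]

lemma w11_mid (hi : i ≠ 0) (h : i ≠ n) :
    w11 n i = ⁅chE n (2 * i), ⁅chE n (2 * i + 1), chE n (2 * i + 2)⁆⁆ := by
  rw [w11, if_neg hi, if_neg h, e3]

lemma w01_last (hn : n ≠ 0) : w01 n n = chE n (2 * n + 2) := by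
  rw [w01, if_neg hn, if_pos rfl]

lemma w11_last (hn : n ≠ 0) : w11 n n = ⁅chE n (2 * n), chE n (2 * n + 2)⁆ := by
  rw [w11, if_neg hn, if_pos rfl, e2]

end blocks

/-- The weights of the block vectors, for a functional with the values `F k` at the simple
roots. -/
def wt00 (F : ℕ → ℂ) (i : ℕ) : ℂ := if i = 0 then F 0 else F (2 * i + 1)

/-- The weight of `w01`. -/
def wt01 (n : ℕ) (F : ℕ → ℂ) (i : ℕ) : ℂ :=
  if i = 0 then F 0 + F 2 else if i = n then F (2 * n + 2) else F (2 * i + 1) + F (2 * i + 2)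

/-- The weight of `w10`. -/
def wt10 (F : ℕ → ℂ) (i : ℕ) : ℂ := if i = 0 then F 1 else F (2 * i) + F (2 * i + 1)

/-- The weight of `w11`. -/
def wt11 (n : ℕ) (F : ℕ → ℂ) (i : ℕ) : ℂ :=
  if i = 0 then F 1 + F 2 else if i = n then F (2 * n) + F (2 * n + 2)
  else F (2 * i) + (F (2 * i + 1) + F (2 * i + 2))

lemma lie_lie_of_eigen {L : Type*} [LieRing L] [LieAlgebra ℂ L] {H x y : L} {a b : ℂ}
    (hx : ⁅H, x⁆ = a • x) (hy : ⁅H, y⁆ = b • y) : ⁅H, ⁅x, y⁆⁆ = (a + b) • ⁅x, y⁆ := by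
  rw [leibniz_lie, hx, hy, smul_lie, lie_smul, add_smul]

lemma hElt_lie_w00 (n : ℕ) (c : ℕ → ℂ) (a : ℂ) (i : ℕ) :
    ⁅hElt n c a, w00 n i⁆ = wt00 (hForm n c a) i • w00 n i := by
  unfold w00 wt00
  split_ifs <;> exact hElt_lie_chE _ _ _ _

lemma hElt_lie_w01 (n : ℕ) (c : ℕ → ℂ) (a : ℂ) (i : ℕ) :
    ⁅hElt n c a, w01 n i⁆ = wt01 n (hForm n c a) i • w01 n i := by
  unfold w01 wt01
  split_ifs
  · exact lie_lie_of_eigen (hElt_lie_chE _ _ _ _) (hElt_lie_chE _ _ _ _)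
  · exact hElt_lie_chE _ _ _ _
  · exact lie_lie_of_eigen (hElt_lie_chE _ _ _ _) (hElt_lie_chE _ _ _ _)

lemma hElt_lie_w10 (n : ℕ) (c : ℕ → ℂ) (a : ℂ) (i : ℕ) :
    ⁅hElt n c a, w10 n i⁆ = wt10 (hForm n c a) i • w10 n i := by
  unfold w10 wt10
  split_ifs
  · exact hElt_lie_chE _ _ _ _
  · exact lie_lie_of_eigen (hElt_lie_chE _ _ _ _) (hElt_lie_chE _ _ _ _)

lemma hElt_lie_w11 (n : ℕ) (c : ℕ → ℂ) (a : ℂ) (i : ℕ) :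
    ⁅hElt n c a, w11 n i⁆ = wt11 n (hForm n c a) i • w11 n i := by
  unfold w11 wt11
  split_ifs
  · exact lie_lie_of_eigen (hElt_lie_chE _ _ _ _) (hElt_lie_chE _ _ _ _)
  · exact lie_lie_of_eigen (hElt_lie_chE _ _ _ _) (hElt_lie_chE _ _ _ _)
  · exact lie_lie_of_eigen (hElt_lie_chE _ _ _ _)
      (lie_lie_of_eigen (hElt_lie_chE _ _ _ _) (hElt_lie_chE _ _ _ _))

section action
variable {n i j : ℕ}

lemma lie_swap_of_comm {L : Type*} [LieRing L] {x y z : L} (h : ⁅x, y⁆ = 0) :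
    ⁅x, ⁅y, z⁆⁆ = ⁅y, ⁅x, z⁆⁆ := by
  rw [leibniz_lie, h, zero_lie, zero_add]

lemma chE_lie_w00 (hj : 1 ≤ j) (hjn : j ≤ n) (hi : i ≤ n) :
    ⁅chE n (2 * j), w00 n i⁆ =
      (if j = i then w10 n i else 0) - (if j = i + 1 then w01 n i else 0) := by
  rcases Nat.eq_zero_or_pos i with rfl | h0
  · rw [if_neg (by omega), zero_sub]
    split_ifs with h
    · rw [w00_zero, w01_zero, h, lie_skew]
    · rw [w00_zero, chE_lie_chE (by unfold Adj; omega), neg_zero]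
  · rw [w00_pos h0.ne']
    by_cases h : j = i
    · rw [if_pos h, if_neg (by omega), sub_zero, w10_pos h0.ne', h]
    · rw [if_neg h, zero_sub]
      split_ifs with h'
      · rw [w01_mid h0.ne' (by omega), h', lie_skew, mul_add, mul_one]
      · rw [chE_lie_chE (by unfold Adj; omega), neg_zero]

lemma chE_lie_w10 (hj : 1 ≤ j) (hjn : j ≤ n) (hi : i ≤ n) :
    ⁅chE n (2 * j), w10 n i⁆ = -(if j = i + 1 then w11 n i else 0) := by
  rcases Nat.eq_zero_or_pos i with rfl | h0
  · split_ifs with h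
    · rw [w10_zero, w11_zero, h, lie_skew]
    · rw [w10_zero, chE_lie_chE (by unfold Adj; omega), neg_zero]
  · rw [w10_pos h0.ne']
    by_cases h : j = i
    · rw [if_neg (by omega), neg_zero, h, chE_serre]
    · rw [lie_swap_of_comm (chE_lie_chE (by unfold Adj; omega))]
      split_ifs with h'
      · rw [w11_mid h0.ne' (by omega), h', ← lie_neg, lie_skew, mul_add, mul_one]
      · rw [chE_lie_chE (i := 2 * j) (by unfold Adj; omega), lie_zero, neg_zero]

lemma chE_lie_w01 (hj : 1 ≤ j) (hjn : j ≤ n) (hi : i ≤ n) :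
    ⁅chE n (2 * j), w01 n i⁆ = if j = i then w11 n i else 0 := by
  rcases Nat.eq_zero_or_pos i with rfl | h0
  · rw [if_neg (by omega), w01_zero]
    by_cases h : j = 1
    · rw [h, chE_serre']
    · rw [lie_swap_of_comm (chE_lie_chE (by unfold Adj; omega)),
        chE_lie_chE (i := 2 * j) (by unfold Adj; omega), lie_zero]
  · by_cases hin : i = n
    · subst hin
      split_ifs with h
      · rw [w01_last h0.ne', w11_last h0.ne', h]
      · rw [w01_last h0.ne', chE_lie_chE (by unfold Adj; omega)]
    · rw [w01_mid h0.ne' hin]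
      split_ifs with h
      · rw [w11_mid h0.ne' hin, h]
      · by_cases h' : j = i + 1
        · rw [h', mul_add, mul_one, chE_serre']
        · rw [lie_swap_of_comm (chE_lie_chE (by unfold Adj; omega)),
            chE_lie_chE (i := 2 * j) (by unfold Adj; omega), lie_zero]

lemma chE_lie_w11 (hj : 1 ≤ j) (hjn : j ≤ n) (hi : i ≤ n) : ⁅chE n (2 * j), w11 n i⁆ = 0 := by
  rcases Nat.eq_zero_or_pos i with rfl | h0
  · rw [w11_zero]
    by_cases h : j = 1
    · rw [h, chE_serre']
    · rw [lie_swap_of_comm (chE_lie_chE (by unfold Adj; omega)),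
        chE_lie_chE (i := 2 * j) (by unfold Adj; omega), lie_zero]
  · by_cases hin : i = n
    · subst hin
      rw [w11_last h0.ne']
      by_cases h : j = i
      · rw [h, chE_serre]
      · rw [lie_swap_of_comm (chE_lie_chE (by unfold Adj; omega)),
          chE_lie_chE (i := 2 * j) (by unfold Adj; omega), lie_zero]
    · rw [w11_mid h0.ne' hin]
      by_cases h : j = i
      · subst h
        have h1 (x : AffD n) : ⁅chE n (2 * j), ⁅x, chE n (2 * j + 2)⁆⁆ =
            ⁅⁅chE n (2 * j), x⁆, chE n (2 * j + 2)⁆ := by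
          rw [leibniz_lie, chE_lie_chE (i := 2 * j) (j := 2 * j + 2) (by unfold Adj; omega),
            lie_zero, add_zero]
        rw [h1, h1, chE_serre, zero_lie]
      · by_cases h' : j = i + 1
        · rw [lie_swap_of_comm (chE_lie_chE (by unfold Adj; omega)), h', mul_add,
            mul_one, chE_serre', lie_zero]
        · rw [lie_swap_of_comm (chE_lie_chE (by unfold Adj; omega)),
            lie_swap_of_comm (x := chE n (2 * j)) (chE_lie_chE (by unfold Adj; omega)),
            chE_lie_chE (i := 2 * j) (by unfold Adj; omega), lie_zero, lie_zero]

lemma chF_lie_w00 (hj : 1 ≤ j) : ⁅chF n (2 * j), w00 n i⁆ = 0 := by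
  unfold w00
  split_ifs with h <;> exact chF_lie_chE (by omega)

end action

section action_f
variable {n i j : ℕ}

lemma chF_lie_lie {k a b : ℕ} (hka : k ≠ a) (hkb : k ≠ b) :
    ⁅chF n k, ⁅chE n a, chE n b⁆⁆ = 0 := by
  rw [leibniz_lie, chF_lie_chE hka, chF_lie_chE hkb, zero_lie, lie_zero, add_zero]

lemma chF_lie_lie_left {k b : ℕ} (hk : k < 2 * n + 3) (hkb : k ≠ b) (h : Adj n k b) :
    ⁅chF n k, ⁅chE n k, chE n b⁆⁆ = chE n b := by
  rw [leibniz_lie, chF_lie_chE_self, chF_lie_chE hkb, lie_zero, add_zero, neg_lie,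
    chH_lie_chE hk, cartan_adj hkb h]
  simp

lemma chF_lie_lie_right {k b : ℕ} (hk : k < 2 * n + 3) (hkb : k ≠ b) (h : Adj n k b) :
    ⁅chF n k, ⁅chE n b, chE n k⁆⁆ = -chE n b := by
  rw [← lie_skew (chE n b), lie_neg, chF_lie_lie_left hk hkb h]

lemma chF_lie_w10 (hj : 1 ≤ j) (hjn : j ≤ n) :
    ⁅chF n (2 * j), w10 n i⁆ = if j = i then w00 n i else 0 := by
  rcases Nat.eq_zero_or_pos i with rfl | h0
  · rw [if_neg (by omega), w10_zero, chF_lie_chE (by omega)]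
  · rw [w10_pos h0.ne']
    split_ifs with h
    · rw [h, w00_pos h0.ne', chF_lie_lie_left (by omega) (by omega) (by unfold Adj; omega)]
    · rw [chF_lie_lie (by omega) (by omega)]

lemma chF_lie_w01 (hj : 1 ≤ j) (hjn : j ≤ n) :
    ⁅chF n (2 * j), w01 n i⁆ = -(if j = i + 1 then w00 n i else 0) := by
  rcases Nat.eq_zero_or_pos i with rfl | h0
  · rw [w01_zero]
    split_ifs with h
    · rw [h, w00_zero, chF_lie_lie_right (by omega) (by omega) (by unfold Adj; omega)]
    · rw [chF_lie_lie (by omega) (by omega), neg_zero]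
  · by_cases hin : i = n
    · subst hin
      rw [if_neg (by omega), w01_last h0.ne', chF_lie_chE (by omega), neg_zero]
    · rw [w01_mid h0.ne' hin]
      split_ifs with h
      · rw [h, w00_pos h0.ne', mul_add, mul_one,
          chF_lie_lie_right (by omega) (by omega) (by unfold Adj; omega)]
      · rw [chF_lie_lie (by omega) (by omega), neg_zero]

lemma chF_lie_w11 (hj : 1 ≤ j) (hjn : j ≤ n) :
    ⁅chF n (2 * j), w11 n i⁆ =
      (if j = i then w01 n i else 0) - (if j = i + 1 then w10 n i else 0) := by
  rcases Nat.eq_zero_or_pos i with rfl | h0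
  · rw [w11_zero, if_neg (by omega), zero_sub]
    split_ifs with h
    · rw [h, w10_zero, chF_lie_lie_right (by omega) (by omega) (by unfold Adj; omega)]
    · rw [chF_lie_lie (by omega) (by omega), neg_zero]
  · by_cases hin : i = n
    · subst hin
      rw [if_neg (c := j = i + 1) (by omega), w11_last h0.ne', sub_zero]
      split_ifs with h
      · rw [h, w01_last h0.ne', chF_lie_lie_left (by omega) (by omega) (by unfold Adj; omega)]
      · rw [chF_lie_lie (by omega) (by omega)]
    · rw [w11_mid h0.ne' hin]
      by_cases h : j = i
      · subst h
        rw [if_pos rfl, if_neg (by omega), sub_zero, w01_mid h0.ne' hin, leibniz_lie,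
          chF_lie_chE_self, chF_lie_lie (by omega) (by omega), lie_zero, add_zero, neg_lie,
          leibniz_lie, chH_lie_chE (by omega), chH_lie_chE (by omega),
          cartan_adj (by omega) (by unfold Adj; omega),
          cartan_not_adj (by omega) (by unfold Adj; omega)]
        simp
      · rw [if_neg h, zero_sub, lie_swap_of_comm (chF_lie_chE (by omega))]
        split_ifs with h'
        · rw [h', w10_pos h0.ne', mul_add, mul_one,
            chF_lie_lie_right (by omega) (by omega) (by unfold Adj; omega), lie_neg]
        · rw [chF_lie_lie (by omega) (by omega), lie_zero, neg_zero]

end action_f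

/-! ### Coordinates on the components of degree zero and one -/

/-- Coordinates of an element of the span of the Cartan subalgebra, the `e_{2i}`, `f_{2i}` and the
block vectors. -/
@[ext] structure Coord where
  /-- The coefficients of the `α_k^∨`. -/
  h : ℕ → ℂ
  /-- The coefficient of `d`. -/
  d : ℂ
  /-- The coefficients of the `e_{2i}`. -/
  x : ℕ → ℂ
  /-- The coefficients of the `f_{2i}`. -/
  y : ℕ → ℂ
  /-- The coefficients of the `w00`. -/
  c00 : ℕ → ℂ
  /-- The coefficients of the `w01`. -/
  c01 : ℕ → ℂ
  /-- The coefficients of the `w10`. -/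
  c10 : ℕ → ℂ
  /-- The coefficients of the `w11`. -/
  c11 : ℕ → ℂ

namespace Coord

noncomputable instance : Add Coord where
  add X Y := ⟨X.h + Y.h, X.d + Y.d, X.x + Y.x, X.y + Y.y, X.c00 + Y.c00, X.c01 + Y.c01,
    X.c10 + Y.c10, X.c11 + Y.c11⟩

noncomputable instance : SMul ℂ Coord where
  smul r X := ⟨r • X.h, r * X.d, r • X.x, r • X.y, r • X.c00, r • X.c01, r • X.c10, r • X.c11⟩

variable (X Y : Coord) (r : ℂ)

@[simp] lemma add_h : (X + Y).h = X.h + Y.h := rfl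
@[simp] lemma add_d : (X + Y).d = X.d + Y.d := rfl
@[simp] lemma add_x : (X + Y).x = X.x + Y.x := rfl
@[simp] lemma add_y : (X + Y).y = X.y + Y.y := rfl
@[simp] lemma add_c00 : (X + Y).c00 = X.c00 + Y.c00 := rfl
@[simp] lemma add_c01 : (X + Y).c01 = X.c01 + Y.c01 := rfl
@[simp] lemma add_c10 : (X + Y).c10 = X.c10 + Y.c10 := rfl
@[simp] lemma add_c11 : (X + Y).c11 = X.c11 + Y.c11 := rfl
@[simp] lemma smul_h : (r • X).h = r • X.h := rfl
@[simp] lemma smul_d : (r • X).d = r * X.d := rfl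
@[simp] lemma smul_x : (r • X).x = r • X.x := rfl
@[simp] lemma smul_y : (r • X).y = r • X.y := rfl
@[simp] lemma smul_c00 : (r • X).c00 = r • X.c00 := rfl
@[simp] lemma smul_c01 : (r • X).c01 = r • X.c01 := rfl
@[simp] lemma smul_c10 : (r • X).c10 = r • X.c10 := rfl
@[simp] lemma smul_c11 : (r • X).c11 = r • X.c11 := rfl

end Coord

/-- The combination of the block vectors with given coefficients. -/
noncomputable def blockSum (n : ℕ) (c00 c01 c10 c11 : ℕ → ℂ) : AffD n :=
  ∑ i ∈ range (n + 1), (c00 i • w00 n i + c01 i • w01 n i + c10 i • w10 n i + c11 i • w11 n i)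

/-- The element with given coordinates. -/
noncomputable def elt (n : ℕ) (X : Coord) : AffD n :=
  hElt n X.h X.d + evenE n X.x + evenF n X.y + blockSum n X.c00 X.c01 X.c10 X.c11

/-- Truncation of a sequence to the indices `1, …, n`. -/
noncomputable def tr (n : ℕ) (v : ℕ → ℂ) (i : ℕ) : ℂ := if 1 ≤ i ∧ i ≤ n then v i else 0

/-- The sequence with entry `v i` at the index `2i`, `1 ≤ i ≤ n`, and zero elsewhere. -/
noncomputable def spread (n : ℕ) (v : ℕ → ℂ) (k : ℕ) : ℂ := if k % 2 = 0 then tr n v (k / 2) else 0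

section linear
variable (n : ℕ)

lemma hElt_add (c c' : ℕ → ℂ) (a a' : ℂ) :
    hElt n c a + hElt n c' a' = hElt n (c + c') (a + a') := by
  simp only [hElt, Pi.add_apply, add_smul, sum_add_distrib]; abel

lemma evenE_add (v w : ℕ → ℂ) : evenE n v + evenE n w = evenE n (v + w) := by
  simp only [evenE, Pi.add_apply, add_smul, sum_add_distrib]

lemma evenF_add (v w : ℕ → ℂ) : evenF n v + evenF n w = evenF n (v + w) := by
  simp only [evenF, Pi.add_apply, add_smul, sum_add_distrib]

lemma blockSum_add (a b c e a' b' c' e' : ℕ → ℂ) :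
    blockSum n a b c e + blockSum n a' b' c' e' =
      blockSum n (a + a') (b + b') (c + c') (e + e') := by
  simp only [blockSum, Pi.add_apply, ← sum_add_distrib]
  exact sum_congr rfl fun i _ => by module

lemma smul_hElt (r : ℂ) (c : ℕ → ℂ) (a : ℂ) : r • hElt n c a = hElt n (r • c) (r * a) := by
  simp only [hElt, Pi.smul_apply, smul_add, smul_sum, smul_smul, smul_eq_mul]

lemma smul_evenE (r : ℂ) (v : ℕ → ℂ) : r • evenE n v = evenE n (r • v) := by
  simp only [evenE, Pi.smul_apply, smul_sum, smul_smul, smul_eq_mul]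

lemma smul_evenF (r : ℂ) (v : ℕ → ℂ) : r • evenF n v = evenF n (r • v) := by
  simp only [evenF, Pi.smul_apply, smul_sum, smul_smul, smul_eq_mul]

lemma smul_blockSum (r : ℂ) (a b c e : ℕ → ℂ) :
    r • blockSum n a b c e = blockSum n (r • a) (r • b) (r • c) (r • e) := by
  simp only [blockSum, Pi.smul_apply, smul_sum, smul_smul, smul_eq_mul, smul_add]

lemma elt_add (X Y : Coord) : elt n (X + Y) = elt n X + elt n Y := by
  simp only [elt, Coord.add_h, Coord.add_d, Coord.add_x, Coord.add_y, Coord.add_c00,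
    Coord.add_c01, Coord.add_c10, Coord.add_c11, ← hElt_add, ← evenE_add, ← evenF_add, ← blockSum_add]; abel

lemma elt_smul (r : ℂ) (X : Coord) : elt n (r • X) = r • elt n X := by
  simp only [elt, smul_add, smul_hElt, smul_evenE, smul_evenF, smul_blockSum]
  rfl

end linear

section congruence
variable {n : ℕ}

lemma hElt_congr {c c' : ℕ → ℂ} {a a' : ℂ} (h : ∀ k < 2 * n + 3, c k = c' k) (ha : a = a') :
    hElt n c a = hElt n c' a' := by
  simp only [hElt, ha]
  congr 1
  exact sum_congr rfl fun k hk => by rw [h k (mem_range.1 hk)]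

lemma evenE_congr {v w : ℕ → ℂ} (h : ∀ i, 1 ≤ i → i ≤ n → v i = w i) : evenE n v = evenE n w :=
  sum_congr rfl fun i hi => by rw [h i (mem_Icc.1 hi).1 (mem_Icc.1 hi).2]

lemma evenF_congr {v w : ℕ → ℂ} (h : ∀ i, 1 ≤ i → i ≤ n → v i = w i) : evenF n v = evenF n w :=
  sum_congr rfl fun i hi => by rw [h i (mem_Icc.1 hi).1 (mem_Icc.1 hi).2]

lemma blockSum_congr {a b c e a' b' c' e' : ℕ → ℂ} (h : ∀ i ≤ n, a i = a' i ∧ b i = b' i ∧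
    c i = c' i ∧ e i = e' i) : blockSum n a b c e = blockSum n a' b' c' e' :=
  sum_congr rfl fun i hi => by
    obtain ⟨h1, h2, h3, h4⟩ := h i (Nat.lt_succ_iff.1 (mem_range.1 hi))
    rw [h1, h2, h3, h4]

lemma elt_congr {X Y : Coord} (hh : ∀ k < 2 * n + 3, X.h k = Y.h k) (hd : X.d = Y.d)
    (hx : ∀ i, 1 ≤ i → i ≤ n → X.x i = Y.x i) (hy : ∀ i, 1 ≤ i → i ≤ n → X.y i = Y.y i)
    (hc : ∀ i ≤ n, X.c00 i = Y.c00 i ∧ X.c01 i = Y.c01 i ∧ X.c10 i = Y.c10 i ∧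
      X.c11 i = Y.c11 i) : elt n X = elt n Y := by
  rw [elt, elt, hElt_congr hh hd, evenE_congr hx, evenF_congr hy, blockSum_congr hc]

lemma tr_of_mem {v : ℕ → ℂ} {i : ℕ} (h1 : 1 ≤ i) (h2 : i ≤ n) : tr n v i = v i := if_pos ⟨h1, h2⟩

lemma tr_zero (v : ℕ → ℂ) : tr n v 0 = 0 := if_neg (by omega)

lemma tr_of_gt {v : ℕ → ℂ} {i : ℕ} (h : n < i) : tr n v i = 0 := if_neg (by omega)

lemma sum_ite_smul {M : Type*} [AddCommGroup M] [Module ℂ M] (v : ℕ → ℂ) (i : ℕ) (w : M) :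
    ∑ j ∈ Icc 1 n, v j • (if j = i then w else 0) = tr n v i • w := by
  simp only [smul_ite, smul_zero, sum_ite_eq', mem_Icc, tr]
  split_ifs <;> simp

lemma sum_spread (v : ℕ → ℂ) :
    ∑ i ∈ Icc 1 n, v i • chH n (2 * i) = hElt n (spread n v) 0 := by
  rw [hElt, zero_smul, add_zero]
  symm
  refine sum_of_injOn (fun i => 2 * i) ?_ ?_ ?_ ?_ |>.symm
  · intro a _ b _ h
    simpa using h
  · intro i hi
    simp only [coe_Icc, Set.mem_Icc, coe_range, Set.mem_Iio] at hi ⊢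
    omega
  · intro k hk hk'
    simp only [coe_Icc, Set.mem_image, Set.mem_Icc, not_exists, not_and] at hk'
    rw [spread]
    split_ifs with h
    · rw [tr, if_neg, zero_smul]
      intro h'
      exact hk' (k / 2) h' (by omega)
    · exact zero_smul _ _
  · intro i hi
    rw [mem_Icc] at hi
    simp only [spread]
    rw [if_pos (by omega), Nat.mul_div_cancel_left _ (by omega), tr_of_mem hi.1 hi.2]

end congruence

/-! ### Brackets in coordinates -/

section brackets
variable {n : ℕ}

lemma evenE_lie_w00 (v : ℕ → ℂ) {i : ℕ} (hi : i ≤ n) :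
    ⁅evenE n v, w00 n i⁆ = tr n v i • w10 n i - tr n v (i + 1) • w01 n i := by
  rw [evenE, sum_lie, ← sum_ite_smul, ← sum_ite_smul, ← sum_sub_distrib]
  refine sum_congr rfl fun j hj => ?_
  rw [mem_Icc] at hj
  rw [smul_lie, chE_lie_w00 hj.1 hj.2 hi, smul_sub]

lemma evenE_lie_w10 (v : ℕ → ℂ) {i : ℕ} (hi : i ≤ n) :
    ⁅evenE n v, w10 n i⁆ = -tr n v (i + 1) • w11 n i := by
  rw [evenE, sum_lie, neg_smul, ← sum_ite_smul, ← sum_neg_distrib]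
  refine sum_congr rfl fun j hj => ?_
  rw [mem_Icc] at hj
  rw [smul_lie, chE_lie_w10 hj.1 hj.2 hi, smul_neg]

lemma evenE_lie_w01 (v : ℕ → ℂ) {i : ℕ} (hi : i ≤ n) :
    ⁅evenE n v, w01 n i⁆ = tr n v i • w11 n i := by
  rw [evenE, sum_lie, ← sum_ite_smul]
  refine sum_congr rfl fun j hj => ?_
  rw [mem_Icc] at hj
  rw [smul_lie, chE_lie_w01 hj.1 hj.2 hi]

lemma evenE_lie_w11 (v : ℕ → ℂ) {i : ℕ} (hi : i ≤ n) : ⁅evenE n v, w11 n i⁆ = 0 := by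
  rw [evenE, sum_lie]
  refine sum_eq_zero fun j hj => ?_
  rw [mem_Icc] at hj
  rw [smul_lie, chE_lie_w11 hj.1 hj.2 hi, smul_zero]

lemma evenF_lie_w00 (v : ℕ → ℂ) (i : ℕ) : ⁅evenF n v, w00 n i⁆ = 0 := by
  rw [evenF, sum_lie]
  refine sum_eq_zero fun j hj => ?_
  rw [mem_Icc] at hj
  rw [smul_lie, chF_lie_w00 hj.1, smul_zero]

lemma evenF_lie_w10 (v : ℕ → ℂ) (i : ℕ) : ⁅evenF n v, w10 n i⁆ = tr n v i • w00 n i := by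
  rw [evenF, sum_lie, ← sum_ite_smul]
  refine sum_congr rfl fun j hj => ?_
  rw [mem_Icc] at hj
  rw [smul_lie, chF_lie_w10 hj.1 hj.2]

lemma evenF_lie_w01 (v : ℕ → ℂ) (i : ℕ) :
    ⁅evenF n v, w01 n i⁆ = -tr n v (i + 1) • w00 n i := by
  rw [evenF, sum_lie, neg_smul, ← sum_ite_smul, ← sum_neg_distrib]
  refine sum_congr rfl fun j hj => ?_
  rw [mem_Icc] at hj
  rw [smul_lie, chF_lie_w01 hj.1 hj.2, smul_neg]

lemma evenF_lie_w11 (v : ℕ → ℂ) (i : ℕ) :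
    ⁅evenF n v, w11 n i⁆ = tr n v i • w01 n i - tr n v (i + 1) • w10 n i := by
  rw [evenF, sum_lie, ← sum_ite_smul, ← sum_ite_smul, ← sum_sub_distrib]
  refine sum_congr rfl fun j hj => ?_
  rw [mem_Icc] at hj
  rw [smul_lie, chF_lie_w11 hj.1 hj.2, smul_sub]

lemma hElt_lie_evenE (u : ℕ → ℂ) (a : ℂ) (v : ℕ → ℂ) :
    ⁅hElt n u a, evenE n v⁆ = evenE n fun i => hForm n u a (2 * i) * v i := by
  simp only [evenE, lie_sum, lie_smul, hElt_lie_chE, smul_smul]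
  exact sum_congr rfl fun i _ => by rw [mul_comm]

lemma hElt_lie_evenF (u : ℕ → ℂ) (a : ℂ) (v : ℕ → ℂ) :
    ⁅hElt n u a, evenF n v⁆ = evenF n fun i => -(hForm n u a (2 * i) * v i) := by
  simp only [evenF, lie_sum, lie_smul, hElt_lie_chF, smul_smul]
  exact sum_congr rfl fun i _ => by rw [mul_comm, neg_mul]

lemma evenE_lie_evenE (v w : ℕ → ℂ) : ⁅evenE n v, evenE n w⁆ = 0 := by
  simp only [evenE, lie_sum, sum_lie, lie_smul, smul_lie, smul_sum]
  refine sum_eq_zero fun i hi => sum_eq_zero fun j hj => ?_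
  rw [mem_Icc] at hi hj
  rw [chE_lie_chE (by unfold Adj; omega), smul_zero, smul_zero]

lemma evenF_lie_evenF (v w : ℕ → ℂ) : ⁅evenF n v, evenF n w⁆ = 0 := by
  simp only [evenF, lie_sum, sum_lie, lie_smul, smul_lie, smul_sum]
  refine sum_eq_zero fun i hi => sum_eq_zero fun j hj => ?_
  rw [mem_Icc] at hi hj
  rw [chF_lie_chF (by unfold Adj; omega), smul_zero, smul_zero]

lemma evenE_lie_evenF (v w : ℕ → ℂ) :
    ⁅evenE n v, evenF n w⁆ = hElt n (spread n fun i => v i * w i) 0 := by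
  rw [← sum_spread]
  simp only [evenE, evenF, sum_lie, lie_sum, lie_smul, smul_lie]
  refine sum_congr rfl fun i hi => ?_
  rw [sum_eq_single i, chE_lie_chF_self, smul_smul, mul_comm]
  · intro j _ hj
    rw [chE_lie_chF (by omega), smul_zero]
  · exact fun h => absurd hi h

/-- The action of `∑ v_i e_{2i}` in coordinates. -/
noncomputable def adE (n : ℕ) (v : ℕ → ℂ) (X : Coord) : Coord where
  h := spread n fun i => v i * X.y i
  d := 0
  x i := -(hForm n X.h X.d (2 * i) * v i)
  y := 0
  c00 := 0
  c01 i := -(tr n v (i + 1) * X.c00 i)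
  c10 i := tr n v i * X.c00 i
  c11 i := tr n v i * X.c01 i - tr n v (i + 1) * X.c10 i

/-- The action of `∑ v_i f_{2i}` in coordinates. -/
noncomputable def adF (n : ℕ) (v : ℕ → ℂ) (X : Coord) : Coord where
  h := -spread n fun i => X.x i * v i
  d := 0
  x := 0
  y i := hForm n X.h X.d (2 * i) * v i
  c00 i := tr n v i * X.c10 i - tr n v (i + 1) * X.c01 i
  c01 i := tr n v i * X.c11 i
  c10 i := -(tr n v (i + 1) * X.c11 i)
  c11 := 0

/-- The action of a Cartan element with the values `F k` at the simple roots in coordinates. -/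
noncomputable def adH (n : ℕ) (F : ℕ → ℂ) (X : Coord) : Coord where
  h := 0
  d := 0
  x i := F (2 * i) * X.x i
  y i := -(F (2 * i) * X.y i)
  c00 i := wt00 F i * X.c00 i
  c01 i := wt01 n F i * X.c01 i
  c10 i := wt10 F i * X.c10 i
  c11 i := wt11 n F i * X.c11 i

lemma hElt_zero : hElt n 0 0 = 0 := by simp [hElt]

lemma evenE_zero : evenE n 0 = 0 := by simp [evenE]

lemma evenF_zero : evenF n 0 = 0 := by simp [evenF]

lemma evenE_neg (v : ℕ → ℂ) : -evenE n v = evenE n fun i => -v i := by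
  simp [evenE]

lemma hElt_neg (v : ℕ → ℂ) (a : ℂ) : -hElt n v a = hElt n (-v) (-a) := by
  simp only [hElt, Pi.neg_apply, neg_smul, sum_neg_distrib, neg_add_rev]; abel

lemma evenF_neg (v : ℕ → ℂ) : -evenF n v = evenF n fun i => -v i := by
  simp [evenF]

lemma evenE_lie_elt (v : ℕ → ℂ) (X : Coord) : ⁅evenE n v, elt n X⁆ = elt n (adE n v X) := by
  simp only [elt, lie_add, adE, evenE_lie_evenE, evenE_lie_evenF, evenF_zero, add_zero]
  rw [← lie_skew, hElt_lie_evenE, evenE_neg, add_comm (evenE n _)]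
  congr 1
  simp only [blockSum, lie_sum]
  refine sum_congr rfl fun i hi => ?_
  have hi : i ≤ n := Nat.lt_succ_iff.1 (mem_range.1 hi)
  simp only [lie_add, lie_smul, evenE_lie_w00 v hi, evenE_lie_w01 v hi, evenE_lie_w10 v hi,
    evenE_lie_w11 v hi, Pi.zero_apply]
  module

lemma evenF_lie_elt (v : ℕ → ℂ) (X : Coord) : ⁅evenF n v, elt n X⁆ = elt n (adF n v X) := by
  simp only [elt, lie_add, adF, evenF_lie_evenF, evenE_zero, add_zero]
  rw [← lie_skew, hElt_lie_evenF, evenF_neg, ← lie_skew (evenF n v), evenE_lie_evenF, hElt_neg,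
    neg_zero, add_comm (evenF n _)]
  simp only [neg_neg]
  congr 1
  simp only [blockSum, lie_sum]
  refine sum_congr rfl fun i hi => ?_
  simp only [lie_add, lie_smul, evenF_lie_w00, evenF_lie_w01, evenF_lie_w10,
    evenF_lie_w11, Pi.zero_apply]
  module

lemma hElt_lie_elt (u : ℕ → ℂ) (a : ℂ) (X : Coord) :
    ⁅hElt n u a, elt n X⁆ = elt n (adH n (hForm n u a) X) := by
  simp only [elt, lie_add, adH, hElt_lie_hElt, hElt_zero, zero_add, hElt_lie_evenE,
    hElt_lie_evenF]
  congr 1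
  simp only [blockSum, lie_sum]
  refine sum_congr rfl fun i hi => ?_
  simp only [lie_add, lie_smul, hElt_lie_w00, hElt_lie_w01, hElt_lie_w10, hElt_lie_w11]
  module

end brackets

/-! ### Independence of the coordinates -/

/-- The basis vector `v_b` of the loop space. -/
def loopVec (b : ℤ) : LoopSpace := fun p => if p = (b, 0) then 1 else 0

/-- The matrix entry of an element of `𝔤` in the loop realization which belongs to the row
`z ^ m v_a` and the column `v_b`. -/
noncomputable def entry {n : ℕ} (hn : 1 ≤ n) (k : ℤ × ℤ × ℤ) : AffD n →ₗ[ℂ] ℂ where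
  toFun X := loopCoord (k.1, k.2.2) (loopRep hn X (loopVec k.2.1))
  map_add' X Y := by rw [map_add, LinearMap.add_apply, map_add]
  map_smul' c X := by rw [map_smul, LinearMap.smul_apply, map_smul, RingHom.id_apply]

/-- The matrix entry `k` of `soUnit x y m`. -/
noncomputable def unitEntry (k : ℤ × ℤ × ℤ) (x y m : ℤ) : ℂ :=
  (if k = (x, y, m) then 1 else 0) - (if k = (-y, -x, m) then 1 else 0)

section entries

lemma loopCoord_matUnit (k : ℤ × ℤ × ℤ) (x y m : ℤ) :
    loopCoord (k.1, k.2.2) (matUnit x y m (loopVec k.2.1)) = if k = (x, y, m) then 1 else 0 := by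
  change (if k.1 = x then (if (y, k.2.2 - m) = (k.2.1, 0) then (1 : ℂ) else 0) else 0) = _
  obtain ⟨a, b, c⟩ := k
  simp only [Prod.mk.injEq]
  by_cases h1 : a = x <;> by_cases h2 : y = b <;> by_cases h3 : c - m = 0 <;>
    simp only [h1, h2, h3, true_and, and_true, if_true, if_false, and_false, false_and] <;>
    first | (rw [if_pos]; omega) | (rw [if_neg]; omega)

lemma loopCoord_soUnit (k : ℤ × ℤ × ℤ) (x y m : ℤ) :
    loopCoord (k.1, k.2.2) (soUnit x y m (loopVec k.2.1)) = unitEntry k x y m := by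
  rw [soUnit, LinearMap.sub_apply, map_sub, loopCoord_matUnit, loopCoord_matUnit, unitEntry]

lemma soUnit_cancel {x y k w v l : ℤ} (h : y = w) (h2 : v ≠ x) (h3 : y ≠ -v)
    (h4 : x ≠ -w) : ⁅soUnit x y k, soUnit w v l⁆ = soUnit x v (k + l) := by
  rw [soUnit_lie, if_pos h, if_neg h2, if_neg h3, if_neg h4]
  simp

variable {n : ℕ} (hn : 1 ≤ n)

lemma entry_of_loopRep {X : AffD n} {x y m : ℤ} (h : loopRep hn X = soUnit x y m)
    (k : ℤ × ℤ × ℤ) : entry hn k X = unitEntry k x y m := by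
  rw [← loopCoord_soUnit, ← h]
  rfl

lemma loopRep_chE_zero : loopRep hn (chE n 0) = soUnit (-2) 1 1 := by
  rw [chE_of_lt (by omega), loopRep_gen]
  rfl

lemma loopRep_chE_last :
    loopRep hn (chE n (2 * n + 2)) = soUnit (2 * n + 1) (-(2 * n + 2)) 0 := by
  rw [chE_of_lt (by omega), loopRep_gen, loopGen]
  simp [rowIx, colIx, degIx]

lemma loopRep_chE_mid {k : ℕ} (h1 : 1 ≤ k) (h2 : k ≤ 2 * n + 1) :
    loopRep hn (chE n k) = soUnit k (k + 1) 0 := by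
  rw [chE_of_lt (by omega), loopRep_gen, loopGen]
  simp only [rowIx, colIx, degIx]
  rw [if_neg (by omega), if_neg (by omega), if_neg (by omega), if_neg (by omega),
    if_neg (by omega)]

lemma loopRep_chF_mid {k : ℕ} (h1 : 1 ≤ k) (h2 : k ≤ 2 * n + 1) :
    loopRep hn (chF n k) = soUnit (k + 1) k 0 := by
  rw [chF_of_lt (by omega), loopRep_gen, loopGen]
  simp only [rowIx, colIx, degIx]
  rw [if_neg (by omega), if_neg (by omega), if_neg (by omega), if_neg (by omega),
    if_neg (by omega), neg_zero]

/-- The kinds of the root vectors which occur in `elt`. -/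
inductive Slot
  | e | f | w00 | w01 | w10 | w11

noncomputable instance : DecidableEq Slot := Classical.decEq _

/-- The matrix position at which the root vector of a given slot and index is supported in the
loop realization. -/
def key (n : ℕ) : Slot → ℕ → ℤ × ℤ × ℤ
  | Slot.e, i => (2 * i, 2 * i + 1, 0)
  | Slot.f, i => (2 * i + 1, 2 * i, 0)
  | Slot.w00, i => if i = 0 then (-2, 1, 1) else (2 * i + 1, 2 * i + 2, 0)
  | Slot.w01, i => if i = 0 then (-3, 1, 1)
      else if i = n then (2 * n + 1, -(2 * n + 2), 0) else (2 * i + 1, 2 * i + 3, 0)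
  | Slot.w10, i => if i = 0 then (1, 2, 0) else (2 * i, 2 * i + 2, 0)
  | Slot.w11, i => if i = 0 then (1, 3, 0)
      else if i = n then (2 * n, -(2 * n + 2), 0) else (2 * i, 2 * i + 3, 0)

/-- The range of indices which belong to a slot. -/
def Slot.Valid (n : ℕ) : Slot → ℕ → Prop
  | Slot.e, i => 1 ≤ i ∧ i ≤ n
  | Slot.f, i => 1 ≤ i ∧ i ≤ n
  | _, i => i ≤ n

/-- The root vector of a given slot and index. -/
noncomputable def slotVec (n : ℕ) : Slot → ℕ → AffD n
  | Slot.e, i => chE n (2 * i)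
  | Slot.f, i => chF n (2 * i)
  | Slot.w00, i => CoupledPVI.w00 n i
  | Slot.w01, i => CoupledPVI.w01 n i
  | Slot.w10, i => CoupledPVI.w10 n i
  | Slot.w11, i => CoupledPVI.w11 n i

lemma key_eq_iff {n : ℕ} {σ τ : Slot} {i j : ℕ} (hi : σ.Valid n i) (hj : τ.Valid n j) :
    key n σ i = key n τ j ↔ σ = τ ∧ i = j := by
  cases σ <;> cases τ <;> simp only [Slot.Valid] at hi hj <;> simp only [key] <;>
    (try split_ifs) <;>
    simp only [Prod.mk.injEq, reduceCtorEq, false_and, true_and, and_true] <;>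
    constructor <;> intro h <;> first | trivial | omega

/-- No position is the reflection of another one in the antidiagonal, where `soUnit` has its second
entry. -/
lemma key_ne_neg {n : ℕ} {σ τ : Slot} {i j : ℕ} (hi : σ.Valid n i) (hj : τ.Valid n j) :
    key n σ i ≠ (-(key n τ j).2.1, -(key n τ j).1, (key n τ j).2.2) := by
  cases σ <;> cases τ <;> simp only [Slot.Valid] at hi hj <;> simp only [key] <;>
    (try split_ifs) <;> simp only [ne_eq, Prod.mk.injEq] <;> omega

lemma loopRep_slotVec {σ : Slot} {i : ℕ} (hi : σ.Valid n i) :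
    loopRep hn (slotVec n σ i) = soUnit (key n σ i).1 (key n σ i).2.1 (key n σ i).2.2 := by
  cases σ with
  | e =>
    rw [slotVec, loopRep_chE_mid hn (by have := hi.1; omega) (by have := hi.2; omega)]
    push_cast
    rfl
  | f =>
    rw [slotVec, loopRep_chF_mid hn (by have := hi.1; omega) (by have := hi.2; omega)]
    push_cast
    rfl
  | w00 =>
    simp only [Slot.Valid] at hi
    simp only [slotVec, CoupledPVI.w00, key]
    split_ifs with h
    · exact loopRep_chE_zero hn
    · rw [loopRep_chE_mid hn (by omega) (by omega)]
      push_cast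
      rw [add_assoc, one_add_one_eq_two]
  | w01 =>
    simp only [Slot.Valid] at hi
    simp only [slotVec, CoupledPVI.w01, key, e2]
    split_ifs with h h'
    · rw [loopRep_lie, loopRep_chE_zero, loopRep_chE_mid hn (by omega) (by omega), soUnit_lie,
        if_neg (by omega), if_neg (by omega), if_neg (by omega), if_pos (by omega)]
      simp
    · exact loopRep_chE_last hn
    · rw [loopRep_lie, loopRep_chE_mid hn (by omega) (by omega),
        loopRep_chE_mid hn (by omega) (by omega), soUnit_cancel (by push_cast; ring)
        (by omega) (by omega) (by omega)]
      push_cast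
      rw [add_assoc _ 2 1]; rfl
  | w10 =>
    simp only [Slot.Valid] at hi
    simp only [slotVec, CoupledPVI.w10, key, e2]
    split_ifs with h
    · exact loopRep_chE_mid hn le_rfl (by omega)
    · rw [loopRep_lie, loopRep_chE_mid hn (by omega) (by omega),
        loopRep_chE_mid hn (by omega) (by omega), soUnit_cancel (by push_cast; ring)
        (by omega) (by omega) (by omega)]
      push_cast
      rw [add_assoc _ 1 1]; rfl
  | w11 =>
    simp only [Slot.Valid] at hi
    simp only [slotVec, CoupledPVI.w11, key, e2, e3]
    split_ifs with h h'
    · rw [loopRep_lie, loopRep_chE_mid hn (by omega) (by omega),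
        loopRep_chE_mid hn (by omega) (by omega), soUnit_cancel (by norm_num)
        (by omega) (by omega) (by omega)]
      push_cast
      rfl
    · rw [loopRep_lie, loopRep_chE_mid hn (by omega) (by omega),
        loopRep_chE_last hn, soUnit_cancel (by push_cast; ring)
        (by omega) (by omega) (by omega)]
      push_cast
      rfl
    · rw [loopRep_lie, loopRep_lie, loopRep_chE_mid hn (by omega) (by omega),
        loopRep_chE_mid hn (by omega) (by omega), loopRep_chE_mid hn (by omega) (by omega),
        soUnit_cancel (x := ((2 * i + 1 : ℕ) : ℤ)) (by push_cast; ring)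
        (by omega) (by omega) (by omega), soUnit_cancel (by push_cast; ring)
        (by omega) (by omega) (by omega)]
      push_cast
      rw [add_assoc _ 2 1]; rfl

lemma entry_slotVec {σ τ : Slot} {i j : ℕ} (hi : σ.Valid n i) (hj : τ.Valid n j) :
    entry hn (key n σ i) (slotVec n τ j) = if σ = τ ∧ i = j then 1 else 0 := by
  rw [entry_of_loopRep hn (loopRep_slotVec hn hj), unitEntry, if_neg (key_ne_neg hi hj), sub_zero]
  exact if_congr (key_eq_iff hi hj) rfl rfl

lemma entry_hElt {k : ℤ × ℤ × ℤ} (hk : k.1 ≠ k.2.1) (c : ℕ → ℂ) (a : ℂ) :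
    entry hn k (hElt n c a) = 0 := by
  have hdiag (x : ℤ) : loopCoord (k.1, k.2.2) (soUnit x x 0 (loopVec k.2.1)) = 0 := by
    rw [loopCoord_soUnit, unitEntry, if_neg, if_neg, sub_zero]
    · rintro rfl; exact hk rfl
    · rintro rfl; exact hk rfl
  have hd : entry hn k (chD n) = 0 := by
    change loopCoord (k.1, k.2.2) (loopRep hn (gen n Gen.d) (loopVec k.2.1)) = 0
    rw [loopRep_gen]
    change (k.2.2 : ℂ) * (if (k.1, k.2.2) = (k.2.1, 0) then (1 : ℂ) else 0) = 0
    rw [if_neg, mul_zero]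
    simp [hk]
  have hh (j : ℕ) (hj : j < 2 * n + 3) : entry hn k (chH n j) = 0 := by
    change loopCoord (k.1, k.2.2) (loopRep hn (chH n j) (loopVec k.2.1)) = 0
    rw [chH_of_lt hj, loopRep_gen, loopGen, LinearMap.sub_apply, map_sub, hdiag, hdiag, sub_zero]
  rw [hElt, map_add, map_sum, map_smul, hd, smul_zero, add_zero]
  exact sum_eq_zero fun j hj => by rw [map_smul, hh j (mem_range.1 hj), smul_zero]

/-- The coefficients of the root vectors of a slot. -/
def Coord.coef (X : Coord) : Slot → ℕ → ℂ
  | Slot.e => X.x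
  | Slot.f => X.y
  | Slot.w00 => X.c00
  | Slot.w01 => X.c01
  | Slot.w10 => X.c10
  | Slot.w11 => X.c11

lemma key_fst_ne {n : ℕ} (σ : Slot) (i : ℕ) : (key n σ i).1 ≠ (key n σ i).2.1 := by
  cases σ <;> simp only [key] <;> (try split_ifs) <;> simp only [ne_eq] <;> omega

/-- The matrix entry at the position of a root vector reads off the coefficient of that vector. -/
lemma entry_elt {σ : Slot} {i : ℕ} (hi : σ.Valid n i) (X : Coord) :
    entry hn (key n σ i) (elt n X) = X.coef σ i := by
  have he (v : ℕ → ℂ) : entry hn (key n σ i) (evenE n v) = if σ = Slot.e then v i else 0 := by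
    rw [evenE, map_sum, sum_congr rfl (g := fun j => v j * if σ = Slot.e ∧ i = j then 1 else 0)
      (fun j hj => by
        rw [map_smul, ← entry_slotVec hn (τ := Slot.e) hi (mem_Icc.1 hj)]; rfl)]
    by_cases h : σ = Slot.e
    · subst h
      simp only [true_and, if_true, mul_ite, mul_one, mul_zero, sum_ite_eq]
      rw [if_pos (mem_Icc.2 hi)]
    · simp [h]
  have hf (v : ℕ → ℂ) : entry hn (key n σ i) (evenF n v) = if σ = Slot.f then v i else 0 := by
    rw [evenF, map_sum, sum_congr rfl (g := fun j => v j * if σ = Slot.f ∧ i = j then 1 else 0)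
      (fun j hj => by
        rw [map_smul, ← entry_slotVec hn (τ := Slot.f) hi (mem_Icc.1 hj)]; rfl)]
    by_cases h : σ = Slot.f
    · subst h
      simp only [true_and, if_true, mul_ite, mul_one, mul_zero, sum_ite_eq]
      rw [if_pos (mem_Icc.2 hi)]
    · simp [h]
  have hw (τ : Slot) (hτ : ∀ j, τ.Valid n j ↔ j ≤ n) (v : ℕ → ℂ) :
      ∑ j ∈ range (n + 1), entry hn (key n σ i) (v j • slotVec n τ j) =
        if σ = τ then v i else 0 := by
    rw [sum_congr rfl (g := fun j => v j * if σ = τ ∧ i = j then 1 else 0)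
      (fun j hj => by
        rw [map_smul, entry_slotVec hn hi ((hτ j).2 (Nat.lt_succ_iff.1 (mem_range.1 hj)))]; rfl)]
    by_cases h : σ = τ
    · subst h
      simp only [true_and, if_true, mul_ite, mul_one, mul_zero, sum_ite_eq]
      rw [if_pos (mem_range.2 (Nat.lt_succ_iff.2 ((hτ i).1 hi)))]
    · simp [h]
  have hb : entry hn (key n σ i) (blockSum n X.c00 X.c01 X.c10 X.c11) =
      (if σ = Slot.w00 then X.c00 i else 0) + (if σ = Slot.w01 then X.c01 i else 0)
      + (if σ = Slot.w10 then X.c10 i else 0) + (if σ = Slot.w11 then X.c11 i else 0) := by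
    rw [← hw Slot.w00 (fun _ => Iff.rfl), ← hw Slot.w01 (fun _ => Iff.rfl),
      ← hw Slot.w10 (fun _ => Iff.rfl), ← hw Slot.w11 (fun _ => Iff.rfl), blockSum]
    simp only [map_sum, map_add, sum_add_distrib]
    rfl
  rw [elt, map_add, map_add, map_add, he, hf, hb, entry_hElt hn (key_fst_ne σ i)]
  cases σ <;> simp [Coord.coef]

/-- The coordinates other than the Cartan part are determined by the element. -/
lemma coef_eq_of_elt_eq (hn : 1 ≤ n) {X Y : Coord} (h : elt n X = elt n Y) {σ : Slot} {i : ℕ}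
    (hi : σ.Valid n i) : X.coef σ i = Y.coef σ i := by
  rw [← entry_elt hn hi, ← entry_elt hn hi, h]

/-- The height of the basis vector `z ^ m v_a`, with respect to which the simple root vectors
raise by one. -/
def loopHeight (n : ℕ) (a : ℤ × ℤ) : ℤ :=
  (if 0 < a.1 then 2 * n + 2 - a.1 else -(2 * n + 2) - a.1) + a.2 * (4 * n + 2)

/-- An endomorphism is upper triangular if it preserves the filtration by height. -/
def UpperTri (n : ℕ) (T : Module.End ℂ LoopSpace) : Prop :=
  ∀ (c : ℤ) (f : LoopSpace), (∀ a, loopHeight n a < c → f a = 0) →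
    ∀ a, loopHeight n a < c → T f a = 0

lemma UpperTri.add {S T : Module.End ℂ LoopSpace} (hS : UpperTri n S) (hT : UpperTri n T) :
    UpperTri n (S + T) := fun c f hf a ha => by
  rw [LinearMap.add_apply, LoopSpace.add_apply, hS c f hf a ha, hT c f hf a ha, add_zero]

lemma UpperTri.sub {S T : Module.End ℂ LoopSpace} (hS : UpperTri n S) (hT : UpperTri n T) :
    UpperTri n (S - T) := fun c f hf a ha => by
  rw [LinearMap.sub_apply, LoopSpace.sub_apply, hS c f hf a ha, hT c f hf a ha, sub_zero]

lemma UpperTri.smul {T : Module.End ℂ LoopSpace} (r : ℂ) (hT : UpperTri n T) :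
    UpperTri n (r • T) := fun c f hf a ha => by
  rw [LinearMap.smul_apply, LoopSpace.smul_apply, hT c f hf a ha, mul_zero]

lemma UpperTri.mul {S T : Module.End ℂ LoopSpace} (hS : UpperTri n S) (hT : UpperTri n T) :
    UpperTri n (S * T) := fun c f hf a ha => by
  rw [Module.End.mul_apply]
  exact hS c _ (hT c f hf) a ha

lemma UpperTri.zero : UpperTri n 0 := fun c f hf a ha => by
  rw [LinearMap.zero_apply, LoopSpace.zero_apply]

lemma upperTri_matUnit {x y k : ℤ} (h : loopHeight n (y, 0) ≤ loopHeight n (x, k)) :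
    UpperTri n (matUnit x y k) := fun c f hf a ha => by
  rw [matUnit_apply]
  split_ifs with h1
  · apply hf
    obtain ⟨a, m⟩ := a
    subst h1
    simp only [loopHeight] at h ha ⊢
    rw [sub_mul]
    linarith
  · rfl

lemma upperTri_soUnit {x y k : ℤ} (h : loopHeight n (y, 0) ≤ loopHeight n (x, k))
    (h' : loopHeight n (-x, 0) ≤ loopHeight n (-y, k)) : UpperTri n (soUnit x y k) :=
  (upperTri_matUnit h).sub (upperTri_matUnit h')

lemma upperTri_chE (j : ℕ) : UpperTri n (loopRep hn (chE n j)) := by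
  by_cases hj : j < 2 * n + 3
  · rw [chE_of_lt hj, loopRep_gen, loopGen]
    have := index_cases hj
    apply upperTri_soUnit <;> simp only [loopHeight, degIx, rowIx, colIx] <;> split_ifs <;> omega
  · rw [chE_of_ge hj, map_zero]
    exact UpperTri.zero

lemma upperTri_of_mem_borel {X : AffD n} (hX : X ∈ borel n) : UpperTri n (loopRep hn X) := by
  have hd (x : ℤ) : UpperTri n (soUnit x x 0) := upperTri_soUnit le_rfl le_rfl
  obtain ⟨Y, hY, Z, hZ, rfl⟩ := Submodule.mem_sup.1 hX
  rw [map_add]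
  clear hX
  refine UpperTri.add ?_ ?_
  · induction hY using Submodule.span_induction with
    | mem x hx =>
      rcases hx with ⟨j, rfl⟩ | hx
      · by_cases hj : j < 2 * n + 3
        · rw [chH_of_lt hj, loopRep_gen, loopGen]
          exact (hd _).sub (hd _)
        · rw [chH_of_ge hj, map_zero]
          exact UpperTri.zero
      · rw [Set.mem_singleton_iff.1 hx, chD, loopRep_gen]
        intro c f hf a ha
        rw [loopGen, loopDeg_apply, hf a ha, mul_zero]
    | zero => rw [map_zero]; exact UpperTri.zero
    | add x y _ _ hx hy => rw [map_add]; exact hx.add hy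
    | smul r x _ hx => rw [map_smul]; exact UpperTri.smul r hx
  · induction hZ using LieSubalgebra.lieSpan_induction with
    | mem x hx => obtain ⟨j, rfl⟩ := hx; exact upperTri_chE hn j
    | zero => rw [map_zero]; exact UpperTri.zero
    | add x y _ _ hx hy => rw [map_add]; exact hx.add hy
    | smul r x _ hx => rw [map_smul]; exact UpperTri.smul r hx
    | lie x y _ _ hx hy => rw [loopRep_lie]; exact (hx.mul hy).sub (hy.mul hx)

/-- Elements of the Borel subalgebra have no component along the `f_{2i}`. -/
lemma coord_y_eq_zero (hn : 1 ≤ n) {X : Coord} (hX : elt n X ∈ borel n) {i : ℕ} (hi : 1 ≤ i ∧ i ≤ n) :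
    X.y i = 0 := by
  change X.coef Slot.f i = 0
  rw [← entry_elt hn (σ := Slot.f) hi X]
  -- the matrix position of `f_{2i}` lies below the diagonal
  refine upperTri_of_mem_borel hn hX (loopHeight n (2 * i, 0)) (loopVec (2 * i)) ?_ _ ?_
  · intro a ha
    exact if_neg fun h => by rw [h] at ha; exact lt_irrefl _ ha
  · simp only [key, loopHeight]
    split_ifs <;> omega

end entries

/-! ### Weak derivatives and weak sums -/

section Weak
variable {V : Type*} [AddCommGroup V] [Module ℂ V]

lemma eq_of_forall_dual {v w : V} (h : ∀ φ : Module.Dual ℂ V, φ v = φ w) : v = w :=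
  sub_eq_zero.1 ((Module.forall_dual_apply_eq_zero_iff ℂ _).1 fun φ => by
    rw [map_sub, h φ, sub_self])

lemma HasDerivW.unique {F : ℂ → V} {v w : V} {z : ℂ} (h : HasDerivW F v z)
    (h' : HasDerivW F w z) : v = w :=
  eq_of_forall_dual fun φ => (h φ).unique (h' φ)

lemma HasDerivW.congr {F G : ℂ → V} {v : V} {z : ℂ} (h : HasDerivW F v z)
    (hFG : ∀ᶠ w in nhds z, G w = F w) : HasDerivW G v z := fun φ =>
  (h φ).congr_of_eventuallyEq (hFG.mono fun _ hw => congrArg φ hw)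

lemma HasSumW.unique {a : ℕ → V} {v w : V} (h : HasSumW a v) (h' : HasSumW a w) : v = w :=
  eq_of_forall_dual fun φ => (h φ).unique (h' φ)

lemma HasSumW.sumW_eq {a : ℕ → V} {v : V} (h : HasSumW a v) : sumW a = v := by
  have h' : ∃ v, HasSumW a v := ⟨v, h⟩
  rw [sumW, dif_pos h']
  exact h'.choose_spec.unique h

lemma hasSumW_of_eventually_zero {a : ℕ → V} (N : ℕ) (h : ∀ m, a (m + N) = 0) :
    HasSumW a (∑ m ∈ range N, a m) := fun φ => by
  rw [map_sum]
  refine hasSum_sum_of_ne_finset_zero fun m hm => ?_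
  obtain ⟨k, rfl⟩ := Nat.exists_eq_add_of_le' (not_lt.1 fun h' => hm (mem_range.2 h'))
  rw [h, map_zero]

end Weak

/-! ### The exponential of an inner derivation -/

/-- The series `∑_m (ad Γ)^m(X) / m!` has the sum `X'`. -/
def ExpRel (n : ℕ) (Γ X X' : AffD n) : Prop :=
  HasSumW (fun m => ((m.factorial : ℂ)⁻¹) • ((LieAlgebra.ad ℂ (AffD n) Γ) ^ m) X) X'

section ExpRel
variable {n : ℕ} {Γ : AffD n}

lemma ExpRel.expAd_eq {X X' : AffD n} (h : ExpRel n Γ X X') : expAd n Γ X = X' := h.sumW_eq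

lemma ExpRel.add {X X' Y Y' : AffD n} (h : ExpRel n Γ X X') (h' : ExpRel n Γ Y Y') :
    ExpRel n Γ (X + Y) (X' + Y') := fun φ => by
  simpa only [map_add, smul_add] using (h φ).add (h' φ)

lemma ExpRel.smul {X X' : AffD n} (r : ℂ) (h : ExpRel n Γ X X') :
    ExpRel n Γ (r • X) (r • X') := fun φ => by
  simpa only [map_smul, smul_eq_mul, mul_left_comm] using (h φ).mul_left r

lemma ad_pow_succ (m : ℕ) (X : AffD n) :
    ((LieAlgebra.ad ℂ (AffD n) Γ) ^ (m + 1)) X = ((LieAlgebra.ad ℂ (AffD n) Γ) ^ m) ⁅Γ, X⁆ := by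
  rw [pow_succ, Module.End.mul_apply, LieAlgebra.ad_apply]

lemma ad_pow_zero (X : AffD n) : ((LieAlgebra.ad ℂ (AffD n) Γ) ^ 0) X = X := by
  rw [pow_zero, Module.End.one_apply]

lemma expRel_of_cube {X : AffD n} (h : ⁅Γ, ⁅Γ, ⁅Γ, X⁆⁆⁆ = 0) :
    ExpRel n Γ X (X + ⁅Γ, X⁆ + (2⁻¹ : ℂ) • ⁅Γ, ⁅Γ, X⁆⁆) := by
  have := hasSumW_of_eventually_zero
    (a := fun m => ((m.factorial : ℂ)⁻¹) • ((LieAlgebra.ad ℂ (AffD n) Γ) ^ m) X) 3 fun m => by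
      simp only [ad_pow_succ, h, map_zero, smul_zero]
  rw [ExpRel]
  simpa [sum_range_succ, ad_pow_succ] using this

/-- If the cube of the derivation `ad Γ` kills `X` and `Y`, its fifth power kills `⁅X, Y⁆`, and the
exponential respects the bracket of the two. -/
lemma expRel_lie_of_cube {X Y : AffD n} (hX : ⁅Γ, ⁅Γ, ⁅Γ, X⁆⁆⁆ = 0)
    (hY : ⁅Γ, ⁅Γ, ⁅Γ, Y⁆⁆⁆ = 0) :
    ExpRel n Γ ⁅X, Y⁆ ⁅expAd n Γ X, expAd n Γ Y⁆ := by
  have h1 : ⁅Γ, ⁅X, Y⁆⁆ = ⁅⁅Γ, X⁆, Y⁆ + ⁅X, ⁅Γ, Y⁆⁆ := leibniz_lie _ _ _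
  have h2 : ⁅Γ, ⁅Γ, ⁅X, Y⁆⁆⁆ = ⁅⁅Γ, ⁅Γ, X⁆⁆, Y⁆ + (2 : ℂ) • ⁅⁅Γ, X⁆, ⁅Γ, Y⁆⁆
      + ⁅X, ⁅Γ, ⁅Γ, Y⁆⁆⁆ := by
    rw [h1, lie_add, leibniz_lie, leibniz_lie Γ X]; module
  have h3 : ⁅Γ, ⁅Γ, ⁅Γ, ⁅X, Y⁆⁆⁆⁆ = (3 : ℂ) • ⁅⁅Γ, ⁅Γ, X⁆⁆, ⁅Γ, Y⁆⁆
      + (3 : ℂ) • ⁅⁅Γ, X⁆, ⁅Γ, ⁅Γ, Y⁆⁆⁆ := by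
    rw [h2, lie_add, lie_add, lie_smul, leibniz_lie, leibniz_lie Γ ⁅Γ, X⁆, leibniz_lie Γ X, hX, hY,
      zero_lie, lie_zero]; module
  have h4 : ⁅Γ, ⁅Γ, ⁅Γ, ⁅Γ, ⁅X, Y⁆⁆⁆⁆⁆ = (6 : ℂ) • ⁅⁅Γ, ⁅Γ, X⁆⁆, ⁅Γ, ⁅Γ, Y⁆⁆⁆ := by
    rw [h3, lie_add, lie_smul, lie_smul, leibniz_lie, leibniz_lie Γ ⁅Γ, X⁆, hX, hY,
      zero_lie, lie_zero]; module
  have h5 : ⁅Γ, ⁅Γ, ⁅Γ, ⁅Γ, ⁅Γ, ⁅X, Y⁆⁆⁆⁆⁆⁆ = 0 := by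
    rw [h4, lie_smul, leibniz_lie, hX, hY, zero_lie, lie_zero, add_zero, smul_zero]
  have := hasSumW_of_eventually_zero
    (a := fun m => ((m.factorial : ℂ)⁻¹) • ((LieAlgebra.ad ℂ (AffD n) Γ) ^ m) ⁅X, Y⁆) 5
    fun m => by simp only [ad_pow_succ, h5, map_zero, smul_zero]
  rw [(expRel_of_cube hX).expAd_eq, (expRel_of_cube hY).expAd_eq]
  rw [ExpRel]
  convert this using 2
  simp only [sum_range_succ, sum_range_zero, ad_pow_succ, ad_pow_zero]
  rw [h4, h3, h2, h1]
  simp only [lie_add, add_lie, lie_smul, smul_lie, Nat.factorial]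
  push_cast
  module

lemma ad_pow_of_eigen {X : AffD n} {l : ℂ} (h : ⁅Γ, X⁆ = l • X) (m : ℕ) :
    ((LieAlgebra.ad ℂ (AffD n) Γ) ^ m) X = l ^ m • X := by
  induction m with
  | zero => rw [ad_pow_zero, pow_zero, one_smul]
  | succ m ih => rw [ad_pow_succ, h, map_smul, ih, smul_smul, pow_succ']

lemma expRel_of_eigen {X : AffD n} {l : ℂ} (h : ⁅Γ, X⁆ = l • X) :
    ExpRel n Γ X (Complex.exp l • X) := fun φ => by
  simp only [ad_pow_of_eigen h, map_smul, smul_eq_mul]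
  have := (NormedSpace.exp_series_hasSum_exp' (𝕂 := ℂ) l).mul_right (φ X)
  rw [← Complex.exp_eq_exp_ℂ] at this
  simpa only [smul_eq_mul, mul_assoc] using this

/-- The pairs `(X, exp(ad Γ) X)` for `X` in the sum of the eigenspaces of `ad Γ`. -/
noncomputable def eigenGraph (n : ℕ) (Γ : AffD n) : Submodule ℂ (AffD n × AffD n) :=
  Submodule.span ℂ {v | ∃ l : ℂ, ⁅Γ, v.1⁆ = l • v.1 ∧ v.2 = Complex.exp l • v.1}

lemma expRel_of_mem_eigenGraph {v : AffD n × AffD n} (h : v ∈ eigenGraph n Γ) :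
    ExpRel n Γ v.1 v.2 := by
  induction h using Submodule.span_induction with
  | mem v hv => obtain ⟨l, h1, h2⟩ := hv; rw [h2]; exact expRel_of_eigen h1
  | zero => exact fun φ => by simp [hasSum_zero]
  | add v w _ _ hv hw => exact hv.add hw
  | smul r v _ hv => exact hv.smul r

lemma mem_eigenGraph {X : AffD n} {l : ℂ} (h : ⁅Γ, X⁆ = l • X) :
    (X, Complex.exp l • X) ∈ eigenGraph n Γ := Submodule.subset_span ⟨l, h, rfl⟩

/-- Brackets of eigenvectors are eigenvectors for the sum of the eigenvalues; hence the exponential of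
a diagonalizable derivation respects brackets. -/
lemma lie_mem_eigenGraph {v w : AffD n × AffD n} (hv : v ∈ eigenGraph n Γ)
    (hw : w ∈ eigenGraph n Γ) : (⁅v.1, w.1⁆, ⁅v.2, w.2⁆) ∈ eigenGraph n Γ := by
  induction hv, hw using Submodule.span_induction₂ with
  | mem_mem v w hv hw =>
    obtain ⟨l, h1, h2⟩ := hv
    obtain ⟨l', h1', h2'⟩ := hw
    rw [h2, h2', smul_lie, lie_smul, smul_smul, ← Complex.exp_add]
    refine mem_eigenGraph ?_
    rw [leibniz_lie, h1, h1', smul_lie, lie_smul, add_smul]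
  | zero_left w _ => simp only [Prod.fst_zero, Prod.snd_zero, zero_lie]; exact zero_mem _
  | zero_right v _ => simp only [Prod.fst_zero, Prod.snd_zero, lie_zero]; exact zero_mem _
  | add_left v v' w _ _ _ h h' => simpa using (eigenGraph n Γ).add_mem h h'
  | add_right v v' w _ _ _ h h' => simpa using (eigenGraph n Γ).add_mem h h'
  | smul_left r v w _ _ h => simpa using (eigenGraph n Γ).smul_mem r h
  | smul_right r v w _ _ h => simpa using (eigenGraph n Γ).smul_mem r h

lemma gaugeConn_of_comm {Γ' : AffD n} (h : ⁅Γ, Γ'⁆ = 0) (B : AffD n) :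
    gaugeConn n Γ Γ' B = expAd n Γ B + Γ' := by
  rw [gaugeConn]
  congr 1
  have := hasSumW_of_eventually_zero (a := fun m => (((m + 1).factorial : ℂ)⁻¹) •
    ((LieAlgebra.ad ℂ (AffD n) Γ) ^ m) Γ') 1 fun m => by
      simp only [ad_pow_succ, h, map_zero, smul_zero]
  rw [this.sumW_eq]
  simp

end ExpRel

/-! ### The three gauge transformations in coordinates -/

section steps
variable {n : ℕ}

lemma hForm_add (c c' : ℕ → ℂ) (a a' : ℂ) (j : ℕ) :
    hForm n (c + c') (a + a') j = hForm n c a j + hForm n c' a' j := by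
  simp only [hForm, Pi.add_apply, add_mul, sum_add_distrib]
  split_ifs <;> ring

lemma hForm_smul (r : ℂ) (c : ℕ → ℂ) (a : ℂ) (j : ℕ) :
    hForm n (r • c) (r * a) j = r * hForm n c a j := by
  simp only [hForm, Pi.smul_apply, smul_eq_mul, mul_add, mul_sum, mul_assoc]
  split_ifs <;> ring

lemma hForm_neg (c : ℕ → ℂ) (j : ℕ) : hForm n (-c) 0 j = -hForm n c 0 j := by
  have := hForm_smul (n := n) (-1) c 0 j
  rw [neg_one_smul, mul_zero] at this
  rw [this, neg_one_mul]

lemma hForm_zero (j : ℕ) : hForm n 0 0 j = 0 := by simp [hForm]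

lemma hForm_spread (v : ℕ → ℂ) {i : ℕ} (h1 : 1 ≤ i) (h2 : i ≤ n) :
    hForm n (spread n v) 0 (2 * i) = 2 * v i := by
  rw [hForm, sum_eq_single (2 * i)]
  · simp only [spread, tr, cartan_self]
    rw [if_pos (by omega), Nat.mul_div_cancel_left _ (by omega), if_pos ⟨h1, h2⟩, if_neg (by omega)]
    push_cast; ring
  · intro k _ hk
    simp only [spread, tr]
    split_ifs with h h'
    · rw [cartan_not_adj hk (by unfold Adj; omega)]; simp
    · simp
    · simp
  · intro h
    exact absurd (mem_range.2 (by omega)) h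

lemma spread_add (v w : ℕ → ℂ) : spread n (fun i => v i + w i) = spread n v + spread n w := by
  funext k
  simp only [spread, tr, Pi.add_apply]
  split_ifs <;> simp

@[simp] lemma spread_zero : spread n (fun _ => 0) = 0 := by
  funext k
  simp [spread, tr]

/-- The action of `exp(ad ∑ v_i e_{2i})` in coordinates. -/
noncomputable def expE (n : ℕ) (v : ℕ → ℂ) (X : Coord) : Coord where
  h := X.h + spread n fun i => v i * X.y i
  d := X.d
  x i := X.x i - v i * hForm n X.h X.d (2 * i) - v i ^ 2 * X.y i
  y := X.y
  c00 := X.c00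
  c01 i := X.c01 i - tr n v (i + 1) * X.c00 i
  c10 i := X.c10 i + tr n v i * X.c00 i
  c11 i := X.c11 i + tr n v i * X.c01 i - tr n v (i + 1) * X.c10 i
    - tr n v i * tr n v (i + 1) * X.c00 i

/-- The action of `exp(ad ∑ v_i f_{2i})` in coordinates. -/
noncomputable def expF (n : ℕ) (v : ℕ → ℂ) (X : Coord) : Coord where
  h := X.h - spread n fun i => v i * X.x i
  d := X.d
  x := X.x
  y i := X.y i + v i * hForm n X.h X.d (2 * i) - v i ^ 2 * X.x i
  c00 i := X.c00 i + tr n v i * X.c10 i - tr n v (i + 1) * X.c01 i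
    - tr n v i * tr n v (i + 1) * X.c11 i
  c01 i := X.c01 i + tr n v i * X.c11 i
  c10 i := X.c10 i - tr n v (i + 1) * X.c11 i
  c11 := X.c11

/-- The action of the exponential of a Cartan element with the values `F k` at the simple roots
in coordinates. -/
noncomputable def expH (n : ℕ) (F : ℕ → ℂ) (X : Coord) : Coord where
  h := X.h
  d := X.d
  x i := Complex.exp (F (2 * i)) * X.x i
  y i := Complex.exp (-F (2 * i)) * X.y i
  c00 i := Complex.exp (wt00 F i) * X.c00 i
  c01 i := Complex.exp (wt01 n F i) * X.c01 i
  c10 i := Complex.exp (wt10 F i) * X.c10 i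
  c11 i := Complex.exp (wt11 n F i) * X.c11 i

lemma elt_zero : elt n ⟨0, 0, 0, 0, 0, 0, 0, 0⟩ = 0 := by
  simp [elt, hElt_zero, evenE_zero, evenF_zero, blockSum]

lemma evenE_cube (v : ℕ → ℂ) (X : Coord) : ⁅evenE n v, ⁅evenE n v, ⁅evenE n v, elt n X⁆⁆⁆ = 0 := by
  rw [evenE_lie_elt, evenE_lie_elt, evenE_lie_elt, ← elt_zero]
  apply elt_congr <;> intros <;> simp [adE, hForm_zero]

lemma evenF_cube (v : ℕ → ℂ) (X : Coord) : ⁅evenF n v, ⁅evenF n v, ⁅evenF n v, elt n X⁆⁆⁆ = 0 := by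
  rw [evenF_lie_elt, evenF_lie_elt, evenF_lie_elt, ← elt_zero]
  apply elt_congr <;> intros <;> simp [adF, hForm_zero]

lemma expAd_evenE_elt (v : ℕ → ℂ) (X : Coord) :
    expAd n (evenE n v) (elt n X) = elt n (expE n v X) := by
  rw [(expRel_of_cube (evenE_cube v X)).expAd_eq, evenE_lie_elt, evenE_lie_elt, ← elt_smul,
    ← elt_add, ← elt_add]
  apply elt_congr
  · intro k _
    simp [adE, expE]
  · simp [adE, expE]
  · intro i h1 h2
    simp only [adE, expE, Coord.add_x, Coord.smul_x, Pi.add_apply, Pi.smul_apply, smul_eq_mul,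
      hForm_spread _ h1 h2]
    ring
  · intro i _ _
    simp [adE, expE]
  · intro i _
    simp only [adE, expE, Coord.add_c00, Coord.smul_c00, Coord.add_c01, Coord.smul_c01,
      Coord.add_c10, Coord.smul_c10, Coord.add_c11, Coord.smul_c11, Pi.add_apply, Pi.smul_apply,
      smul_eq_mul, Pi.zero_apply]
    refine ⟨?_, ?_, ?_, ?_⟩ <;> ring

lemma expAd_evenF_elt (v : ℕ → ℂ) (X : Coord) :
    expAd n (evenF n v) (elt n X) = elt n (expF n v X) := by
  rw [(expRel_of_cube (evenF_cube v X)).expAd_eq, evenF_lie_elt, evenF_lie_elt, ← elt_smul,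
    ← elt_add, ← elt_add]
  apply elt_congr
  · intro k _
    simp [adF, expF, mul_comm, sub_eq_add_neg]
  · simp [adF, expF]
  · intro i _ _
    simp [adF, expF]
  · intro i h1 h2
    simp only [adF, expF, Coord.add_y, Coord.smul_y, Pi.add_apply, Pi.smul_apply, smul_eq_mul,
      hForm_neg, hForm_spread _ h1 h2]
    ring
  · intro i _
    simp only [adF, expF, Coord.add_c00, Coord.smul_c00, Coord.add_c01, Coord.smul_c01,
      Coord.add_c10, Coord.smul_c10, Coord.add_c11, Coord.smul_c11, Pi.add_apply, Pi.smul_apply,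
      smul_eq_mul, Pi.zero_apply]
    refine ⟨?_, ?_, ?_, ?_⟩ <;> ring

lemma elt_mem_eigenGraph (u : ℕ → ℂ) (a : ℂ) (X : Coord) :
    (elt n X, elt n (expH n (hForm n u a) X)) ∈ eigenGraph n (hElt n u a) := by
  have hsmul {r l : ℂ} {v : AffD n} (h : ⁅hElt n u a, v⁆ = l • v) :
      (r • v, (Complex.exp l * r) • v) ∈ eigenGraph n (hElt n u a) := by
    have := (eigenGraph n (hElt n u a)).smul_mem r (mem_eigenGraph h)
    rwa [Prod.smul_mk, smul_smul, mul_comm r] at this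
  have hadd {v v' w w' : AffD n} (h : (v, v') ∈ eigenGraph n (hElt n u a))
      (h' : (w, w') ∈ eigenGraph n (hElt n u a)) :
      (v + w, v' + w') ∈ eigenGraph n (hElt n u a) := (eigenGraph n _).add_mem h h'
  have hsum {s : Finset ℕ} {v v' : ℕ → AffD n}
      (h : ∀ i ∈ s, (v i, v' i) ∈ eigenGraph n (hElt n u a)) :
      (∑ i ∈ s, v i, ∑ i ∈ s, v' i) ∈ eigenGraph n (hElt n u a) := by
    have := (eigenGraph n (hElt n u a)).sum_mem h
    rwa [show ∑ i ∈ s, (v i, v' i) = (∑ i ∈ s, v i, ∑ i ∈ s, v' i) from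
      Prod.ext Prod.fst_sum Prod.snd_sum] at this
  refine hadd (hadd (hadd ?_ ?_) ?_) ?_
  · have := mem_eigenGraph (Γ := hElt n u a) (X := hElt n X.h X.d) (l := 0)
      (by rw [hElt_lie_hElt, zero_smul])
    rwa [Complex.exp_zero, one_smul] at this
  · exact hsum fun i _ => hsmul (hElt_lie_chE ..)
  · exact hsum fun i _ => hsmul (by rw [hElt_lie_chF]; try rw [neg_smul])
  · exact hsum fun i _ => hadd (hadd (hadd (hsmul (hElt_lie_w00 ..)) (hsmul (hElt_lie_w01 ..)))
      (hsmul (hElt_lie_w10 ..))) (hsmul (hElt_lie_w11 ..))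

lemma expAd_hElt_elt (u : ℕ → ℂ) (a : ℂ) (X : Coord) :
    expAd n (hElt n u a) (elt n X) = elt n (expH n (hForm n u a) X) :=
  (expRel_of_mem_eigenGraph (elt_mem_eigenGraph u a X)).expAd_eq

/-! If the bracket of two elements of degree at most one again has degree at most one, the
coordinates of the brackets before and after a gauge transformation correspond. -/

lemma expE_lie {v : ℕ → ℂ} {X Y Z : Coord} (h : elt n Z = ⁅elt n X, elt n Y⁆) :
    elt n (expE n v Z) = ⁅elt n (expE n v X), elt n (expE n v Y)⁆ := by
  rw [← expAd_evenE_elt, ← expAd_evenE_elt, ← expAd_evenE_elt, h]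
  exact (expRel_lie_of_cube (evenE_cube v X) (evenE_cube v Y)).expAd_eq

lemma expF_lie {v : ℕ → ℂ} {X Y Z : Coord} (h : elt n Z = ⁅elt n X, elt n Y⁆) :
    elt n (expF n v Z) = ⁅elt n (expF n v X), elt n (expF n v Y)⁆ := by
  rw [← expAd_evenF_elt, ← expAd_evenF_elt, ← expAd_evenF_elt, h]
  exact (expRel_lie_of_cube (evenF_cube v X) (evenF_cube v Y)).expAd_eq

lemma expH_lie {u : ℕ → ℂ} {a : ℂ} {X Y Z : Coord} (h : elt n Z = ⁅elt n X, elt n Y⁆) :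
    elt n (expH n (hForm n u a) Z) =
      ⁅elt n (expH n (hForm n u a) X), elt n (expH n (hForm n u a) Y)⁆ := by
  rw [← expAd_hElt_elt _ _ Z, h]
  exact (expRel_of_mem_eigenGraph
    (lie_mem_eigenGraph (elt_mem_eigenGraph u a X) (elt_mem_eigenGraph u a Y))).expAd_eq

end steps

/-! ### Differentiation in coordinates -/

/-- The coordinates of `X` which enter `elt n X` have the derivatives given by `X'`. -/
structure HasDerivC (n : ℕ) (X : ℂ → Coord) (X' : Coord) (z : ℂ) : Prop where
  h : ∀ k < 2 * n + 3, HasDerivAt (fun w => (X w).h k) (X'.h k) z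
  d : HasDerivAt (fun w => (X w).d) X'.d z
  x : ∀ i, 1 ≤ i → i ≤ n → HasDerivAt (fun w => (X w).x i) (X'.x i) z
  y : ∀ i, 1 ≤ i → i ≤ n → HasDerivAt (fun w => (X w).y i) (X'.y i) z
  c00 : ∀ i ≤ n, HasDerivAt (fun w => (X w).c00 i) (X'.c00 i) z
  c01 : ∀ i ≤ n, HasDerivAt (fun w => (X w).c01 i) (X'.c01 i) z
  c10 : ∀ i ≤ n, HasDerivAt (fun w => (X w).c10 i) (X'.c10 i) z
  c11 : ∀ i ≤ n, HasDerivAt (fun w => (X w).c11 i) (X'.c11 i) z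

section deriv
variable {n : ℕ} {X : ℂ → Coord} {X' : Coord} {z : ℂ}

lemma HasDerivC.hasDerivW (hX : HasDerivC n X X' z) :
    HasDerivW (fun w => elt n (X w)) (elt n X') z := fun φ => by
  simp only [elt, hElt, evenE, evenF, blockSum, map_add, map_sum, map_smul, smul_eq_mul]
  refine (((HasDerivAt.fun_sum fun k hk => ?_).fun_add ?_).fun_add
    (HasDerivAt.fun_sum fun i hi => ?_) |>.fun_add (HasDerivAt.fun_sum fun i hi => ?_)).fun_add
    (HasDerivAt.fun_sum fun i hi => ?_)
  · exact (hX.h k (mem_range.1 hk)).mul_const _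
  · exact hX.d.mul_const _
  · exact (hX.x i (mem_Icc.1 hi).1 (mem_Icc.1 hi).2).mul_const _
  · exact (hX.y i (mem_Icc.1 hi).1 (mem_Icc.1 hi).2).mul_const _
  · have hi : i ≤ n := Nat.lt_succ_iff.1 (mem_range.1 hi)
    exact ((((hX.c00 i hi).mul_const _).fun_add ((hX.c01 i hi).mul_const _)).fun_add
      ((hX.c10 i hi).mul_const _)).fun_add ((hX.c11 i hi).mul_const _)

lemma hasDerivAt_tr {v : ℂ → ℕ → ℂ} {v' : ℕ → ℂ}
    (hv : ∀ i, 1 ≤ i → i ≤ n → HasDerivAt (fun w => v w i) (v' i) z) (i : ℕ) :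
    HasDerivAt (fun w => tr n (v w) i) (tr n v' i) z := by
  unfold tr
  split_ifs with h
  · exact hv i h.1 h.2
  · exact hasDerivAt_const _ _

lemma hasDerivAt_spread {v : ℂ → ℕ → ℂ} {v' : ℕ → ℂ}
    (hv : ∀ i, 1 ≤ i → i ≤ n → HasDerivAt (fun w => v w i) (v' i) z) (k : ℕ) :
    HasDerivAt (fun w => spread n (v w) k) (spread n v' k) z := by
  unfold spread
  split_ifs with h
  · exact hasDerivAt_tr hv _
  · exact hasDerivAt_const _ _

lemma hasDerivAt_hForm {u : ℂ → ℕ → ℂ} {u' : ℕ → ℂ} {a : ℂ → ℂ} {a' : ℂ}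
    (hu : ∀ k < 2 * n + 3, HasDerivAt (fun w => u w k) (u' k) z) (ha : HasDerivAt a a' z) (j : ℕ) :
    HasDerivAt (fun w => hForm n (u w) (a w) j) (hForm n u' a' j) z := by
  unfold hForm
  refine (HasDerivAt.fun_sum fun k hk => (hu k (mem_range.1 hk)).mul_const _).fun_add ?_
  split_ifs with h
  · exact ha
  · exact hasDerivAt_const _ _

lemma HasDerivC.expE (hX : HasDerivC n X X' z) {v : ℂ → ℕ → ℂ} {v' : ℕ → ℂ}
    (hv : ∀ i, 1 ≤ i → i ≤ n → HasDerivAt (fun w => v w i) (v' i) z) :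
    HasDerivC n (fun w => expE n (v w) (X w))
      (adE n v' (CoupledPVI.expE n (v z) (X z)) + CoupledPVI.expE n (v z) X') z := by
  have ht := hasDerivAt_tr hv
  constructor
  · intro k hk
    refine HasDerivAt.congr_deriv ((hX.h k hk).fun_add (hasDerivAt_spread (v := fun w i => v w i * (X w).y i)
      (fun i h1 h2 => (hv i h1 h2).fun_mul (hX.y i h1 h2)) k)) ?_
    simp only [adE, CoupledPVI.expE, Coord.add_h, spread_add, Pi.add_apply]
    ring
  · simpa [adE, CoupledPVI.expE] using hX.d
  · intro i h1 h2
    refine HasDerivAt.congr_deriv (((hX.x i h1 h2).fun_sub ((hv i h1 h2).fun_mul (hasDerivAt_hForm hX.h hX.d (2 * i)))).fun_sub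
      (((hv i h1 h2).fun_pow 2).fun_mul (hX.y i h1 h2))) ?_
    have := hForm_add (n := n) (X z).h (spread n fun i => v z i * (X z).y i) (X z).d 0 (2 * i)
    rw [add_zero, hForm_spread _ h1 h2] at this
    simp only [adE, CoupledPVI.expE, Coord.add_x, Pi.add_apply, this]
    push_cast
    ring
  · intro i h1 h2
    simpa [adE, CoupledPVI.expE] using hX.y i h1 h2
  · intro i hi
    simpa [adE, CoupledPVI.expE] using hX.c00 i hi
  · intro i hi
    refine HasDerivAt.congr_deriv ((hX.c01 i hi).fun_sub ((ht (i + 1)).fun_mul (hX.c00 i hi))) ?_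
    simp only [adE, CoupledPVI.expE, Coord.add_c01, Pi.add_apply]
    ring
  · intro i hi
    refine HasDerivAt.congr_deriv ((hX.c10 i hi).fun_add ((ht i).fun_mul (hX.c00 i hi))) ?_
    simp only [adE, CoupledPVI.expE, Coord.add_c10, Pi.add_apply]
    ring
  · intro i hi
    refine HasDerivAt.congr_deriv ((((hX.c11 i hi).fun_add ((ht i).fun_mul (hX.c01 i hi))).fun_sub
      ((ht (i + 1)).fun_mul (hX.c10 i hi))).fun_sub
      (((ht i).fun_mul (ht (i + 1))).fun_mul (hX.c00 i hi))) ?_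
    simp only [adE, CoupledPVI.expE, Coord.add_c11, Pi.add_apply]
    ring

lemma HasDerivC.expF (hX : HasDerivC n X X' z) {v : ℂ → ℕ → ℂ} {v' : ℕ → ℂ}
    (hv : ∀ i, 1 ≤ i → i ≤ n → HasDerivAt (fun w => v w i) (v' i) z) :
    HasDerivC n (fun w => expF n (v w) (X w))
      (adF n v' (CoupledPVI.expF n (v z) (X z)) + CoupledPVI.expF n (v z) X') z := by
  have ht := hasDerivAt_tr hv
  constructor
  · intro k hk
    refine HasDerivAt.congr_deriv ((hX.h k hk).fun_sub (hasDerivAt_spread (v := fun w i => v w i * (X w).x i)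
      (fun i h1 h2 => (hv i h1 h2).fun_mul (hX.x i h1 h2)) k)) ?_
    simp only [adF, CoupledPVI.expF, Coord.add_h, spread_add, Pi.add_apply, Pi.sub_apply,
      Pi.neg_apply, mul_comm]
    ring
  · simpa [adF, CoupledPVI.expF] using hX.d
  · intro i h1 h2
    simpa [adF, CoupledPVI.expF] using hX.x i h1 h2
  · intro i h1 h2
    refine HasDerivAt.congr_deriv (((hX.y i h1 h2).fun_add ((hv i h1 h2).fun_mul (hasDerivAt_hForm hX.h hX.d (2 * i)))).fun_sub
      (((hv i h1 h2).fun_pow 2).fun_mul (hX.x i h1 h2))) ?_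
    have := hForm_add (n := n) (X z).h (-spread n fun i => v z i * (X z).x i) (X z).d 0 (2 * i)
    rw [add_zero, hForm_neg, hForm_spread _ h1 h2, ← sub_eq_add_neg] at this
    simp only [adF, CoupledPVI.expF, Coord.add_y, Pi.add_apply, this]
    push_cast
    ring
  · intro i hi
    refine HasDerivAt.congr_deriv ((((hX.c00 i hi).fun_add ((ht i).fun_mul (hX.c10 i hi))).fun_sub
      ((ht (i + 1)).fun_mul (hX.c01 i hi))).fun_sub
      (((ht i).fun_mul (ht (i + 1))).fun_mul (hX.c11 i hi))) ?_
    simp only [adF, CoupledPVI.expF, Coord.add_c00, Pi.add_apply]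
    ring
  · intro i hi
    refine HasDerivAt.congr_deriv ((hX.c01 i hi).fun_add ((ht i).fun_mul (hX.c11 i hi))) ?_
    simp only [adF, CoupledPVI.expF, Coord.add_c01, Pi.add_apply]
    ring
  · intro i hi
    refine HasDerivAt.congr_deriv ((hX.c10 i hi).fun_sub ((ht (i + 1)).fun_mul (hX.c11 i hi))) ?_
    simp only [adF, CoupledPVI.expF, Coord.add_c10, Pi.add_apply]
    ring
  · intro i hi
    simpa [adF, CoupledPVI.expF] using hX.c11 i hi

lemma HasDerivC.expH (hX : HasDerivC n X X' z) {F : ℂ → ℕ → ℂ} {F' : ℕ → ℂ}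
    (hF : ∀ i, HasDerivAt (fun w => F w i) (F' i) z) :
    HasDerivC n (fun w => expH n (F w) (X w))
      (adH n F' (CoupledPVI.expH n (F z) (X z)) + CoupledPVI.expH n (F z) X') z := by
  have key {f g : ℂ → ℂ} {f' g' : ℂ} (hf : HasDerivAt f f' z) (hg : HasDerivAt g g' z) :
      HasDerivAt (fun w => Complex.exp (f w) * g w)
        (f' * (Complex.exp (f z) * g z) + Complex.exp (f z) * g') z := by
    refine HasDerivAt.congr_deriv (hf.cexp.fun_mul hg) ?_
    ring
  constructor
  · intro k hk
    simpa [adH, CoupledPVI.expH] using hX.h k hk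
  · simpa [adH, CoupledPVI.expH] using hX.d
  · exact fun i h1 h2 => key (hF _) (hX.x i h1 h2)
  · intro i h1 h2
    refine HasDerivAt.congr_deriv (key (hF (2 * i)).fun_neg (hX.y i h1 h2)) ?_
    simp only [adH, CoupledPVI.expH, Coord.add_y, Pi.add_apply]
    ring
  · refine fun i hi => key ?_ (hX.c00 i hi)
    unfold wt00
    split_ifs <;> exact hF _
  · refine fun i hi => key ?_ (hX.c01 i hi)
    unfold wt01
    split_ifs <;> first | exact hF _ | exact (hF _).fun_add (hF _)
  · refine fun i hi => key ?_ (hX.c10 i hi)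
    unfold wt10
    split_ifs <;> first | exact hF _ | exact (hF _).fun_add (hF _)
  · refine fun i hi => key ?_ (hX.c11 i hi)
    unfold wt11
    split_ifs <;> first | exact (hF _).fun_add (hF _) | exact (hF _).fun_add ((hF _).fun_add (hF _))

end deriv

/-! ### Gauge covariance -/

/-- The gauge transform of a connection coefficient in coordinates. -/
noncomputable def gaugeCoord (n : ℕ) (γ γ' u u' : ℕ → ℂ) (a : ℂ) (η η' : ℕ → ℂ) (B : Coord) :
    Coord :=
  expF n η (expH n (hForm n u a) (expE n γ B + ⟨0, 0, γ', 0, 0, 0, 0, 0⟩)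
    + ⟨u', 0, 0, 0, 0, 0, 0, 0⟩) + ⟨0, 0, 0, η', 0, 0, 0, 0⟩

section gauge
variable {n : ℕ}

lemma elt_inE (v : ℕ → ℂ) : elt n ⟨0, 0, v, 0, 0, 0, 0, 0⟩ = evenE n v := by
  simp [elt, hElt_zero, evenF_zero, blockSum]

lemma elt_inF (v : ℕ → ℂ) : elt n ⟨0, 0, 0, v, 0, 0, 0, 0⟩ = evenF n v := by
  simp [elt, hElt_zero, evenE_zero, blockSum]

lemma elt_inH (v : ℕ → ℂ) (a : ℂ) : elt n ⟨v, a, 0, 0, 0, 0, 0, 0⟩ = hElt n v a := by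
  simp [elt, evenE_zero, evenF_zero, blockSum]

lemma elt_gaugeCoord (γ γ' u u' : ℕ → ℂ) (a : ℂ) (η η' : ℕ → ℂ) (B : Coord) :
    gaugeConn n (evenF n η) (evenF n η') (gaugeConn n (hElt n u a) (hElt n u' 0)
      (gaugeConn n (evenE n γ) (evenE n γ') (elt n B))) =
    elt n (gaugeCoord n γ γ' u u' a η η' B) := by
  rw [gaugeConn_of_comm (evenF_lie_evenF _ _), gaugeConn_of_comm (hElt_lie_hElt ..),
    gaugeConn_of_comm (evenE_lie_evenE _ _), expAd_evenE_elt, ← elt_inE, ← elt_add,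
    expAd_hElt_elt, ← elt_inH, ← elt_add, expAd_evenF_elt, ← elt_inF, ← elt_add, gaugeCoord]

variable {X : ℂ → Coord} {z : ℂ}

/-- A Lax equation `X' = [B, X]` is preserved by gauge transformations. -/
lemma exists_hasDerivC_gauge {X' B : Coord} (hX : HasDerivC n X X' z)
    (hlax : elt n X' = ⁅elt n B, elt n (X z)⁆) {γ u η : ℂ → ℕ → ℂ} {γ' u' η' : ℕ → ℂ} (a : ℂ)
    (hγ : ∀ i, 1 ≤ i → i ≤ n → HasDerivAt (fun w => γ w i) (γ' i) z)
    (hu : ∀ k < 2 * n + 3, HasDerivAt (fun w => u w k) (u' k) z)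
    (hη : ∀ i, 1 ≤ i → i ≤ n → HasDerivAt (fun w => η w i) (η' i) z) :
    ∃ Z, HasDerivC n (fun w => expF n (η w) (expH n (hForm n (u w) a) (expE n (γ w) (X w)))) Z z ∧
      elt n Z = ⁅elt n (gaugeCoord n (γ z) γ' (u z) u' a (η z) η' B),
        elt n (expF n (η z) (expH n (hForm n (u z) a) (expE n (γ z) (X z))))⁆ := by
  have h1 := hX.expE hγ
  have l1 : elt n (adE n γ' (expE n (γ z) (X z)) + expE n (γ z) X') =
      ⁅elt n (expE n (γ z) B + ⟨0, 0, γ', 0, 0, 0, 0, 0⟩), elt n (expE n (γ z) (X z))⁆ := by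
    rw [elt_add, ← evenE_lie_elt, expE_lie hlax, elt_add, elt_inE, add_lie, add_comm]
  have h2 := h1.expH (F := fun w => hForm n (u w) a)
    (fun i => hasDerivAt_hForm hu (hasDerivAt_const _ a) i)
  have l2 := expH_lie (u := u z) (a := a) l1
  have h3 := h2.expF hη
  refine ⟨_, h3, ?_⟩
  have l2' : elt n (adH n (hForm n u' 0) (expH n (hForm n (u z) a) (expE n (γ z) (X z)))
      + expH n (hForm n (u z) a) (adE n γ' (expE n (γ z) (X z)) + expE n (γ z) X')) =
      ⁅elt n (expH n (hForm n (u z) a) (expE n (γ z) B + ⟨0, 0, γ', 0, 0, 0, 0, 0⟩)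
        + ⟨u', 0, 0, 0, 0, 0, 0, 0⟩), elt n (expH n (hForm n (u z) a) (expE n (γ z) (X z)))⁆ := by
    rw [elt_add, ← hElt_lie_elt, l2, elt_add _ _ ⟨u', 0, 0, 0, 0, 0, 0, 0⟩, elt_inH, add_lie,
      add_comm]
  rw [gaugeCoord, elt_add, ← evenF_lie_elt, expF_lie l2', elt_add _ _ ⟨0, 0, 0, η', 0, 0, 0, 0⟩,
    elt_inF, add_lie, add_comm]

lemma expE_lin (v : ℕ → ℂ) (r s : ℂ) (X Y : Coord) :
    expE n v (r • X + s • Y) = r • expE n v X + s • expE n v Y := by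
  have hs (k : ℕ) : spread n (fun i => v i * (r * X.y i + s * Y.y i)) k =
      r * spread n (fun i => v i * X.y i) k + s * spread n (fun i => v i * Y.y i) k := by
    simp only [spread, tr]
    split_ifs <;> ring
  ext <;> simp only [expE, Coord.add_h, Coord.add_d, Coord.add_x, Coord.add_y, Coord.add_c00,
    Coord.add_c01, Coord.add_c10, Coord.add_c11, Coord.smul_h, Coord.smul_d, Coord.smul_x,
    Coord.smul_y, Coord.smul_c00, Coord.smul_c01, Coord.smul_c10, Coord.smul_c11, hs,
    hForm_add, hForm_smul, Pi.add_apply, Pi.smul_apply, smul_eq_mul] <;> ring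

lemma expF_lin (v : ℕ → ℂ) (r s : ℂ) (X Y : Coord) :
    expF n v (r • X + s • Y) = r • expF n v X + s • expF n v Y := by
  have hs (k : ℕ) : spread n (fun i => v i * (r * X.x i + s * Y.x i)) k =
      r * spread n (fun i => v i * X.x i) k + s * spread n (fun i => v i * Y.x i) k := by
    simp only [spread, tr]
    split_ifs <;> ring
  ext <;> simp only [expF, Coord.add_h, Coord.add_d, Coord.add_x, Coord.add_y, Coord.add_c00,
    Coord.add_c01, Coord.add_c10, Coord.add_c11, Coord.smul_h, Coord.smul_d, Coord.smul_x,
    Coord.smul_y, Coord.smul_c00, Coord.smul_c01, Coord.smul_c10, Coord.smul_c11, hs,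
    hForm_add, hForm_smul, Pi.add_apply, Pi.sub_apply, Pi.smul_apply, smul_eq_mul] <;> ring

lemma expH_lin (F : ℕ → ℂ) (r s : ℂ) (X Y : Coord) :
    expH n F (r • X + s • Y) = r • expH n F X + s • expH n F Y := by
  ext <;> simp only [expH, Coord.add_h, Coord.add_d, Coord.add_x, Coord.add_y, Coord.add_c00,
    Coord.add_c01, Coord.add_c10, Coord.add_c11, Coord.smul_h, Coord.smul_d, Coord.smul_x,
    Coord.smul_y, Coord.smul_c00, Coord.smul_c01, Coord.smul_c10, Coord.smul_c11,
    Pi.add_apply, Pi.smul_apply, smul_eq_mul] <;> ring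

lemma gaugeCoord_lin (γ γ₁ γ₂ u u₁ u₂ : ℕ → ℂ) (a : ℂ) (η η₁ η₂ : ℕ → ℂ) (r s : ℂ)
    (X Y : Coord) :
    gaugeCoord n γ (fun i => r * γ₁ i + s * γ₂ i) u (fun i => r * u₁ i + s * u₂ i) a η
      (fun i => r * η₁ i + s * η₂ i) (r • X + s • Y) =
    r • gaugeCoord n γ γ₁ u u₁ a η η₁ X + s • gaugeCoord n γ γ₂ u u₂ a η η₂ Y := by
  have hc (A A' B B' : Coord) :
      (r • A + s • A') + (r • B + s • B') = r • (A + B) + s • (A' + B') := by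
    ext <;> simp only [Coord.add_h, Coord.add_d, Coord.add_x, Coord.add_y, Coord.add_c00,
      Coord.add_c01, Coord.add_c10, Coord.add_c11, Coord.smul_h, Coord.smul_d, Coord.smul_x,
      Coord.smul_y, Coord.smul_c00, Coord.smul_c01, Coord.smul_c10, Coord.smul_c11,
      Pi.add_apply, Pi.smul_apply, smul_eq_mul] <;> ring
  have h1 (v w : ℕ → ℂ) : (⟨0, 0, fun i => r * v i + s * w i, 0, 0, 0, 0, 0⟩ : Coord) =
      r • ⟨0, 0, v, 0, 0, 0, 0, 0⟩ + s • ⟨0, 0, w, 0, 0, 0, 0, 0⟩ := by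
    ext <;> simp
  have h2 (v w : ℕ → ℂ) : (⟨fun i => r * v i + s * w i, 0, 0, 0, 0, 0, 0, 0⟩ : Coord) =
      r • ⟨v, 0, 0, 0, 0, 0, 0, 0⟩ + s • ⟨w, 0, 0, 0, 0, 0, 0, 0⟩ := by
    ext <;> simp
  have h3 (v w : ℕ → ℂ) : (⟨0, 0, 0, fun i => r * v i + s * w i, 0, 0, 0, 0⟩ : Coord) =
      r • ⟨0, 0, 0, v, 0, 0, 0, 0⟩ + s • ⟨0, 0, 0, w, 0, 0, 0, 0⟩ := by
    ext <;> simp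
  simp only [gaugeCoord]
  rw [h1, h2, h3, expE_lin, hc, expH_lin, hc, expF_lin, hc]

end gauge

/-! ### The operators in coordinates -/

section splitting
variable {M : Type*} [AddCommMonoid M]

lemma sum_range_split {n : ℕ} (hn : 1 ≤ n) (f : ℕ → M) :
    ∑ i ∈ range (n + 1), f i = f 0 + ∑ i ∈ Ico 1 n, f i + f n := by
  rw [sum_range_succ, range_eq_Ico, sum_eq_sum_Ico_succ_bot (by omega)]

lemma sum_range_parity (n : ℕ) (f : ℕ → M) :
    ∑ k ∈ range (2 * n + 3), f k =
      f 0 + ∑ i ∈ range (n + 1), f (2 * i + 1) + ∑ i ∈ Icc 1 n, f (2 * i) + f (2 * n + 2) := by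
  induction n with
  | zero => simp [sum_range_succ]
  | succ n ih =>
    rw [show 2 * (n + 1) + 3 = (2 * n + 3) + 1 + 1 by ring, sum_range_succ, sum_range_succ, ih,
      sum_range_succ (n := n + 1), sum_Icc_succ_top (by omega)]
    rw [show 2 * (n + 1) = 2 * n + 2 by ring]
    abel

lemma sum_Icc_parity {n : ℕ} (hn : 1 ≤ n) (f : ℕ → M) :
    ∑ k ∈ Icc 1 (2 * n), f k =
      f 1 + ∑ i ∈ Ico 1 n, (f (2 * i) + f (2 * i + 1)) + f (2 * n) := by
  induction n, hn using Nat.le_induction with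
  | base => simp [sum_Icc_succ_top]
  | succ n hn ih =>
    rw [show 2 * (n + 1) = 2 * n + 1 + 1 by ring, sum_Icc_succ_top (by omega),
      sum_Icc_succ_top (by omega), ih, sum_Ico_succ_top hn]
    abel

end splitting

/-- The sequence with the value `a` at `0`, the value `b` at `n` and the values `f i` in
between. -/
def pw (n : ℕ) (a : ℂ) (f : ℕ → ℂ) (b : ℂ) (i : ℕ) : ℂ :=
  if i = 0 then a else if i = n then b else f i

section blockforms
variable {n : ℕ}

lemma pw_zero (a : ℂ) (f : ℕ → ℂ) (b : ℂ) : pw n a f b 0 = a := rfl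

lemma pw_last (hn : 1 ≤ n) (a : ℂ) (f : ℕ → ℂ) (b : ℂ) : pw n a f b n = b := by
  rw [pw, if_neg (by omega), if_pos rfl]

lemma pw_mid {i : ℕ} (h1 : 1 ≤ i) (h2 : i < n) (a : ℂ) (f : ℕ → ℂ) (b : ℂ) :
    pw n a f b i = f i := by
  rw [pw, if_neg (by omega), if_neg (by omega)]

lemma blockSum_split (hn : 1 ≤ n) (a b c e : ℕ → ℂ) : blockSum n a b c e =
    (a 0 • chE n 0 + b 0 • e2 n 0 2 + c 0 • chE n 1 + e 0 • e2 n 1 2)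
    + ∑ i ∈ Ico 1 n, (a i • chE n (2 * i + 1) + b i • e2 n (2 * i + 1) (2 * i + 2)
      + c i • e2 n (2 * i) (2 * i + 1) + e i • e3 n (2 * i) (2 * i + 1) (2 * i + 2))
    + (a n • chE n (2 * n + 1) + b n • chE n (2 * n + 2) + c n • e2 n (2 * n) (2 * n + 1)
      + e n • e2 n (2 * n) (2 * n + 2)) := by
  have h0 : n ≠ 0 := by omega
  rw [blockSum, sum_range_split hn, w00_pos h0, w01_last h0, w10_pos h0, w11_last h0]
  congr 2
  refine sum_congr rfl fun i hi => ?_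
  rw [mem_Ico] at hi
  have h0 : i ≠ 0 := by omega
  have h1 : i ≠ n := by omega
  rw [w00_pos h0, w01_mid h0 h1, w10_pos h0, w11_mid h0 h1]
  rfl

lemma blockSum_pw (hn : 1 ≤ n) (a a' b b' c c' e e' : ℂ) (f g h k : ℕ → ℂ) :
    blockSum n (pw n a f a') (pw n b g b') (pw n c h c') (pw n e k e') =
    (a • chE n 0 + b • e2 n 0 2 + c • chE n 1 + e • e2 n 1 2)
    + ∑ i ∈ Ico 1 n, (f i • chE n (2 * i + 1) + g i • e2 n (2 * i + 1) (2 * i + 2)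
      + h i • e2 n (2 * i) (2 * i + 1) + k i • e3 n (2 * i) (2 * i + 1) (2 * i + 2))
    + (a' • chE n (2 * n + 1) + b' • chE n (2 * n + 2) + c' • e2 n (2 * n) (2 * n + 1)
      + e' • e2 n (2 * n) (2 * n + 2)) := by
  rw [blockSum_split hn]
  simp only [pw_zero, pw_last hn]
  congr 2
  refine sum_congr rfl fun i hi => ?_
  rw [mem_Ico] at hi
  simp only [pw_mid hi.1 hi.2]

/-- The coordinates of `Λ₁` and `Λ₂`. -/
lemma Lam_eq (hn : 1 ≤ n) (k : Fin 2) : Lam n k =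
    blockSum n (fun _ => if k = 0 then 1 else 0) (fun _ => if k = 0 then 0 else 1)
      (fun _ => if k = 0 then 0 else 1) (fun _ => if k = 0 then 1 else 0) := by
  rw [blockSum_split hn, Lam]
  split_ifs <;> simp only [one_smul, zero_smul, zero_add, add_zero, sum_add_distrib] <;> abel

/-- The block coefficients of an element in normal form. -/
noncomputable def nfCoord (n : ℕ) (h : ℕ → ℂ) (d : ℂ) (x b : ℕ → ℂ) : Coord where
  h := h
  d := d
  x := x
  y := 0
  c00 := pw n 1 (fun i => b (2 * i + 1)) (b (2 * n + 1))
  c01 := pw n 0 (fun _ => 1) (b (2 * n + 2))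
  c10 := pw n (b 1) (fun _ => 1) 1
  c11 := pw n 1 (fun _ => 0) 1

lemma normalForm_eq (hn : 1 ≤ n) (h : ℕ → ℂ) (d : ℂ) (x b : ℕ → ℂ) :
    hElt n h d + evenE n x + normalForm n b = elt n (nfCoord n h d x b) := by
  simp only [elt, nfCoord, evenF_zero, add_zero]
  congr 1
  rw [blockSum_pw hn, normalForm]
  simp only [one_smul, zero_smul, add_zero, sum_add_distrib]
  abel

/-- The coefficients of the `e_j`, `j` odd or `j = 2n + 2`, in `borelM`. -/
noncomputable def borelOdd (n : ℕ) (l c : ℕ → ℂ) (k : ℕ) : ℂ :=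
  if k = 1 then c 1 - l 1 else if k = 2 * n + 1 then l n - c (2 * n + 1)
  else if k = 2 * n + 2 then l n - c (2 * n + 2) else l (k / 2) - l (k / 2 + 1)

lemma borelM_eq (hn : 1 ≤ n) (κ : ℕ → ℂ) (κd : ℂ) (μ l c : ℕ → ℂ) :
    borelM n κ κd μ l c = elt n (nfCoord n κ κd μ (borelOdd n l c)) := by
  have h1 : borelOdd n l c 1 = c 1 - l 1 := if_pos rfl
  have h2 : borelOdd n l c (2 * n + 1) = l n - c (2 * n + 1) := by
    rw [borelOdd, if_neg (by omega), if_pos rfl]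
  have h3 : borelOdd n l c (2 * n + 2) = l n - c (2 * n + 2) := by
    rw [borelOdd, if_neg (by omega), if_neg (by omega), if_pos rfl]
  have h4 : ∑ i ∈ Ico 1 n, borelOdd n l c (2 * i + 1) • chE n (2 * i + 1) =
      ∑ i ∈ Ico 1 n, (l i - l (i + 1)) • chE n (2 * i + 1) := sum_congr rfl fun i hi => by
    rw [mem_Ico] at hi
    rw [borelOdd, if_neg (by omega), if_neg (by omega), if_neg (by omega),
      show (2 * i + 1) / 2 = i by omega]
  rw [← normalForm_eq hn, normalForm, h1, h2, h3, h4, borelM]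
  abel

/-- The coefficients of the `e_j`, `j` odd or `j = 2n + 2`, in `laxM`. -/
noncomputable def laxOdd (n : ℕ) (s : ℂ) (q : ℕ → ℂ) (k : ℕ) : ℂ :=
  (2 * n + 2) * if k = 1 then q 1 - s else if k = 2 * n + 1 then 1 - q n
  else if k = 2 * n + 2 then -q n else q (k / 2 + 1) - q (k / 2)

lemma natCast_ne_zero (n : ℕ) : (2 * n + 2 : ℂ) ≠ 0 := by
  exact_mod_cast (by omega : 2 * n + 2 ≠ 0)

lemma laxM_eq (hn : 1 ≤ n) (κ : ℕ → ℂ) (κd s : ℂ) (q p : ℕ → ℂ) :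
    laxM n κ κd s q p = elt n (nfCoord n κ κd (fun i => -p i) (laxOdd n s q)) := by
  have hN := natCast_ne_zero n
  have hodd (k : ℕ) (hk : k ≠ 0) (h : k % 2 = 1 ∨ k = 2 * n + 2) :
      (2 * n + 2 : ℂ) * phi n s q p k = laxOdd n s q k := by
    rw [phi, laxOdd, if_neg hk]
    congr 1
    split_ifs <;> first | rfl | omega
  have h0 : (2 * n + 2 : ℂ) * phi n s q p 0 = 1 := by
    rw [phi, if_pos rfl, mul_one_div_cancel hN]
  have heven : ∑ i ∈ Icc 1 n, ((2 * n + 2 : ℂ) * phi n s q p (2 * i)) • chE n (2 * i) =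
      evenE n fun i => -p i := by
    refine sum_congr rfl fun i hi => ?_
    rw [mem_Icc] at hi
    rw [phi, if_neg (by omega), if_neg (by omega), if_neg (by omega), if_neg (by omega),
      if_pos (by omega), Nat.mul_div_cancel_left _ (by omega), mul_div_cancel₀ _ hN]
  rw [← normalForm_eq hn, laxM, sum_range_parity, sum_range_split hn, sum_Icc_parity hn, heven,
    h0, hodd _ (by omega) (by omega), hodd _ (by omega) (by omega), hodd _ (by omega) (by omega),
    normalForm, sum_congr rfl fun i _ => by rw [hodd (2 * i + 1) (by omega) (by omega)]]
  simp only [one_smul]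
  abel

/-- The coordinates of the operator `B` with Cartan part `u` and coefficients `x i` at `e_{2i}`. -/
noncomputable def laxBCoord (n : ℕ) (u : ℕ → ℂ) (x : ℕ → ℂ) (s : ℂ) (q : ℕ → ℂ) : Coord where
  h := u
  d := 0
  x := x
  y := 0
  c00 := pw n ((q 1 - s) / (2 * n + 2))
    (fun i => s * (s - 1) - (q i - s) * (q (i + 1) - s)) ((s - 1) * q n)
  c01 := pw n (1 / (2 * n + 2) ^ 2) (fun i => -(q i - s) / (2 * n + 2)) (s * (q n - 1))
  c10 := pw n (s * (s - 1)) (fun i => (q (i + 1) - s) / (2 * n + 2)) (-(s - 1) / (2 * n + 2))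
  c11 := pw n 0 (fun _ => 1 / (2 * n + 2) ^ 2) (-s / (2 * n + 2))

lemma laxB_eq (hn : 1 ≤ n) (u α : ℕ → ℂ) (s : ℂ) (q p : ℕ → ℂ) :
    hElt n u 0 + laxBnil n α s q p = elt n (laxBCoord n u (xEven n α s q p) s q) := by
  simp only [elt, laxBCoord, evenF_zero, add_zero]
  rw [blockSum_pw hn, laxBnil]
  simp only [zero_smul, add_zero, sum_add_distrib]
  abel

end blockforms

/-! ### The Cartan subalgebra and the normalization of the parameters -/

/-- The coefficients of the imaginary root `δ = ∑_j δ_j α_j`. -/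
def deltaCoef (n j : ℕ) : ℂ :=
  if j = 0 ∨ j = 1 ∨ j = 2 * n + 1 ∨ j = 2 * n + 2 then 1 else 2

/-- The sum of the values of `f` at the neighbours of the vertex `j` of the Dynkin diagram. -/
def nbSum (n : ℕ) (f : ℕ → ℂ) (j : ℕ) : ℂ :=
  if j = 0 ∨ j = 1 then f 2 else if j = 2 * n + 1 ∨ j = 2 * n + 2 then f (2 * n)
  else f (j - 1) + f (j + 1) + (if j = 2 then f 0 else 0)
    + (if j = 2 * n then f (2 * n + 2) else 0)

section cartan
variable {n : ℕ}

lemma cartan_symm (n i j : ℕ) : cartan n i j = cartan n j i := by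
  unfold cartan
  simp only [eq_comm (a := i) (b := j)]
  congr 1
  exact if_congr (by tauto) rfl rfl

/-- Row `j` of the Cartan matrix applied to `f` is twice the value at `j` minus the sum over the
neighbours of `j` in the Dynkin diagram. -/
lemma sum_mul_cartan (hn : 1 ≤ n) (f : ℕ → ℂ) {j : ℕ} (hj : j < 2 * n + 3) :
    ∑ k ∈ range (2 * n + 3), f k * (cartan n k j : ℂ) = 2 * f j - nbSum n f j := by
  have hite (a : ℕ) (ha : a < 2 * n + 3) (r : ℂ) :
      ∑ k ∈ range (2 * n + 3), f k * (if k = a then r else 0) = r * f a := by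
    simp only [mul_ite, mul_zero, sum_ite_eq', mem_range]
    rw [if_pos ha, mul_comm]
  unfold nbSum
  split_ifs with h1 h2 h3 h4 h4
  · rw [sum_congr rfl (g := fun k => f k * (if k = j then 2 else 0)
      + f k * (if k = 2 then -1 else 0)), sum_add_distrib, hite _ hj, hite _ (by omega)]
    · ring
    · intro k _
      rw [← mul_add]
      congr 1
      unfold cartan
      split_ifs <;> first | omega | norm_num
  · rw [sum_congr rfl (g := fun k => f k * (if k = j then 2 else 0)
      + f k * (if k = 2 * n then -1 else 0)), sum_add_distrib, hite _ hj, hite _ (by omega)]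
    · ring
    · intro k hk
      rw [mem_range] at hk
      rw [← mul_add]
      congr 1
      unfold cartan
      split_ifs <;> first | omega | norm_num
  all_goals
    rw [sum_congr rfl (g := fun k => f k * (if k = j then 2 else 0)
      + f k * (if k = j - 1 then -1 else 0) + f k * (if k = j + 1 then -1 else 0)
      + f k * (if k = 0 then (if j = 2 then -1 else 0) else 0)
      + f k * (if k = 2 * n + 2 then (if j = 2 * n then -1 else 0) else 0)), sum_add_distrib,
      sum_add_distrib, sum_add_distrib, sum_add_distrib, hite _ hj, hite _ (by omega),
      hite _ (by omega), hite _ (by omega), hite _ (by omega)]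
  any_goals
    intro k hk
    rw [mem_range] at hk
    rw [← mul_add, ← mul_add, ← mul_add, ← mul_add]
    congr 1
    unfold cartan
    split_ifs <;> first | omega | norm_num
  · rw [if_pos h3, if_pos h4]; ring
  · rw [if_pos h3, if_neg h4]; ring
  · rw [if_neg h3, if_pos h4]; ring
  · rw [if_neg h3, if_neg h4]; ring

lemma hForm_eq (hn : 1 ≤ n) (c : ℕ → ℂ) (a : ℂ) {j : ℕ} (hj : j < 2 * n + 3) :
    hForm n c a j = 2 * c j - nbSum n c j + if j = 0 then a else 0 := by
  rw [hForm, sum_mul_cartan hn c hj]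

lemma sum_deltaCoef (hn : 1 ≤ n) (F : ℕ → ℂ) : ∑ j ∈ range (2 * n + 3), F j * deltaCoef n j =
    F 0 + F 1 + ∑ j ∈ Icc 2 (2 * n), 2 * F j + F (2 * n + 1) + F (2 * n + 2) := by
  rw [sum_range_succ, sum_range_succ, range_eq_Ico, sum_eq_sum_Ico_succ_bot (by omega),
    sum_eq_sum_Ico_succ_bot (by omega)]
  have h (j : ℕ) (hj : j = 0 ∨ j = 1 ∨ j = 2 * n + 1 ∨ j = 2 * n + 2) : deltaCoef n j = 1 :=
    if_pos hj
  rw [h _ (by omega), h _ (by omega), h _ (by omega), h _ (by omega)]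
  have : ∑ j ∈ Ico (0 + 1 + 1) (2 * n + 1), F j * deltaCoef n j =
      ∑ j ∈ Icc 2 (2 * n), 2 * F j := by
    refine sum_congr (by ext; simp only [mem_Ico, mem_Icc]; omega) fun j hj => ?_
    rw [mem_Icc] at hj
    rw [deltaCoef, if_neg (by omega), mul_comm]
  rw [this]
  ring

/-- `δ` takes the value `a` at `∑ c_k α_k^∨ + a d`. -/
lemma sum_hForm_mul_deltaCoef (hn : 1 ≤ n) (c : ℕ → ℂ) (a : ℂ) :
    ∑ j ∈ range (2 * n + 3), hForm n c a j * deltaCoef n j = a := by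
  simp only [hForm, add_mul, sum_add_distrib, sum_mul]
  rw [sum_comm]
  have h1 (k : ℕ) (hk : k < 2 * n + 3) :
      ∑ j ∈ range (2 * n + 3), c k * (cartan n k j : ℂ) * deltaCoef n j = 0 := by
    have := sum_mul_cartan hn (deltaCoef n) hk
    have h2 : 2 * deltaCoef n k - nbSum n (deltaCoef n) k = 0 := by
      unfold nbSum deltaCoef
      split_ifs <;> first | omega | (norm_num; done) |
        (simp only [false_or, or_false] at *; omega)
    rw [h2] at this
    rw [← mul_zero (c k), ← this, mul_sum]
    exact sum_congr rfl fun j _ => by rw [cartan_symm n j k]; ring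
  rw [sum_eq_zero fun k hk => h1 k (mem_range.1 hk), zero_add]
  rw [sum_eq_single 0 (fun j _ hj => by rw [if_neg hj, zero_mul])
    (fun h => absurd (mem_range.2 (by omega)) h), if_pos rfl, deltaCoef, if_pos (Or.inl rfl),
    mul_one]

lemma hForm_delta (hn : 1 ≤ n) (c : ℕ → ℂ) (a : ℂ) :
    hForm n c a 0 + hForm n c a 1 + ∑ j ∈ Icc 2 (2 * n), 2 * hForm n c a j
      + hForm n c a (2 * n + 1) + hForm n c a (2 * n + 2) = a := by
  rw [← sum_deltaCoef hn, sum_hForm_mul_deltaCoef hn]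

/-- The solution of `2 r_k - r_{k-1} - r_{k+1} = F_k` along the inner vertices of the Dynkin
diagram with `r_0 = 0`. -/
noncomputable def chainSol (F : ℕ → ℂ) (a : ℂ) : ℕ → ℂ
  | 0 => 0
  | 1 => (F 1 + (a - F 0)) / 2
  | 2 => a - F 0
  | (k + 3) => 2 * chainSol F a (k + 2) - chainSol F a (k + 1) - F (k + 2)

/-- All values at the simple roots occur, the coefficient of `d` being determined by the value
at `δ`. -/
lemma exists_hForm_eq (hn : 1 ≤ n) (F : ℕ → ℂ) {a : ℂ}
    (ha : ∑ j ∈ range (2 * n + 3), F j * deltaCoef n j = a) :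
    ∃ c : ℕ → ℂ, ∀ j < 2 * n + 3, hForm n c a j = F j := by
  set r := chainSol F a with hr
  set c : ℕ → ℂ := fun k => if k = 2 * n + 1 ∨ k = 2 * n + 2 then (F k + r (2 * n)) / 2 else r k
    with hc
  have hlo (k : ℕ) (hk : k ≤ 2 * n) : c k = r k := if_neg (by omega)
  have hhi (k : ℕ) (hk : k = 2 * n + 1 ∨ k = 2 * n + 2) : c k = (F k + r (2 * n)) / 2 := if_pos hk
  have hne (j : ℕ) (hj : j < 2 * n + 3) (hj' : j ≠ 2 * n) : hForm n c a j = F j := by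
    rw [hForm_eq hn c a hj, nbSum]
    by_cases h0 : j = 0
    · subst h0
      rw [if_pos (Or.inl rfl), if_pos rfl, hlo _ (by omega), hlo _ (by omega), hr, chainSol,
        chainSol]
      ring
    rw [if_neg h0]
    by_cases h1 : j = 1
    · subst h1
      rw [if_pos (Or.inr rfl), hlo _ (by omega), hlo _ (by omega), hr, chainSol, chainSol]
      ring
    rw [if_neg (by omega)]
    by_cases h2 : j = 2 * n + 1 ∨ j = 2 * n + 2
    · rw [if_pos h2, hhi j h2, hlo _ le_rfl]
      ring
    rw [if_neg h2, if_neg hj', hlo _ (by omega), hlo _ (by omega), hlo _ (by omega),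
      hlo 0 (by omega), hr, show chainSol F a 0 = 0 from rfl, ite_self]
    obtain ⟨k, rfl⟩ : ∃ k, j = k + 2 := ⟨j - 2, by omega⟩
    rw [show k + 2 - 1 = k + 1 from rfl, show k + 2 + 1 = k + 3 from rfl, chainSol]
    ring
  refine ⟨c, fun j hj => ?_⟩
  by_cases hj' : j = 2 * n
  · -- the remaining value is determined by the value at `δ`
    subst hj'
    have h := (sum_hForm_mul_deltaCoef hn c a).trans ha.symm
    have hmem : 2 * n ∈ range (2 * n + 3) := mem_range.2 hj
    rw [← add_sum_erase _ _ hmem, ← add_sum_erase _ _ hmem] at h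
    have h1 : ∑ j ∈ (range (2 * n + 3)).erase (2 * n), hForm n c a j * deltaCoef n j =
        ∑ j ∈ (range (2 * n + 3)).erase (2 * n), F j * deltaCoef n j :=
      sum_congr rfl fun j hj => by
        rw [hne j (mem_range.1 (mem_erase.1 hj).2) (mem_erase.1 hj).1]
    rw [h1] at h
    have h2 : deltaCoef n (2 * n) ≠ 0 := by unfold deltaCoef; split_ifs <;> norm_num
    exact mul_right_cancel₀ h2 (add_right_cancel h)
  · exact hne j hj hj'

/-- The normalization of the parameters says that the imaginary root takes the value `2n+2` at `κ`;
this value is the coefficient of `d`. -/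
lemma normalized_iff (hn : 1 ≤ n) (κ : ℕ → ℂ) (κd : ℂ) :
    Normalized n (alph n κ κd) ↔ κd = 2 * n + 2 := by
  have hN := natCast_ne_zero n
  have : (alph n κ κd 0 + alph n κ κd 1 + ∑ j ∈ Icc 2 (2 * n), 2 * alph n κ κd j
      + alph n κ κd (2 * n + 1) + alph n κ κd (2 * n + 2)) * (2 * n + 2) = κd := by
    refine Eq.trans ?_ (hForm_delta hn κ κd)
    simp only [alph, add_mul, sum_mul, mul_assoc, div_mul_cancel₀ _ hN]
  rw [Normalized, ← mul_left_inj' hN, this, one_mul]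

lemma exists_alph_eq (hn : 1 ≤ n) (α : ℕ → ℂ) :
    ∃ (κ : ℕ → ℂ) (κd : ℂ), ∀ j ∈ range (2 * n + 3), alph n κ κd j = α j := by
  obtain ⟨c, hc⟩ := exists_hForm_eq hn (fun j => (2 * n + 2) * α j) rfl
  refine ⟨c, ∑ j ∈ range (2 * n + 3), (2 * n + 2) * α j * deltaCoef n j, fun j hj => ?_⟩
  rw [alph, hc j (mem_range.1 hj), mul_div_cancel_left₀ _ (natCast_ne_zero n)]

end cartan

/-! ### Scalar form of the Lax equation -/

/-- The part without derivatives of the scalar equations expressed by the Lax equation, for the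
values `F` of the Cartan part of `B` and its coefficients `x` at the `e_{2i}`. -/
structure LaxAlg (n : ℕ) (α : ℕ → ℂ) (s : ℂ) (q p x F : ℕ → ℂ) : Prop where
  first00 : F 0 = α 0 * (q 1 - s)
  first01 : (2 * n + 2) * x 1 = -(α 0 + α 2) - (q 1 - s) * p 1
  first11 : F 1 + F 2 = (2 * n + 2) * x 1 * (q 1 - s) + p 1 * (s * (s - 1))
  mid01 : ∀ i, 1 ≤ i → i < n → F (2 * i + 1) + F (2 * i + 2) =
    -(α (2 * i + 1) + α (2 * i + 2)) * (q i - s) + (2 * n + 2) * x (i + 1) * (q (i + 1) - q i)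
      + p (i + 1) * (s * (s - 1) - (q i - s) * (q (i + 1) - s))
  mid10 : ∀ i, 1 ≤ i → i < n → F (2 * i) + F (2 * i + 1) =
    (α (2 * i) + α (2 * i + 1)) * (q (i + 1) - s) - (2 * n + 2) * x i * (q (i + 1) - q i)
      - p i * (s * (s - 1) - (q i - s) * (q (i + 1) - s))
  mid11 : ∀ i, 1 ≤ i → i < n → (2 * n + 2) * x (i + 1) = (2 * n + 2) * x i
    - (α (2 * i) + (α (2 * i + 1) + α (2 * i + 2))) - p i * (q i - s) - p (i + 1) * (q (i + 1) - s)
  last10 : F (2 * n) + F (2 * n + 1) = -(α (2 * n) + α (2 * n + 1)) * (s - 1)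
    - (2 * n + 2) * x n * (1 - q n) - p n * ((s - 1) * q n)
  last11 : F (2 * n) + F (2 * n + 2) = -(α (2 * n) + α (2 * n + 2)) * s
    + (2 * n + 2) * x n * q n - p n * (s * (q n - 1))

/-- The part with derivatives of the scalar equations expressed by the Lax equation; `Q` and `P`
stand for `s(s-1) dq/ds` and `s(s-1) dp/ds`. -/
structure LaxDyn (n : ℕ) (α : ℕ → ℂ) (s : ℂ) (q p x F Q P : ℕ → ℂ) : Prop where
  even : ∀ i, 1 ≤ i → i ≤ n → P i = F (2 * i) * p i + (2 * n + 2) * α (2 * i) * x i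
  first : Q 1 - s * (s - 1) = F 1 * (q 1 - s) - α 1 * (s * (s - 1))
  mid : ∀ i, 1 ≤ i → i < n → Q (i + 1) - Q i = F (2 * i + 1) * (q (i + 1) - q i)
    - α (2 * i + 1) * (s * (s - 1) - (q i - s) * (q (i + 1) - s))
  last00 : -Q n = F (2 * n + 1) * (1 - q n) - α (2 * n + 1) * ((s - 1) * q n)
  last01 : -Q n = -F (2 * n + 2) * q n - α (2 * n + 2) * (s * (q n - 1))

lemma Ioc_eq_Icc_succ (i n : ℕ) : Ioc i n = Icc (i + 1) n := by
  ext; simp only [mem_Ioc, mem_Icc]; omega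

section recursions
variable (n : ℕ) (α : ℕ → ℂ) (s : ℂ) (q p : ℕ → ℂ)

lemma sumS_zero : sumS s q p 0 = 0 := by simp [sumS]

lemma sumS_succ (i : ℕ) :
    sumS s q p (i + 1) = sumS s q p i + 2 * ((q (i + 1) - s) * p (i + 1)) := by
  rw [sumS, sum_Icc_succ_top (by omega), ← sumS]

lemma sumT_last : sumT n α q p (n + 1) = 0 := by simp [sumT]

variable {n} in
lemma sumT_step {i : ℕ} (hi : i ≤ n) : sumT n α q p i =
    2 * (q i * ((q i - 1) * p i + α (2 * i))) + sumT n α q p (i + 1) := by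
  rw [sumT, ← add_sum_Ioc_eq_sum_Icc hi, sumT, Ioc_eq_Icc_succ]

lemma beta0_one : beta0 α 1 = α 1 := by simp [beta0]

lemma beta0_succ {i : ℕ} (hi : 1 ≤ i) : beta0 α (i + 1) = beta0 α i + α (2 * i + 1) := by
  rw [beta0, sum_Ico_succ_top hi, beta0, add_assoc]

lemma beta1_one : beta1 α 1 = α 0 := by simp [beta1]

lemma beta1_succ {i : ℕ} (hi : 1 ≤ i) :
    beta1 α (i + 1) = beta1 α i + 2 * α (2 * i) + α (2 * i + 1) := by
  rw [beta1, sum_Ico_succ_top hi, sum_Ico_succ_top hi, beta1]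
  ring

lemma beta3_last : beta3 n α n = α (2 * n + 1) := by simp [beta3]

variable {n} in
lemma beta3_step {i : ℕ} (hi : i < n) :
    beta3 n α i = beta3 n α (i + 1) + α (2 * i + 1) + 2 * α (2 * (i + 1)) := by
  rw [beta3, sum_eq_sum_Ico_succ_bot hi, ← add_sum_Ioc_eq_sum_Icc (by omega : i + 1 ≤ n), beta3,
    Ioc_eq_Icc_succ]
  ring

lemma beta4_last : beta4 n α n = α (2 * n + 2) := by simp [beta4]

variable {n} in
lemma beta4_step {i : ℕ} (hi : i < n) : beta4 n α i = beta4 n α (i + 1) + α (2 * i + 1) := by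
  rw [beta4, sum_eq_sum_Ico_succ_bot hi, beta4]
  ring

variable {n α} in
lemma beta_sum (hα : Normalized n α) {i : ℕ} (h1 : 1 ≤ i) (h2 : i ≤ n) :
    beta0 α i + beta1 α i + 2 * α (2 * i) + beta3 n α i + beta4 n α i = 1 := by
  have hn := h1.trans h2
  have hlast : beta0 α n + beta1 α n + 2 * α (2 * n) + beta3 n α n + beta4 n α n = 1 := by
    rw [beta3_last, beta4_last, ← hα, beta0, beta1]
    have h := sum_Icc_parity hn fun j => 2 * α j
    rw [← add_sum_Ioc_eq_sum_Icc (by omega), Ioc_eq_Icc_succ,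
      sum_add_distrib] at h
    simp only [← mul_sum] at h ⊢
    linear_combination -h
  induction h2 using Nat.decreasingInduction with
  | self => exact hlast
  | of_succ k hk ih =>
    have h3 := beta3_step α hk
    have h4 := beta4_step α hk
    have h := ih (by omega)
    rw [beta0_succ α h1, beta1_succ α h1] at h
    rw [h3, h4]
    linear_combination h

variable {n} in
lemma mul_xEven {i : ℕ} (hi : 1 ≤ i) : (2 * n + 2) * xEven n α s q p i =
    -(sumS s q p (i - 1) + beta1 α i + (q i - s) * p i + α (2 * i)) := by
  rw [xEven, mul_div_cancel₀ _ (natCast_ne_zero n), beta1, sumS,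
    show Icc 1 (i - 1) = Ico 1 i by ext; simp only [mem_Icc, mem_Ico]; omega]
  simp only [mul_add, sum_add_distrib]
  ring

lemma uForm_zero : uForm n α s q p 0 = α 0 * (q 1 - s) := if_pos rfl

lemma uForm_one : uForm n α s q p 1 = α 0 * (q 1 + s - 1) + sumT n α q p 1
    + (2 * α 2 + beta3 n α 1) * (s - 1) + beta4 n α 1 * s := by
  rw [uForm, if_neg (by omega), if_pos rfl]

variable {n} in
lemma uForm_even {i : ℕ} (h1 : 1 ≤ i) (h2 : i ≤ n) :
    uForm n α s q p (2 * i) = uEven n α s q p i := by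
  rw [uForm, if_neg (by omega), if_neg (by omega), if_neg (by omega), if_neg (by omega),
    if_pos (by omega), Nat.mul_div_cancel_left _ (by omega)]

variable {n} in
lemma uForm_odd {i : ℕ} (h1 : 1 ≤ i) (h2 : i < n) :
    uForm n α s q p (2 * i + 1) = uOdd n α s q p i := by
  rw [uForm, if_neg (by omega), if_neg (by omega), if_neg (by omega), if_neg (by omega),
    if_neg (by omega), show (2 * i + 1) / 2 = i by omega]

variable {n} in
lemma uForm_last0 (hn : 1 ≤ n) : uForm n α s q p (2 * n + 1) =
    (sumS s q p n + beta1 α n + 2 * α (2 * n)) * q n + α (2 * n + 2) * s := by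
  rw [uForm, if_neg (by omega), if_neg (by omega), if_pos rfl]

lemma uForm_last1 : uForm n α s q p (2 * n + 2) =
    (sumS s q p n + beta1 α n + 2 * α (2 * n)) * (q n - 1) + α (2 * n + 1) * (s - 1) := by
  rw [uForm, if_neg (by omega), if_neg (by omega), if_neg (by omega), if_pos rfl]

variable {n} in
/-- The prescribed coefficients of `B` satisfy the equations without derivatives. -/
lemma laxAlg_uForm (hn : 1 ≤ n) :
    LaxAlg n α s q p (xEven n α s q p) (uForm n α s q p) where
  first00 := uForm_zero ..
  first01 := by
    rw [mul_xEven α s q p le_rfl, Nat.sub_self, sumS_zero, beta1_one]; ring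
  first11 := by
    rw [mul_xEven α s q p le_rfl, Nat.sub_self, sumS_zero, beta1_one, uForm_one,
      uForm_even (i := 1) α s q p le_rfl hn, uEven, Nat.sub_self, sumS_zero, sumT_step α q p hn,
      beta1_one]
    ring
  mid01 i h1 h2 := by
    rw [show 2 * i + 2 = 2 * (i + 1) by ring, mul_xEven α s q p (by omega),
      uForm_odd α s q p h1 h2, uForm_even (i := i + 1) α s q p (by omega) h2, uOdd, uEven, Nat.add_sub_cancel,
      sumT_step α q p (i := i + 1) h2, beta1_succ α h1]
    simp only [mul_add, mul_one]
    ring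
  mid10 i h1 h2 := by
    obtain ⟨i, rfl⟩ := Nat.exists_eq_add_of_le' h1
    rw [mul_xEven α s q p (by omega), uForm_odd α s q p h1 h2,
      uForm_even α s q p (by omega) h2.le, uOdd, uEven, Nat.add_sub_cancel, sumS_succ,
      beta3_step α h2, beta4_step α h2]
    simp only [mul_add, mul_one]
    ring
  mid11 i h1 h2 := by
    obtain ⟨i, rfl⟩ := Nat.exists_eq_add_of_le' h1
    rw [mul_xEven α s q p (by omega), mul_xEven α s q p (by omega), Nat.add_sub_cancel,
      Nat.add_sub_cancel, sumS_succ, beta1_succ α h1]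
    simp only [mul_add, mul_one]
    ring
  last10 := by
    obtain ⟨m, hm⟩ := Nat.exists_eq_add_of_le' hn
    have hS : sumS s q p n = sumS s q p (n - 1) + 2 * ((q n - s) * p n) := by
      rw [hm, sumS_succ, Nat.add_sub_cancel]
    rw [mul_xEven α s q p hn, uForm_last0 α s q p hn, uForm_even α s q p hn le_rfl, uEven, hS,
      sumT_last, beta3_last, beta4_last]
    ring
  last11 := by
    obtain ⟨m, hm⟩ := Nat.exists_eq_add_of_le' hn
    have hS : sumS s q p n = sumS s q p (n - 1) + 2 * ((q n - s) * p n) := by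
      rw [hm, sumS_succ, Nat.add_sub_cancel]
    rw [mul_xEven α s q p hn, uForm_last1 n α s q p, uForm_even α s q p hn le_rfl, uEven, hS,
      sumT_last, beta3_last, beta4_last]
    ring

end recursions

/-- The equations without derivatives determine `x`, and they determine `F` up to a multiple of
a vector with the alternating entries `0, 1, -1, 1, …, -1, 1, 1`, to which `δ` assigns the
value `1`. -/
lemma LaxAlg.unique {n : ℕ} (hn : 1 ≤ n) {α : ℕ → ℂ} {s : ℂ} {q p x F x' F' : ℕ → ℂ}
    (h : LaxAlg n α s q p x F) (h' : LaxAlg n α s q p x' F')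
    (hδ : ∑ j ∈ range (2 * n + 3), F j * deltaCoef n j =
      ∑ j ∈ range (2 * n + 3), F' j * deltaCoef n j) :
    (∀ i, 1 ≤ i → i ≤ n → x i = x' i) ∧ ∀ k < 2 * n + 3, F k = F' k := by
  have hN := natCast_ne_zero n
  have hx : ∀ i, 1 ≤ i → i ≤ n → x i = x' i := by
    intro i h1
    induction i, h1 using Nat.le_induction with
    | base => exact fun _ => mul_left_cancel₀ hN (h.first01.trans h'.first01.symm)
    | succ i h1 ih =>
      intro h2
      have := h.mid11 i h1 (by omega)
      rw [ih (by omega), ← h'.mid11 i h1 (by omega)] at this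
      exact mul_left_cancel₀ hN this
  refine ⟨hx, ?_⟩
  set g := F 1 - F' 1 with hg
  have hstep (i : ℕ) (hi : i < n) (ho : F (2 * i + 1) - F' (2 * i + 1) = g) :
      F (2 * i + 2) - F' (2 * i + 2) = -g := by
    rcases Nat.eq_zero_or_pos i with rfl | h1
    · have e1 := h.first11
      have e2 := h'.first11
      rw [hx 1 le_rfl hn] at e1
      linear_combination e1 - e2 - ho
    · have e1 := h.mid01 i h1 hi
      have e2 := h'.mid01 i h1 hi
      rw [hx (i + 1) (by omega) hi] at e1
      linear_combination e1 - e2 - ho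
  have hodd : ∀ i < n, F (2 * i + 1) - F' (2 * i + 1) = g := by
    intro i
    induction i with
    | zero => exact fun _ => hg.symm
    | succ i ih =>
      intro hi
      have e0 := hstep i (by omega) (ih (by omega))
      have e1 := h.mid10 (i + 1) (by omega) hi
      have e2 := h'.mid10 (i + 1) (by omega) hi
      rw [hx (i + 1) (by omega) (by omega)] at e1
      rw [show 2 * i + 2 = 2 * (i + 1) by ring] at e0
      linear_combination e1 - e2 - e0
  have heven (i : ℕ) (h1 : 1 ≤ i) (h2 : i ≤ n) : F (2 * i) - F' (2 * i) = -g := by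
    obtain ⟨j, rfl⟩ := Nat.exists_eq_add_of_le' h1
    exact hstep j h2 (hodd j h2)
  have hl0 : F (2 * n + 1) - F' (2 * n + 1) = g := by
    have e1 := h.last10
    have e2 := h'.last10
    rw [hx n hn le_rfl] at e1
    linear_combination e1 - e2 - heven n hn le_rfl
  have hl1 : F (2 * n + 2) - F' (2 * n + 2) = g := by
    have e1 := h.last11
    have e2 := h'.last11
    rw [hx n hn le_rfl] at e1
    linear_combination e1 - e2 - heven n hn le_rfl
  have h0 : F 0 - F' 0 = 0 := by rw [h.first00, h'.first00, sub_self]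
  have hzero : g = 0 := by
    have hs : ∑ k ∈ range (2 * n + 3), (F k - F' k) * deltaCoef n k = g := by
      rw [sum_deltaCoef hn fun k => F k - F' k, h0, hl0, hl1]
      have hz (i : ℕ) (hi : i ∈ Ico 1 n) :
          2 * (F (2 * i) - F' (2 * i)) + 2 * (F (2 * i + 1) - F' (2 * i + 1)) = 0 := by
        rw [mem_Ico] at hi
        rw [heven i hi.1 hi.2.le, hodd i hi.2]
        ring
      have h := sum_Icc_parity hn fun k => 2 * (F k - F' k)
      rw [← add_sum_Ioc_eq_sum_Icc (by omega), Ioc_eq_Icc_succ,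
        heven n hn le_rfl, sum_congr (s₁ := Ico 1 n) rfl hz] at h
      simp only [sum_const_zero] at h
      linear_combination h
    simp only [sub_mul, sum_sub_distrib] at hs
    rw [← hs, hδ, sub_self]
  intro k hk
  rw [← sub_eq_zero]
  rcases Nat.even_or_odd' k with ⟨i, rfl | rfl⟩
  · rcases Nat.eq_zero_or_pos i with rfl | h1
    · exact h0
    · by_cases h2 : i ≤ n
      · rw [heven i h1 h2, hzero, neg_zero]
      · obtain rfl : i = n + 1 := by omega
        rw [show 2 * (n + 1) = 2 * n + 2 by ring, hl1, hzero]
  · by_cases h2 : i < n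
    · rw [hodd i h2, hzero]
    · obtain rfl : i = n := by omega
      rw [hl0, hzero]

/-- The prescribed values of the Cartan part of `B` are those of a combination of the `α_k^∨`: in
the value at `δ`, the contributions of the inner blocks telescope. -/
lemma sum_uForm {n : ℕ} (hn : 1 ≤ n) (α : ℕ → ℂ) (s : ℂ) (q p : ℕ → ℂ) :
    ∑ j ∈ range (2 * n + 3), uForm n α s q p j * deltaCoef n j = 0 := by
  have h := laxAlg_uForm α s q p hn
  set F := uForm n α s q p with hF
  set x := xEven n α s q p with hx
  set G : ℕ → ℂ := fun i => α (2 * i) * (q i - s) + p i * (q i - s) ^ 2 - p i * (s * (s - 1))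
    with hG
  have hmid : ∑ i ∈ Ico 1 n, (F (2 * i) + 2 * F (2 * i + 1) + F (2 * (i + 1))) = G 1 - G n := by
    rw [← neg_sub (G n), ← sum_Ico_sub G hn, ← sum_neg_distrib]
    refine sum_congr rfl fun i hi => ?_
    rw [mem_Ico] at hi
    have h1 := h.mid01 i hi.1 hi.2
    have h2 := h.mid10 i hi.1 hi.2
    have h3 := h.mid11 i hi.1 hi.2
    rw [show 2 * i + 2 = 2 * (i + 1) by ring] at h1 h3
    simp only [hG]
    linear_combination h1 + h2 + (q (i + 1) - q i) * h3
  have hsum : ∑ i ∈ Ico 1 n, (F (2 * i) + 2 * F (2 * i + 1) + F (2 * (i + 1))) =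
      ∑ j ∈ Icc 2 (2 * n), 2 * F j - F 2 - F (2 * n) := by
    have h1 := sum_Icc_parity hn fun j => 2 * F j
    rw [← add_sum_Ioc_eq_sum_Icc (by omega), Ioc_eq_Icc_succ] at h1
    have h2 := sum_Ico_sub (fun i => F (2 * i)) hn
    rw [← sub_eq_zero] at h1 h2 ⊢
    simp only [sum_add_distrib, sum_sub_distrib, ← mul_sum] at h1 h2 ⊢
    linear_combination h2 - h1
  have e1 := h.first01
  have e2 := h.first11
  have e3 := h.last10
  have e4 := h.last11
  have e5 : F (2 * n) = uEven n α s q p n := uForm_even α s q p hn le_rfl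
  have e6 := mul_xEven (n := n) α s q p hn
  rw [uEven, sumT_last, beta3_last, beta4_last] at e5
  rw [hsum] at hmid
  rw [sum_deltaCoef hn, h.first00]
  simp only [hG] at hmid
  rw [← hx] at e6
  linear_combination hmid + e2 + (q 1 - s) * e1 + e3 + e4 - e5 + (2 * q n - 1) * e6

/-! ### The Hamiltonian vector field -/

/-- The derivative of the Hamiltonian in the direction `p_i`. -/
noncomputable def hamP (n : ℕ) (α : ℕ → ℂ) (s : ℂ) (q p : ℕ → ℂ) (i : ℕ) : ℂ :=
  2 * (q i * (q i - 1) * (q i - s)) * p i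
    - ((beta0 α i - 1) * q i * (q i - 1) + beta3 n α i * q i * (q i - s)
        + beta4 n α i * (q i - 1) * (q i - s))
    + (q i - s) * sumT n α q p (i + 1) + sumS s q p (i - 1) * (q i * (q i - 1))

/-- The derivative of the Hamiltonian in the direction `q_i`. -/
noncomputable def hamQ (n : ℕ) (α : ℕ → ℂ) (s : ℂ) (q p : ℕ → ℂ) (i : ℕ) : ℂ :=
  (3 * q i ^ 2 - 2 * (1 + s) * q i + s) * p i ^ 2
    - ((beta0 α i - 1) * (2 * q i - 1) + beta3 n α i * (2 * q i - s)
        + beta4 n α i * (2 * q i - 1 - s)) * p i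
    + α (2 * i) * (α (2 * i) + beta1 α i)
    + p i * sumT n α q p (i + 1) + sumS s q p (i - 1) * ((2 * q i - 1) * p i + α (2 * i))

section poisson
variable {n : ℕ} (α : ℕ → ℂ) (s : ℂ) (q p : ℕ → ℂ)

lemma hasDerivAt_update_apply (f : ℕ → ℂ) (k i : ℕ) :
    HasDerivAt (fun z => Function.update f k z i) (if i = k then 1 else 0) (f k) := by
  by_cases h : i = k
  · subst h
    simpa using hasDerivAt_id' (f i)
  · simpa [Function.update_of_ne h, h] using hasDerivAt_const (f k) (f i)

lemma sum_Icc_ite {k : ℕ} (h1 : 1 ≤ k) (h2 : k ≤ n) (f : ℕ → ℂ) :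
    ∑ i ∈ Icc 1 n, (if i = k then f i else 0) = f k := by
  rw [sum_ite_eq', if_pos (mem_Icc.2 ⟨h1, h2⟩)]

lemma sum_sum_Icc_ite {k : ℕ} (h2 : k ≤ n) (f : ℕ → ℕ → ℂ) :
    ∑ i ∈ Icc 1 n, ∑ j ∈ Icc (i + 1) n, (if j = k then f i j else 0) =
      ∑ i ∈ Icc 1 (k - 1), f i k := by
  simp only [sum_ite_eq', mem_Icc]
  rw [← sum_filter]
  refine sum_congr ?_ fun _ _ => rfl
  ext i
  simp only [mem_filter, mem_Icc]
  omega

/-- The Hamiltonian is quadratic in each `p_k`; besides `H_k`, the coupling terms with `i = k` give a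
sum over later indices and those with `j = k` a sum over earlier ones. -/
lemma hasDerivAt_ham_p {k : ℕ} (h1 : 1 ≤ k) (h2 : k ≤ n) :
    HasDerivAt (fun z => ham n α s q (Function.update p k z)) (hamP n α s q p k) (p k) := by
  have hu := hasDerivAt_update_apply p k
  unfold ham hamPVI
  refine HasDerivAt.congr_deriv (HasDerivAt.fun_add (HasDerivAt.fun_sum fun i _ =>
      ((((hu i).fun_pow 2).const_mul _).fun_sub ((hu i).const_mul _)).add_const _)
    (HasDerivAt.fun_sum fun i _ => HasDerivAt.fun_sum fun j _ =>
      (((hu i).const_mul _).mul_const _).fun_mul (((hu j).const_mul _).add_const _))) ?_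
  simp only [Function.update_eq_self]
  rw [sum_congr rfl (g := fun i => if i = k then 2 * (q i * (q i - 1) * (q i - s)) * p i
    - ((beta0 α i - 1) * q i * (q i - 1) + beta3 n α i * q i * (q i - s)
        + beta4 n α i * (q i - 1) * (q i - s)) else 0), sum_Icc_ite h1 h2]
  · simp only [sum_add_distrib]
    rw [sum_congr (s₁ := Icc 1 n) rfl (g := fun i => if i = k then
        (q i - s) * sumT n α q p (i + 1) else 0), sum_Icc_ite h1 h2]
    · rw [sum_congr (s₁ := Icc 1 n) rfl (g := fun i => ∑ j ∈ Icc (i + 1) n, if j = k then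
          2 * ((q i - s) * p i) * (q j * (q j - 1)) else 0), sum_sum_Icc_ite h2, ← sum_mul,
          ← sumS, hamP]
      · ring
      · intro i _
        refine sum_congr rfl fun j _ => ?_
        split_ifs <;> ring
    · intro i _
      split_ifs
      · rw [sumT, mul_sum]
        exact sum_congr rfl fun j _ => by ring
      · exact sum_eq_zero fun j _ => by ring
  · intro i _
    split_ifs
    · push_cast; ring
    · ring

lemma hasDerivAt_ham_q {k : ℕ} (h1 : 1 ≤ k) (h2 : k ≤ n) :
    HasDerivAt (fun z => ham n α s (Function.update q k z) p) (hamQ n α s q p k) (q k) := by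
  have hu := hasDerivAt_update_apply q k
  unfold ham hamPVI
  refine HasDerivAt.congr_deriv (HasDerivAt.fun_add (HasDerivAt.fun_sum fun i _ =>
      (((((hu i).fun_mul ((hu i).sub_const _)).fun_mul ((hu i).sub_const _)).mul_const _).fun_sub
        ((((((hu i).const_mul _).fun_mul ((hu i).sub_const _)).fun_add
          (((hu i).const_mul _).fun_mul ((hu i).sub_const _))).fun_add
          ((((hu i).sub_const _).const_mul _).fun_mul ((hu i).sub_const _))).mul_const _)).fun_add
        ((hu i).const_mul _))
    (HasDerivAt.fun_sum fun i _ => HasDerivAt.fun_sum fun j _ =>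
      (((((hu i).sub_const _).const_mul _).mul_const _).fun_mul (hu j)).fun_mul
        ((((hu j).sub_const _).mul_const _).add_const _))) ?_
  simp only [Function.update_eq_self]
  rw [sum_congr rfl (g := fun i => if i = k then
    (3 * q i ^ 2 - 2 * (1 + s) * q i + s) * p i ^ 2
    - ((beta0 α i - 1) * (2 * q i - 1) + beta3 n α i * (2 * q i - s)
        + beta4 n α i * (2 * q i - 1 - s)) * p i
    + α (2 * i) * (α (2 * i) + beta1 α i) else 0), sum_Icc_ite h1 h2]
  · rw [sum_congr (s₁ := Icc 1 n) rfl (g := fun i => (if i = k then p i * sumT n α q p (i + 1) else 0)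
      + ∑ j ∈ Icc (i + 1) n, if j = k then
          2 * ((q i - s) * p i) * ((2 * q j - 1) * p j + α (2 * j)) else 0), sum_add_distrib,
      sum_Icc_ite h1 h2, sum_sum_Icc_ite h2, ← sum_mul, ← sumS, hamQ]
    · ring
    · intro i _
      have : (if i = k then p i * sumT n α q p (i + 1) else 0) = ∑ j ∈ Icc (i + 1) n,
          if i = k then p i * (2 * (q j * ((q j - 1) * p j + α (2 * j)))) else 0 := by
        split_ifs
        · rw [sumT, mul_sum]
        · rw [sum_const_zero]
      rw [this, ← sum_add_distrib]
      refine sum_congr rfl fun j _ => ?_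
      split_ifs <;> ring
  · intro i _
    split_ifs <;> ring

lemma dq_apply (k i : ℕ) : dq k (fun Q _ => Q i) q p = if i = k then 1 else 0 :=
  (hasDerivAt_update_apply q k i).deriv

lemma dp_apply (k i : ℕ) : dp k (fun _ P => P i) q p = if i = k then 1 else 0 :=
  (hasDerivAt_update_apply p k i).deriv

lemma poisson_q {i : ℕ} (h1 : 1 ≤ i) (h2 : i ≤ n) :
    poisson n (ham n α s) (fun Q _ => Q i) q p = hamP n α s q p i := by
  have hd (k : ℕ) : dp k (fun (Q : ℕ → ℂ) (_ : ℕ → ℂ) => Q i) q p = 0 := by simp [dp]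
  simp only [poisson, hd, dq_apply, mul_zero, sub_zero, mul_ite, mul_one, sum_ite_eq, mem_Icc]
  rw [if_pos ⟨h1, h2⟩]
  exact (hasDerivAt_ham_p α s q p h1 h2).deriv

lemma poisson_p {i : ℕ} (h1 : 1 ≤ i) (h2 : i ≤ n) :
    poisson n (ham n α s) (fun _ P => P i) q p = -hamQ n α s q p i := by
  have hd (k : ℕ) : dq k (fun (_ : ℕ → ℂ) (P : ℕ → ℂ) => P i) q p = 0 := by simp [dq]
  simp only [poisson, hd, dp_apply, mul_zero, zero_sub, mul_ite, mul_one, sum_neg_distrib,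
    sum_ite_eq, mem_Icc]
  rw [if_pos ⟨h1, h2⟩]
  exact congrArg _ (hasDerivAt_ham_q α s q p h1 h2).deriv

lemma isSasanoSolution_iff (U : Set ℂ) (q p : ℕ → ℂ → ℂ) :
    IsSasanoSolution n U α q p ↔ ∀ s ∈ U, ∀ i, 1 ≤ i → i ≤ n → ∃ q' p' : ℂ,
      HasDerivAt (q i) q' s ∧ HasDerivAt (p i) p' s ∧
      s * (s - 1) * q' = hamP n α s (fun j => q j s) (fun j => p j s) i ∧
      s * (s - 1) * p' = -hamQ n α s (fun j => q j s) (fun j => p j s) i := by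
  refine forall₂_congr fun s _ => forall_congr' fun i => ?_
  constructor
  · intro h h1 h2
    have := h (mem_Icc.2 ⟨h1, h2⟩)
    rwa [poisson_q _ _ _ _ h1 h2, poisson_p _ _ _ _ h1 h2] at this
  · intro h hi
    obtain ⟨h1, h2⟩ := mem_Icc.1 hi
    rw [poisson_q _ _ _ _ h1 h2, poisson_p _ _ _ _ h1 h2]
    exact h h1 h2

variable {α}

/-- The Hamiltonian vector field satisfies the equations with derivatives. -/
lemma laxDyn_ham (hn : 1 ≤ n) (hα : Normalized n α) :
    LaxDyn n α s q p (xEven n α s q p) (uForm n α s q p) (hamP n α s q p)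
      (fun i => -hamQ n α s q p i) where
  even i h1 h2 := by
    have h := beta_sum hα h1 h2
    rw [show (2 * n + 2) * α (2 * i) * xEven n α s q p i =
      α (2 * i) * ((2 * n + 2) * xEven n α s q p i) by ring, mul_xEven α s q p h1,
      uForm_even α s q p h1 h2, uEven, hamQ]
    linear_combination (2 * q i - 1) * p i * h
  first := by
    have h := beta_sum hα le_rfl hn
    rw [beta0_one, beta1_one] at h
    rw [uForm_one, hamP, Nat.sub_self, sumS_zero, sumT_step α q p hn, beta0_one]
    linear_combination -(q 1 + s - 1) * (q 1 - s) * h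
  mid i h1 h2 := by
    have h := beta_sum hα (i := i + 1) (by omega) h2
    have hT := sumT_step α q p (i := i + 1) h2
    have hb3 := beta3_step α h2
    obtain ⟨i, rfl⟩ := Nat.exists_eq_add_of_le' h1
    rw [beta0_succ α h1, beta1_succ α h1] at h
    rw [uForm_odd α s q p h1 h2, uOdd, hamP, hamP, Nat.add_sub_cancel, Nat.add_sub_cancel, hT,
      hb3, beta4_step α h2, beta0_succ α h1, sumS_succ]
    simp only [mul_add, mul_one] at h ⊢
    linear_combination -(q (i + 1 + 1) * (q (i + 1 + 1) - 1) - q (i + 1) * (q (i + 1) - 1)) * h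
  last00 := by
    have h := beta_sum hα hn le_rfl
    obtain ⟨m, hm⟩ := Nat.exists_eq_add_of_le' hn
    have hS : sumS s q p n = sumS s q p (n - 1) + 2 * ((q n - s) * p n) := by
      rw [hm, sumS_succ, Nat.add_sub_cancel]
    rw [beta3_last, beta4_last] at h
    rw [uForm_last0 α s q p hn, hamP, hS, sumT_last, beta3_last, beta4_last]
    linear_combination q n * (q n - 1) * h
  last01 := by
    have h := beta_sum hα hn le_rfl
    obtain ⟨m, hm⟩ := Nat.exists_eq_add_of_le' hn
    have hS : sumS s q p n = sumS s q p (n - 1) + 2 * ((q n - s) * p n) := by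
      rw [hm, sumS_succ, Nat.add_sub_cancel]
    rw [beta3_last, beta4_last] at h
    rw [uForm_last1 n α s q p, hamP, hS, sumT_last, beta3_last, beta4_last]
    linear_combination q n * (q n - 1) * h

lemma LaxDyn.eq_ham (hn : 1 ≤ n) (hα : Normalized n α) {Q P : ℕ → ℂ}
    (h : LaxDyn n α s q p (xEven n α s q p) (uForm n α s q p) Q P) :
    ∀ i, 1 ≤ i → i ≤ n → Q i = hamP n α s q p i ∧ P i = -hamQ n α s q p i := by
  have h' := laxDyn_ham s q p hn hα
  have hQ : ∀ i, 1 ≤ i → i ≤ n → Q i = hamP n α s q p i := by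
    intro i h1
    induction i, h1 using Nat.le_induction with
    | base => exact fun _ => sub_left_inj.1 (h.first.trans h'.first.symm)
    | succ i h1 ih =>
      intro h2
      have := (h.mid i h1 h2).trans (h'.mid i h1 h2).symm
      rw [ih (by omega)] at this
      exact sub_left_inj.1 this
  exact fun i h1 h2 => ⟨hQ i h1 h2, (h.even i h1 h2).trans (h'.even i h1 h2).symm⟩

end poisson

/-! ### Brackets of elements of degree one -/

section degreeTwo
variable {n : ℕ}

/-- The subalgebra generated by the `e_k` with `k` in `S`. -/
noncomputable def chainAlg (n : ℕ) (S : Set ℕ) : LieSubalgebra ℂ (AffD n) :=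
  LieSubalgebra.lieSpan ℂ (AffD n) (chE n '' S)

lemma chE_mem_chainAlg {S : Set ℕ} {k : ℕ} (hk : k ∈ S) : chE n k ∈ chainAlg n S :=
  LieSubalgebra.subset_lieSpan ⟨k, hk, rfl⟩

/-- Subalgebras generated by simple root vectors at pairwise non-adjacent vertices commute. -/
lemma lie_eq_zero_of_mem_chainAlg {S T : Set ℕ} (h : ∀ k ∈ S, ∀ l ∈ T, ¬Adj n k l)
    {x y : AffD n} (hx : x ∈ chainAlg n S) (hy : y ∈ chainAlg n T) : ⁅x, y⁆ = 0 := by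
  induction hx using LieSubalgebra.lieSpan_induction with
  | mem x hx =>
    obtain ⟨k, hk, rfl⟩ := hx
    induction hy using LieSubalgebra.lieSpan_induction with
    | mem y hy => obtain ⟨l, hl, rfl⟩ := hy; exact chE_lie_chE (h k hk l hl)
    | zero => exact lie_zero _
    | add y z _ _ h1 h2 => rw [lie_add, h1, h2, add_zero]
    | smul r y _ h1 => rw [lie_smul, h1, smul_zero]
    | lie y z _ _ h1 h2 => rw [leibniz_lie, h1, h2, zero_lie, lie_zero, add_zero]
  | zero => exact zero_lie _
  | add x z _ _ h1 h2 => rw [add_lie, h1, h2, add_zero]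
  | smul r x _ h1 => rw [smul_lie, h1, smul_zero]
  | lie x z _ _ h1 h2 => rw [lie_lie, h1, h2, lie_zero, lie_zero, sub_zero]

/-- The indices up to `m`. -/
def below (m : ℕ) : Set ℕ := {k | k ≤ m}

/-- The indices from `m` on. -/
def above (m : ℕ) : Set ℕ := {k | m ≤ k}

lemma lie_eq_zero_of_below_above {m : ℕ} (hm : m < 2 * n) (hm0 : 1 ≤ m) {x y : AffD n}
    (hx : x ∈ chainAlg n (below m)) (hy : y ∈ chainAlg n (above (m + 2))) : ⁅x, y⁆ = 0 :=
  lie_eq_zero_of_mem_chainAlg (fun k hk l hl => by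
    simp only [below, above, Set.mem_ofPred_eq] at hk hl
    unfold Adj; omega) hx hy

lemma w00_mem_below {i : ℕ} : w00 n i ∈ chainAlg n (below (2 * i + 1)) := by
  unfold w00
  split_ifs with h <;> exact chE_mem_chainAlg (by simp [below])

lemma w10_mem_below {i : ℕ} : w10 n i ∈ chainAlg n (below (2 * i + 1)) := by
  unfold w10 e2
  split_ifs with h
  · exact chE_mem_chainAlg (by simp [below])
  · exact LieSubalgebra.lie_mem _ (chE_mem_chainAlg (by simp [below]))
      (chE_mem_chainAlg (by simp [below]))

lemma w00_mem_above {i : ℕ} (hi : i ≠ 0) : w00 n i ∈ chainAlg n (above (2 * i + 1)) := by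
  rw [w00_pos hi]
  exact chE_mem_chainAlg (by simp [above])

lemma w01_mem_above {i : ℕ} (hi : i ≠ 0) : w01 n i ∈ chainAlg n (above (2 * i + 1)) := by
  unfold w01 e2
  rw [if_neg hi]
  split_ifs with h
  · exact chE_mem_chainAlg (by simp only [above, Set.mem_ofPred_eq]; omega)
  · exact LieSubalgebra.lie_mem _ (chE_mem_chainAlg (by simp [above]))
      (chE_mem_chainAlg (by simp [above]))

/-- The combination of the four vectors of a block. -/
noncomputable def blockVec (n i : ℕ) (a b c e : ℂ) : AffD n :=
  a • w00 n i + b • w01 n i + c • w10 n i + e • w11 n i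

lemma blockVec_mem_below {i : ℕ} (a b c e : ℂ) :
    blockVec n i a b c e ∈ chainAlg n (below (2 * i + 2)) := by
  have hk (k : ℕ) (hk : k ≤ 2 * i + 2) : chE n k ∈ chainAlg n (below (2 * i + 2)) :=
    chE_mem_chainAlg hk
  unfold blockVec w00 w01 w10 w11 e2 e3
  refine add_mem (add_mem (add_mem ?_ ?_) ?_) ?_ <;> refine SMulMemClass.smul_mem _ ?_ <;>
    split_ifs <;> (try subst_vars) <;>
    repeat first | exact hk _ (by omega) | apply LieSubalgebra.lie_mem

lemma blockVec_mem_above {i : ℕ} (hi : i ≠ 0) (a b c e : ℂ) :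
    blockVec n i a b c e ∈ chainAlg n (above (2 * i)) := by
  have hk (k : ℕ) (hk : 2 * i ≤ k) : chE n k ∈ chainAlg n (above (2 * i)) := chE_mem_chainAlg hk
  unfold blockVec w00 w01 w10 w11 e2 e3
  simp only [if_neg hi]
  refine add_mem (add_mem (add_mem ?_ ?_) ?_) ?_ <;> refine SMulMemClass.smul_mem _ ?_ <;>
    (try split_ifs) <;> (try subst_vars) <;>
    repeat first | exact hk _ (by omega) | apply LieSubalgebra.lie_mem

/-- Distant blocks commute. -/
lemma blockVec_lie_far {i j : ℕ} (hij : i + 2 ≤ j) (hj : j ≤ n) (a b c e a' b' c' e' : ℂ) :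
    ⁅blockVec n i a b c e, blockVec n j a' b' c' e'⁆ = 0 := by
  refine lie_eq_zero_of_mem_chainAlg (fun k hk l hl => ?_) (blockVec_mem_below a b c e)
    (blockVec_mem_above (by omega) a' b' c' e')
  simp only [below, above, Set.mem_ofPred_eq] at hk hl
  unfold Adj; omega

section adjacent
variable {i : ℕ}

/-- The action of the even vertex to the right of a block. -/
lemma right_action (hi : i < n) :
    ⁅chE n (2 * (i + 1)), w00 n i⁆ = -w01 n i ∧ ⁅chE n (2 * (i + 1)), w01 n i⁆ = 0 ∧
    ⁅chE n (2 * (i + 1)), w10 n i⁆ = -w11 n i ∧ ⁅chE n (2 * (i + 1)), w11 n i⁆ = 0 := by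
  have h1 : 1 ≤ i + 1 := by omega
  have h2 : i + 1 ≠ i := by omega
  refine ⟨?_, ?_, ?_, ?_⟩
  · simp [chE_lie_w00 h1 hi hi.le]
  · simp [chE_lie_w01 h1 hi hi.le]
  · simp [chE_lie_w10 h1 hi hi.le]
  · simp [chE_lie_w11 h1 hi hi.le]

/-- The action of the even vertex to the left of a block. -/
lemma left_action (h1 : 1 ≤ i) (hi : i ≤ n) :
    ⁅chE n (2 * i), w00 n i⁆ = w10 n i ∧ ⁅chE n (2 * i), w10 n i⁆ = 0 ∧
    ⁅chE n (2 * i), w01 n i⁆ = w11 n i ∧ ⁅chE n (2 * i), w11 n i⁆ = 0 := by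
  refine ⟨?_, ?_, ?_, ?_⟩
  · simp [chE_lie_w00 h1 hi hi]
  · simp [chE_lie_w10 h1 hi hi]
  · simp [chE_lie_w01 h1 hi hi]
  · simp [chE_lie_w11 h1 hi hi]

lemma eq_zero_of_neg_sub_self {V : Type*} [AddCommGroup V] [Module ℂ V] {v : V}
    (h : -v - v = 0) : v = 0 := by
  have : (2 : ℂ) • v = 0 := by rw [two_smul, ← neg_eq_zero, neg_add, ← h, sub_eq_add_neg]
  exact (smul_eq_zero.1 this).resolve_left two_ne_zero

/-- If a derivation maps `x ↦ -x'`, `y ↦ y'` and kills `x'`, `y'`, then the vanishing of `[x, y]`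
implies `[x, y'] = [x', y]` and `[x', y'] = 0`. -/
lemma lie_of_raise {E x x' y y' : AffD n} (hx : ⁅E, x⁆ = -x') (hx' : ⁅E, x'⁆ = 0)
    (hy : ⁅E, y⁆ = y') (hy' : ⁅E, y'⁆ = 0) (h : ⁅x, y⁆ = 0) :
    ⁅x, y'⁆ = ⁅x', y⁆ ∧ ⁅x', y'⁆ = 0 := by
  have h1 : ⁅x, y'⁆ = ⁅x', y⁆ := by
    have := leibniz_lie E x y
    rw [h, lie_zero, hx, hy, neg_lie] at this
    exact (neg_add_eq_zero.1 this.symm).symm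
  refine ⟨h1, ?_⟩
  have := congrArg (fun z => ⁅E, z⁆) h1
  simp only [leibniz_lie E, hx, hx', hy, hy', neg_lie, lie_zero, zero_lie, add_zero,
    zero_add] at this
  exact eq_zero_of_neg_sub_self (by rw [this, sub_self])

/-- Brackets of neighbouring blocks `i` and `i + 1`. The copy of `𝔰𝔩₂` between them acts on both, and
the brackets of the vectors not yet raised by it vanish by distance; applying `e_{2i+2}` to these
gives all other brackets. -/
lemma adjacent_lie (hi : i < n) :
    ((⁅w00 n i, w10 n (i + 1)⁆ = ⁅w01 n i, w00 n (i + 1)⁆ ∧ ⁅w00 n i, w00 n (i + 1)⁆ = 0 ∧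
      ⁅w01 n i, w10 n (i + 1)⁆ = 0) ∧
    (⁅w00 n i, w11 n (i + 1)⁆ = ⁅w01 n i, w01 n (i + 1)⁆ ∧ ⁅w00 n i, w01 n (i + 1)⁆ = 0 ∧
      ⁅w01 n i, w11 n (i + 1)⁆ = 0)) ∧
    ((⁅w10 n i, w10 n (i + 1)⁆ = ⁅w11 n i, w00 n (i + 1)⁆ ∧ ⁅w10 n i, w00 n (i + 1)⁆ = 0 ∧
      ⁅w11 n i, w10 n (i + 1)⁆ = 0) ∧
    (⁅w10 n i, w11 n (i + 1)⁆ = ⁅w11 n i, w01 n (i + 1)⁆ ∧ ⁅w10 n i, w01 n (i + 1)⁆ = 0 ∧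
      ⁅w11 n i, w11 n (i + 1)⁆ = 0)) := by
  obtain ⟨r1, r2, r3, r4⟩ := right_action hi
  obtain ⟨l1, l2, l3, l4⟩ := left_action (by omega) (Nat.succ_le_of_lt hi)
  have hc {x y : AffD n} (hx : x ∈ chainAlg n (below (2 * i + 1)))
      (hy : y ∈ chainAlg n (above (2 * (i + 1) + 1))) : ⁅x, y⁆ = 0 :=
    lie_eq_zero_of_below_above (m := 2 * i + 1) (by omega) (by omega) hx hy
  have h0 : i + 1 ≠ 0 := by omega
  have c1 := hc w00_mem_below (w00_mem_above h0)
  have c2 := hc w00_mem_below (w01_mem_above h0)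
  have c3 := hc w10_mem_below (w00_mem_above h0)
  have c4 := hc w10_mem_below (w01_mem_above h0)
  have d1 := lie_of_raise r1 r2 l1 l2 c1
  have d2 := lie_of_raise r1 r2 l3 l4 c2
  have d3 := lie_of_raise r3 r4 l1 l2 c3
  have d4 := lie_of_raise r3 r4 l3 l4 c4
  exact ⟨⟨⟨d1.1, c1, d1.2⟩, ⟨d2.1, c2, d2.2⟩⟩, ⟨⟨d3.1, c3, d3.2⟩, ⟨d4.1, c4, d4.2⟩⟩⟩

lemma blockVec_lie_next (hi : i < n) (a b c e a' b' c' e' : ℂ) :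
    ⁅blockVec n i a b c e, blockVec n (i + 1) a' b' c' e'⁆ =
      (a * c' + b * a') • ⁅w01 n i, w00 n (i + 1)⁆ + (a * e' + b * b') • ⁅w01 n i, w01 n (i + 1)⁆
      + (c * c' + e * a') • ⁅w11 n i, w00 n (i + 1)⁆
      + (c * e' + e * b') • ⁅w11 n i, w01 n (i + 1)⁆ := by
  obtain ⟨⟨⟨h1, h2, h3⟩, ⟨h4, h5, h6⟩⟩, ⟨⟨h7, h8, h9⟩, ⟨h10, h11, h12⟩⟩⟩ := adjacent_lie hi
  simp only [blockVec, add_lie, lie_add, smul_lie, lie_smul, h1, h2, h3, h4, h5, h6, h7, h8, h9,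
    h10, h11, h12]
  module

/-- A block between two even vertices is a tensor product of two-dimensional representations of two
copies of `𝔰𝔩₂`; the Serre relations make it abelian. -/
lemma blockVec_lie_mid (h1 : 1 ≤ i) (hi : i < n) (a b c e a' b' c' e' : ℂ) :
    ⁅blockVec n i a b c e, blockVec n i a' b' c' e'⁆ = 0 := by
  obtain ⟨r1, r2, r3, r4⟩ := right_action hi
  obtain ⟨l1, l2, l3, l4⟩ := left_action h1 hi.le
  have h00 : ⁅w00 n i, w10 n i⁆ = 0 := by
    rw [w00_pos (by omega), w10_pos (by omega)]; exact chE_serre' ..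
  have h01 : ⁅w00 n i, w01 n i⁆ = 0 := by
    rw [w00_pos (by omega), w01_mid (by omega) (by omega)]; exact chE_serre ..
  have e1 : ⁅w10 n i, w01 n i⁆ + ⁅w00 n i, w11 n i⁆ = 0 := by
    have := leibniz_lie (chE n (2 * i)) (w00 n i) (w01 n i)
    rwa [h01, lie_zero, l1, l3, eq_comm] at this
  have e2 : -⁅w01 n i, w10 n i⁆ + -⁅w00 n i, w11 n i⁆ = 0 := by
    have := leibniz_lie (chE n (2 * (i + 1))) (w00 n i) (w10 n i)
    rwa [h00, lie_zero, r1, r3, neg_lie, lie_neg, eq_comm] at this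
  have e3 : ⁅w00 n i, w11 n i⁆ = 0 := by
    rw [lie_skew] at e2
    refine eq_zero_of_neg_sub_self (sub_eq_zero.2 ?_)
    rw [← eq_neg_of_add_eq_zero_left e1, eq_neg_of_add_eq_zero_left e2, neg_neg]
  have e4 : ⁅w10 n i, w01 n i⁆ = 0 := by rwa [e3, add_zero] at e1
  have e5 : ⁅w10 n i, w11 n i⁆ = 0 := by
    have := leibniz_lie (chE n (2 * i)) (w00 n i) (w11 n i)
    rwa [e3, lie_zero, l1, l4, lie_zero, add_zero, eq_comm] at this
  have e6 : ⁅w01 n i, w11 n i⁆ = 0 := by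
    have := leibniz_lie (chE n (2 * (i + 1))) (w00 n i) (w11 n i)
    rwa [e3, lie_zero, r1, r4, lie_zero, add_zero, neg_lie, zero_eq_neg] at this
  have sk {x y : AffD n} (h : ⁅x, y⁆ = 0) : ⁅y, x⁆ = 0 := by rw [← lie_skew, h, neg_zero]
  simp only [blockVec, add_lie, lie_add, smul_lie, lie_smul, lie_self, h00, h01, e3, e4, e5, e6,
    sk h00, sk h01, sk e3, sk e4, sk e5, sk e6, smul_zero, add_zero]

lemma blockVec_lie_first (hn : 1 ≤ n) (a b c e a' b' c' e' : ℂ) :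
    ⁅blockVec n 0 a b c e, blockVec n 0 a' b' c' e'⁆ =
      (a * e' - b * c' + c * b' - e * a') • ⁅w00 n 0, w11 n 0⁆ := by
  obtain ⟨r1, r2, r3, r4⟩ := right_action (n := n) (i := 0) hn
  have h00 : ⁅w00 n 0, w10 n 0⁆ = 0 := by
    rw [w00_zero, w10_zero]; exact chE_lie_chE (by unfold Adj; omega)
  have h01 : ⁅w00 n 0, w01 n 0⁆ = 0 := chE_serre ..
  have h02 : ⁅w10 n 0, w11 n 0⁆ = 0 := chE_serre ..
  have e2 : -⁅w01 n 0, w10 n 0⁆ + -⁅w00 n 0, w11 n 0⁆ = 0 := by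
    have := leibniz_lie (chE n (2 * (0 + 1))) (w00 n 0) (w10 n 0)
    rwa [h00, lie_zero, r1, r3, neg_lie, lie_neg, eq_comm] at this
  have e3 : ⁅w01 n 0, w10 n 0⁆ = -⁅w00 n 0, w11 n 0⁆ := neg_inj.1 (eq_neg_of_add_eq_zero_left e2)
  have e4 : ⁅w01 n 0, w11 n 0⁆ = 0 := by
    have := leibniz_lie (chE n (2 * (0 + 1))) (w01 n 0) (w10 n 0)
    rw [e3, lie_neg, leibniz_lie, r1, r2, r3, r4] at this
    simp only [zero_lie, lie_zero, neg_lie, lie_neg, zero_add, add_zero, neg_neg] at this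
    exact eq_zero_of_neg_sub_self (by rw [← this, sub_self])
  have sk {x y z : AffD n} (h : ⁅x, y⁆ = z) : ⁅y, x⁆ = -z := by rw [← lie_skew, h]
  simp only [blockVec, add_lie, lie_add, smul_lie, lie_smul, lie_self, h00, h01, h02, e3, e4,
    sk h00, sk h01, sk h02, sk e3, sk e4, sk (rfl : ⁅w00 n 0, w11 n 0⁆ = _)]
  module

lemma blockVec_lie_last (hn : 1 ≤ n) (a b c e a' b' c' e' : ℂ) :
    ⁅blockVec n n a b c e, blockVec n n a' b' c' e'⁆ =
      (a * e' - c * b' + b * c' - e * a') • ⁅w00 n n, w11 n n⁆ := by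
  obtain ⟨l1, l2, l3, l4⟩ := left_action hn le_rfl
  have hn0 : n ≠ 0 := by omega
  have h00 : ⁅w00 n n, w01 n n⁆ = 0 := by
    rw [w00_pos hn0, w01_last hn0]; exact chE_lie_chE (by unfold Adj; omega)
  have h01 : ⁅w00 n n, w10 n n⁆ = 0 := by
    rw [w00_pos hn0, w10_pos hn0]; exact chE_serre' ..
  have h02 : ⁅w01 n n, w11 n n⁆ = 0 := by
    rw [w01_last hn0, w11_last hn0]; exact chE_serre' ..
  have e2 : ⁅w10 n n, w01 n n⁆ + ⁅w00 n n, w11 n n⁆ = 0 := by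
    have := leibniz_lie (chE n (2 * n)) (w00 n n) (w01 n n)
    rwa [h00, lie_zero, l1, l3, eq_comm] at this
  have e3 : ⁅w10 n n, w01 n n⁆ = -⁅w00 n n, w11 n n⁆ := eq_neg_of_add_eq_zero_left e2
  have e4 : ⁅w10 n n, w11 n n⁆ = 0 := by
    have := leibniz_lie (chE n (2 * n)) (w10 n n) (w01 n n)
    rw [e3, lie_neg, leibniz_lie, l1, l2, l3, l4] at this
    simp only [zero_lie, lie_zero, zero_add, add_zero] at this
    exact eq_zero_of_neg_sub_self (by rw [this, sub_self])
  have sk {x y z : AffD n} (h : ⁅x, y⁆ = z) : ⁅y, x⁆ = -z := by rw [← lie_skew, h]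
  simp only [blockVec, add_lie, lie_add, smul_lie, lie_smul, lie_self, h00, h01, h02, e3, e4,
    sk h00, sk h01, sk h02, sk e3, sk e4, sk (rfl : ⁅w00 n n, w11 n n⁆ = _)]
  module

end adjacent

lemma sum_sum_eq_zero_of_skew {V : Type*} [AddCommGroup V] [Module ℂ V] (s : Finset ℕ)
    (g : ℕ → ℕ → V) (h0 : ∀ i ∈ s, g i i = 0)
    (h : ∀ i ∈ s, ∀ j ∈ s, i < j → g i j + g j i = 0) : ∑ i ∈ s, ∑ j ∈ s, g i j = 0 := by
  have h1 : ∑ i ∈ s, ∑ j ∈ s, (g i j + g j i) = 0 := by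
    refine sum_eq_zero fun i hi => sum_eq_zero fun j hj => ?_
    rcases lt_trichotomy i j with hij | rfl | hij
    · exact h i hi j hj hij
    · rw [h0 i hi, add_zero]
    · rw [add_comm]; exact h j hj i hi hij
  simp only [sum_add_distrib] at h1
  rw [sum_comm (f := fun i j => g j i), ← two_smul ℂ] at h1
  exact (smul_eq_zero.1 h1).resolve_left two_ne_zero

/-- Two elements of degree one commute if finitely many bilinear expressions in their coefficients
vanish: one for each of the two outer blocks and four for each pair of neighbouring blocks. -/
lemma blockSum_lie_eq_zero (hn : 1 ≤ n) {a b c e a' b' c' e' : ℕ → ℂ}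
    (h0 : a 0 * e' 0 - b 0 * c' 0 + c 0 * b' 0 - e 0 * a' 0 = 0)
    (hlast : a n * e' n - c n * b' n + b n * c' n - e n * a' n = 0)
    (hadj : ∀ i < n,
      a i * c' (i + 1) + b i * a' (i + 1) = a' i * c (i + 1) + b' i * a (i + 1) ∧
      a i * e' (i + 1) + b i * b' (i + 1) = a' i * e (i + 1) + b' i * b (i + 1) ∧
      c i * c' (i + 1) + e i * a' (i + 1) = c' i * c (i + 1) + e' i * a (i + 1) ∧
      c i * e' (i + 1) + e i * b' (i + 1) = c' i * e (i + 1) + e' i * b (i + 1)) :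
    ⁅blockSum n a b c e, blockSum n a' b' c' e'⁆ = 0 := by
  change ⁅∑ i ∈ range (n + 1), blockVec n i (a i) (b i) (c i) (e i),
    ∑ i ∈ range (n + 1), blockVec n i (a' i) (b' i) (c' i) (e' i)⁆ = 0
  rw [sum_lie]
  simp only [lie_sum]
  refine sum_sum_eq_zero_of_skew _ _ (fun i hi => ?_) (fun i hi j hj hij => ?_)
  · rw [mem_range] at hi
    by_cases hi0 : i = 0
    · subst hi0
      rw [blockVec_lie_first hn, h0, zero_smul]
    · by_cases hin : i = n
      · subst hin
        rw [blockVec_lie_last hn, hlast, zero_smul]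
      · exact blockVec_lie_mid (by omega) (by omega) ..
  · rw [mem_range] at hi hj
    rw [← lie_skew (blockVec n j _ _ _ _)]
    by_cases hj' : j = i + 1
    · subst hj'
      obtain ⟨h1, h2, h3, h4⟩ := hadj i (by omega)
      rw [blockVec_lie_next (by omega), blockVec_lie_next (by omega), h1, h2, h3, h4,
        add_neg_cancel]
    · rw [blockVec_lie_far (by omega) (by omega), blockVec_lie_far (by omega) (by omega),
        neg_zero, add_zero]

end degreeTwo

/-! ### The Lax equation in coordinates -/

/-- The part of degree at most one of the bracket of two elements of `𝔟₊`, in coordinates. -/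
noncomputable def lieCoord (n : ℕ) (B M : Coord) : Coord where
  h := 0
  d := 0
  x i := hForm n B.h B.d (2 * i) * M.x i - hForm n M.h M.d (2 * i) * B.x i
  y := 0
  c00 i := wt00 (hForm n B.h B.d) i * M.c00 i - wt00 (hForm n M.h M.d) i * B.c00 i
  c01 i := wt01 n (hForm n B.h B.d) i * M.c01 i - wt01 n (hForm n M.h M.d) i * B.c01 i
    - tr n B.x (i + 1) * M.c00 i + tr n M.x (i + 1) * B.c00 i
  c10 i := wt10 (hForm n B.h B.d) i * M.c10 i - wt10 (hForm n M.h M.d) i * B.c10 i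
    + tr n B.x i * M.c00 i - tr n M.x i * B.c00 i
  c11 i := wt11 n (hForm n B.h B.d) i * M.c11 i - wt11 n (hForm n M.h M.d) i * B.c11 i
    + (tr n B.x i * M.c01 i - tr n B.x (i + 1) * M.c10 i)
    - (tr n M.x i * B.c01 i - tr n M.x (i + 1) * B.c10 i)

/-- The part of degree one in the gradation of type `(1,1,0,1,0,…,1,0,1,1)`. -/
noncomputable def Coord.degOne (X : Coord) : Coord := ⟨0, 0, 0, 0, X.c00, X.c01, X.c10, X.c11⟩

section grading
variable {n : ℕ}

lemma elt_degOne (X : Coord) : elt n X.degOne = blockSum n X.c00 X.c01 X.c10 X.c11 := by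
  simp [elt, Coord.degOne, hElt_zero, evenE_zero, evenF_zero]

/-- The only part of the bracket of two elements of `𝔟₊` which is not expressed in the coordinates is
the bracket of their parts of degree one. -/
lemma lie_elt {B M : Coord} (hB : B.y = 0) (hM : M.y = 0) : ⁅elt n B, elt n M⁆ =
    elt n (lieCoord n B M) + ⁅elt n B.degOne, elt n M.degOne⁆ := by
  have e (X : Coord) (hX : X.y = 0) : elt n X = hElt n X.h X.d + evenE n X.x + elt n X.degOne := by
    rw [elt_degOne, elt, hX, evenF_zero, add_zero]
  have h1 : ⁅elt n B.degOne, elt n M⁆ = -⁅hElt n M.h M.d, elt n B.degOne⁆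
      - ⁅evenE n M.x, elt n B.degOne⁆ + ⁅elt n B.degOne, elt n M.degOne⁆ := by
    rw [e M hM, lie_add, lie_add, ← lie_skew (elt n B.degOne) (hElt ..),
      ← lie_skew (elt n B.degOne) (evenE ..), sub_eq_add_neg]
  have h2 : elt n (lieCoord n B M) = elt n (adH n (hForm n B.h B.d) M) + elt n (adE n B.x M)
      - elt n (adH n (hForm n M.h M.d) B.degOne) - elt n (adE n M.x B.degOne) := by
    rw [sub_eq_add_neg, sub_eq_add_neg, ← neg_one_smul ℂ (elt n (adH _ _ B.degOne)),
      ← neg_one_smul ℂ (elt n (adE _ _ B.degOne)), ← elt_smul, ← elt_smul, ← elt_add, ← elt_add,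
      ← elt_add]
    apply elt_congr
    · intro k _
      simp [lieCoord, adH, adE, hM, Coord.degOne]
    · simp [lieCoord, adH, adE]
    · intro i _ _
      simp [lieCoord, adH, adE, Coord.degOne, hForm_zero]
      ring
    · intro i _ _
      simp [lieCoord, adH, adE, Coord.degOne, hM]
    · intro i _
      simp only [lieCoord, adH, adE, Coord.degOne, Coord.add_c00, Coord.smul_c00, Coord.add_c01,
        Coord.smul_c01, Coord.add_c10, Coord.smul_c10, Coord.add_c11, Coord.smul_c11,
        Pi.add_apply, Pi.smul_apply, smul_eq_mul, Pi.zero_apply]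
      refine ⟨?_, ?_, ?_, ?_⟩ <;> ring
  rw [e B hB, add_lie, add_lie, h1, hElt_lie_elt, evenE_lie_elt, hElt_lie_elt, evenE_lie_elt, h2]
  abel

/-- The element defining the gradation of type `(1,1,0,1,0,…,1,0,1,1)`. -/
lemma exists_grading (hn : 1 ≤ n) : ∃ (u : ℕ → ℂ) (a : ℂ), ∀ X : Coord,
    ⁅hElt n u a, elt n X⁆ = elt n X.degOne := by
  obtain ⟨a, ha⟩ : ∃ a, ∑ j ∈ range (2 * n + 3),
    (if j % 2 = 0 ∧ j ≠ 0 ∧ j ≠ 2 * n + 2 then (0 : ℂ) else 1) * deltaCoef n j = a := ⟨_, rfl⟩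
  obtain ⟨u, hu⟩ := exists_hForm_eq hn _ ha
  refine ⟨u, a, fun X => ?_⟩
  have h0 (i : ℕ) (h1 : 1 ≤ i) (h2 : i ≤ n) : hForm n u a (2 * i) = 0 := by
    rw [hu _ (by omega), if_pos (by omega)]
  have h1 (j : ℕ) (hj : j < 2 * n + 3) (h : j % 2 = 1 ∨ j = 0 ∨ j = 2 * n + 2) :
      hForm n u a j = 1 := by
    rw [hu _ hj, if_neg (by omega)]
  rw [hElt_lie_elt]
  apply elt_congr
  · exact fun _ _ => rfl
  · rfl
  · intro i h2 h3
    simp [adH, Coord.degOne, h0 i h2 h3]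
  · intro i h2 h3
    simp [adH, Coord.degOne, h0 i h2 h3]
  · intro i hi
    have e0 : i ≠ 0 → hForm n u a (2 * i) = 0 := fun h => h0 i (by omega) hi
    have e1 : hForm n u a (2 * i + 1) = 1 := h1 _ (by omega) (by omega)
    have e2 : i ≠ n → hForm n u a (2 * i + 2) = 0 := fun h => h0 (i + 1) (by omega) (by omega)
    have e3 : hForm n u a 0 = 1 := h1 _ (by omega) (by omega)
    have e4 : hForm n u a 1 = 1 := h1 _ (by omega) (by omega)
    have e5 : hForm n u a 2 = 0 := h0 1 le_rfl hn
    have e6 : hForm n u a (2 * n + 2) = 1 := h1 _ (by omega) (by omega)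
    have e7 : hForm n u a (2 * n) = 0 := h0 n hn le_rfl
    clear hu ha h0 h1
    simp only [adH, Coord.degOne, wt00, wt01, wt10, wt11, e1, e3, e4, e5, e6, e7]
    refine ⟨?_, ?_, ?_, ?_⟩ <;> split_ifs with h h' <;>
      first
        | ring1
        | (rw [e0 h]; ring1)
        | (rw [e2 h']; ring1)
        | (rw [e0 h, e2 h']; ring1)

/-- Elements of degree at most one and brackets of elements of degree one are independent. -/
lemma elt_eq_of_elt_eq_add (hn : 1 ≤ n) {X Y A B : Coord}
    (h : elt n X = elt n Y + ⁅elt n A.degOne, elt n B.degOne⁆) : elt n X = elt n Y := by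
  obtain ⟨u, a, hu⟩ := exists_grading hn
  have hd (A : Coord) : A.degOne.degOne = A.degOne := rfl
  have hZ : ⁅hElt n u a, ⁅elt n A.degOne, elt n B.degOne⁆⁆ =
      (2 : ℂ) • ⁅elt n A.degOne, elt n B.degOne⁆ := by
    rw [leibniz_lie, hu, hu, hd, hd, two_smul]
  have h1 := congrArg (fun z => ⁅hElt n u a, z⁆) h
  simp only [lie_add, hu, hZ] at h1
  have h2 := congrArg (fun z => ⁅hElt n u a, z⁆) h1
  simp only [lie_add, lie_smul, hu, hZ, hd] at h2
  rw [h1, add_right_inj, smul_smul] at h2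
  have h3 : (2 : ℂ) • ⁅elt n A.degOne, elt n B.degOne⁆ = 0 := by
    have : (2 : ℂ) • ⁅elt n A.degOne, elt n B.degOne⁆ =
        (2 * 2 : ℂ) • ⁅elt n A.degOne, elt n B.degOne⁆
          - (2 : ℂ) • ⁅elt n A.degOne, elt n B.degOne⁆ := by module
    rw [this, h2, sub_self]
  rw [h, (smul_eq_zero.1 h3).resolve_left two_ne_zero, add_zero]

/-- Elements with the same Cartan and lowering coordinates agree exactly if their remaining coordinates
do: the root vectors of degree zero and one are linearly independent. -/
lemma elt_eq_iff (hn : 1 ≤ n) {X Y : Coord} (hh : X.h = Y.h) (hd : X.d = Y.d) (hy : X.y = Y.y) :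
    elt n X = elt n Y ↔ (∀ i, 1 ≤ i → i ≤ n → X.x i = Y.x i) ∧
      ∀ i ≤ n, X.c00 i = Y.c00 i ∧ X.c01 i = Y.c01 i ∧ X.c10 i = Y.c10 i ∧ X.c11 i = Y.c11 i := by
  constructor
  · intro h
    exact ⟨fun i h1 h2 => coef_eq_of_elt_eq hn h (σ := Slot.e) ⟨h1, h2⟩,
      fun i hi => ⟨coef_eq_of_elt_eq hn h (σ := Slot.w00) hi,
        coef_eq_of_elt_eq hn h (σ := Slot.w01) hi, coef_eq_of_elt_eq hn h (σ := Slot.w10) hi,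
        coef_eq_of_elt_eq hn h (σ := Slot.w11) hi⟩⟩
  · rintro ⟨h1, h2⟩
    exact elt_congr (fun k _ => by rw [hh]) hd h1 (fun i _ _ => by rw [hy]) h2

lemma forall_le_split (P : ℕ → Prop) :
    (∀ i ≤ n, P i) ↔ P 0 ∧ (∀ i, 1 ≤ i → i < n → P i) ∧ P n := by
  constructor
  · exact fun h => ⟨h 0 (Nat.zero_le n), fun i _ h2 => h i h2.le, h n le_rfl⟩
  · rintro ⟨h0, h1, h2⟩ i hi
    by_cases h : i = 0
    · rwa [h]
    · by_cases h' : i = n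
      · rwa [h']
      · exact h1 i (by omega) (by omega)

end grading

/-- The derivative of `laxM` in coordinates, multiplied by `s(s-1)`; `Q` and `P` stand for
`s(s-1) dq/ds` and `s(s-1) dp/ds`. -/
noncomputable def laxMDeriv (n : ℕ) (s : ℂ) (Q P : ℕ → ℂ) : Coord where
  h := 0
  d := 0
  x i := -P i
  y := 0
  c00 := pw n 0 (fun i => (2 * n + 2) * (Q (i + 1) - Q i)) (-((2 * n + 2) * Q n))
  c01 := pw n 0 0 (-((2 * n + 2) * Q n))
  c10 := pw n ((2 * n + 2) * (Q 1 - s * (s - 1))) 0 0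
  c11 := 0

section laxEquation
variable {n : ℕ} (κ : ℕ → ℂ) (κd s : ℂ) (q p : ℕ → ℂ)

lemma hForm_eq_alph (j : ℕ) : hForm n κ κd j = (2 * n + 2) * alph n κ κd j := by
  rw [alph, mul_div_cancel₀ _ (natCast_ne_zero n)]

lemma laxOdd_one : laxOdd n s q 1 = (2 * n + 2) * (q 1 - s) := by rw [laxOdd, if_pos rfl]

lemma laxOdd_mid {i : ℕ} (h1 : 1 ≤ i) (h2 : i < n) :
    laxOdd n s q (2 * i + 1) = (2 * n + 2) * (q (i + 1) - q i) := by
  rw [laxOdd, if_neg (by omega), if_neg (by omega), if_neg (by omega),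
    show (2 * i + 1) / 2 = i by omega]

lemma laxOdd_last0 (hn : 1 ≤ n) : laxOdd n s q (2 * n + 1) = (2 * n + 2) * (1 - q n) := by
  rw [laxOdd, if_neg (by omega), if_pos rfl]

lemma laxOdd_last1 : laxOdd n s q (2 * n + 2) = (2 * n + 2) * (-q n) := by
  rw [laxOdd, if_neg (by omega), if_neg (by omega), if_pos rfl]

/-- The components of degree at most one of the Lax equation are the scalar equations. -/
lemma laxMDeriv_eq_iff (hn : 1 ≤ n) (u x Q P : ℕ → ℂ) :
    elt n (laxMDeriv n s Q P) = elt n (lieCoord n (laxBCoord n u x s q)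
      (nfCoord n κ κd (fun i => -p i) (laxOdd n s q))) ↔
    LaxAlg n (alph n κ κd) s q p x (hForm n u 0) ∧
      LaxDyn n (alph n κ κd) s q p x (hForm n u 0) Q P := by
  have hN := natCast_ne_zero n
  have hN' := inv_ne_zero hN
  have h1 : (-1 : ℂ) ≠ 0 := neg_ne_zero.2 one_ne_zero
  have key {a b a' b' : ℂ} (c : ℂ) (hc : c ≠ 0) (h : (a - b) * c = a' - b') :
      a = b ↔ a' = b' := by
    rw [← sub_eq_zero, ← sub_eq_zero (a := a'), ← h, mul_eq_zero, or_iff_left hc]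
  have hn0 : n ≠ 0 := by omega
  obtain ⟨X, hX⟩ : ∃ X, X = laxMDeriv n s Q P := ⟨_, rfl⟩
  obtain ⟨Y, hY⟩ : ∃ Y, Y = lieCoord n (laxBCoord n u x s q)
    (nfCoord n κ κd (fun i => -p i) (laxOdd n s q)) := ⟨_, rfl⟩
  have t0 (v : ℕ → ℂ) : tr n v (0 + 1) = v 1 := tr_of_mem le_rfl hn
  have tl (v : ℕ → ℂ) : tr n v (n + 1) = 0 := tr_of_gt (Nat.lt_succ_self n)
  have E (i : ℕ) (h1 : 1 ≤ i) (h2 : i ≤ n) : X.x i = Y.x i ↔ P i =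
      hForm n u 0 (2 * i) * p i + (2 * n + 2) * alph n κ κd (2 * i) * x i := by
    rw [hX, hY]
    simp only [laxMDeriv, lieCoord, laxBCoord, nfCoord, hForm_eq_alph κ κd]
    exact key (-1) (by norm_num) (by ring)
  have E000 : X.c00 0 = Y.c00 0 ↔ hForm n u 0 0 = alph n κ κd 0 * (q 1 - s) := by
    rw [hX, hY]
    simp only [laxMDeriv, lieCoord, laxBCoord, nfCoord, hForm_eq_alph κ κd, pw_zero, wt00, if_true]
    exact key (-1) h1 (by field_simp; ring)
  have E001 : X.c01 0 = Y.c01 0 ↔ (2 * n + 2) * x 1 =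
      -(alph n κ κd 0 + alph n κ κd 2) - (q 1 - s) * p 1 := by
    rw [hX, hY]
    simp only [laxMDeriv, lieCoord, laxBCoord, nfCoord, hForm_eq_alph κ κd, pw_zero, wt01, if_true,
      t0]
    exact key (2 * n + 2) hN (by field_simp; ring)
  have E010 : X.c10 0 = Y.c10 0 ↔ Q 1 - s * (s - 1) =
      hForm n u 0 1 * (q 1 - s) - alph n κ κd 1 * (s * (s - 1)) := by
    rw [hX, hY]
    simp only [laxMDeriv, lieCoord, laxBCoord, nfCoord, hForm_eq_alph κ κd, pw_zero, wt10, if_true,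
      tr_zero, laxOdd_one]
    exact key (2 * n + 2)⁻¹ hN' (by field_simp; ring)
  have E011 : X.c11 0 = Y.c11 0 ↔ hForm n u 0 1 + hForm n u 0 2 =
      (2 * n + 2) * x 1 * (q 1 - s) + p 1 * (s * (s - 1)) := by
    rw [hX, hY]
    simp only [laxMDeriv, lieCoord, laxBCoord, nfCoord, hForm_eq_alph κ κd, pw_zero, wt11, if_true,
      tr_zero, t0, laxOdd_one, Pi.zero_apply]
    exact key (-1) h1 (by field_simp; ring)
  have mid (i : ℕ) (h2 : 1 ≤ i) (h3 : i < n) :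
      (X.c00 i = Y.c00 i ↔ Q (i + 1) - Q i = hForm n u 0 (2 * i + 1) * (q (i + 1) - q i)
        - alph n κ κd (2 * i + 1) * (s * (s - 1) - (q i - s) * (q (i + 1) - s))) ∧
      (X.c01 i = Y.c01 i ↔ hForm n u 0 (2 * i + 1) + hForm n u 0 (2 * i + 2) =
        -(alph n κ κd (2 * i + 1) + alph n κ κd (2 * i + 2)) * (q i - s)
        + (2 * n + 2) * x (i + 1) * (q (i + 1) - q i)
        + p (i + 1) * (s * (s - 1) - (q i - s) * (q (i + 1) - s))) ∧
      (X.c10 i = Y.c10 i ↔ hForm n u 0 (2 * i) + hForm n u 0 (2 * i + 1) =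
        (alph n κ κd (2 * i) + alph n κ κd (2 * i + 1)) * (q (i + 1) - s)
        - (2 * n + 2) * x i * (q (i + 1) - q i)
        - p i * (s * (s - 1) - (q i - s) * (q (i + 1) - s))) ∧
      (X.c11 i = Y.c11 i ↔ (2 * n + 2) * x (i + 1) = (2 * n + 2) * x i
        - (alph n κ κd (2 * i) + (alph n κ κd (2 * i + 1) + alph n κ κd (2 * i + 2)))
        - p i * (q i - s) - p (i + 1) * (q (i + 1) - s)) := by
    have ta (v : ℕ → ℂ) : tr n v i = v i := tr_of_mem h2 h3.le
    have tb (v : ℕ → ℂ) : tr n v (i + 1) = v (i + 1) := tr_of_mem (by omega) h3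
    have hi0 : i ≠ 0 := by omega
    rw [hX, hY]
    simp only [laxMDeriv, lieCoord, laxBCoord, nfCoord, hForm_eq_alph κ κd, pw_mid h2 h3, wt00,
      wt01, wt10, wt11, if_neg hi0, if_neg h3.ne, ta, tb, laxOdd_mid s q h2 h3, Pi.zero_apply]
    exact ⟨key (2 * n + 2)⁻¹ hN' (by field_simp), key (-1) h1 (by field_simp; ring),
      key (-1) h1 (by field_simp; ring), key (2 * n + 2) hN (by field_simp; ring)⟩
  have last :
      (X.c00 n = Y.c00 n ↔ -Q n = hForm n u 0 (2 * n + 1) * (1 - q n)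
        - alph n κ κd (2 * n + 1) * ((s - 1) * q n)) ∧
      (X.c01 n = Y.c01 n ↔ -Q n = -hForm n u 0 (2 * n + 2) * q n
        - alph n κ κd (2 * n + 2) * (s * (q n - 1))) ∧
      (X.c10 n = Y.c10 n ↔ hForm n u 0 (2 * n) + hForm n u 0 (2 * n + 1) =
        -(alph n κ κd (2 * n) + alph n κ κd (2 * n + 1)) * (s - 1)
        - (2 * n + 2) * x n * (1 - q n) - p n * ((s - 1) * q n)) ∧
      (X.c11 n = Y.c11 n ↔ hForm n u 0 (2 * n) + hForm n u 0 (2 * n + 2) =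
        -(alph n κ κd (2 * n) + alph n κ κd (2 * n + 2)) * s
        + (2 * n + 2) * x n * q n - p n * (s * (q n - 1))) := by
    have ta (v : ℕ → ℂ) : tr n v n = v n := tr_of_mem hn le_rfl
    rw [hX, hY]
    simp only [laxMDeriv, lieCoord, laxBCoord, nfCoord, hForm_eq_alph κ κd, pw_last hn, wt00,
      wt01, wt10, wt11, if_neg hn0, if_true, ta, tl, laxOdd_last0 s q hn, laxOdd_last1 s q,
      Pi.zero_apply]
    exact ⟨key (2 * n + 2)⁻¹ hN' (by field_simp), key (2 * n + 2)⁻¹ hN' (by field_simp; ring),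
      key (-1) h1 (by field_simp; ring), key (-1) h1 (by field_simp; ring)⟩
  rw [← hX, ← hY, elt_eq_iff hn (by rw [hX, hY]; rfl) (by rw [hX, hY]; rfl) (by rw [hX, hY]; rfl),
    forall_le_split]
  constructor
  · rintro ⟨hx, ⟨a1, a2, a3, a4⟩, hm, ⟨b1, b2, b3, b4⟩⟩
    exact ⟨⟨E000.1 a1, E001.1 a2, E011.1 a4, fun i h h' => (mid i h h').2.1.1 (hm i h h').2.1,
      fun i h h' => (mid i h h').2.2.1.1 (hm i h h').2.2.1,
      fun i h h' => (mid i h h').2.2.2.1 (hm i h h').2.2.2, last.2.2.1.1 b3, last.2.2.2.1 b4⟩,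
      ⟨fun i h h' => (E i h h').1 (hx i h h'), E010.1 a3,
      fun i h h' => (mid i h h').1.1 (hm i h h').1, last.1.1 b1, last.2.1.1 b2⟩⟩
  · rintro ⟨h, h'⟩
    exact ⟨fun i h1 h2 => (E i h1 h2).2 (h'.even i h1 h2),
      ⟨E000.2 h.first00, E001.2 h.first01, E010.2 h'.first, E011.2 h.first11⟩,
      fun i h1 h2 => ⟨(mid i h1 h2).1.2 (h'.mid i h1 h2), (mid i h1 h2).2.1.2 (h.mid01 i h1 h2),
        (mid i h1 h2).2.2.1.2 (h.mid10 i h1 h2), (mid i h1 h2).2.2.2.2 (h.mid11 i h1 h2)⟩,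
      ⟨last.1.2 h'.last00, last.2.1.2 h'.last01, last.2.2.1.2 h.last10, last.2.2.2.2 h.last11⟩⟩

/-- The components of degree two of the Lax equation hold identically. -/
lemma laxB_degOne_lie (hn : 1 ≤ n) (u x : ℕ → ℂ) :
    ⁅elt n (laxBCoord n u x s q).degOne,
      elt n (nfCoord n κ κd (fun i => -p i) (laxOdd n s q)).degOne⁆ = 0 := by
  have hN := natCast_ne_zero n
  rw [elt_degOne, elt_degOne]
  apply blockSum_lie_eq_zero hn
  · simp only [laxBCoord, nfCoord, pw_zero, laxOdd_one]
    field_simp; ring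
  · simp only [laxBCoord, nfCoord, pw_last hn, laxOdd_last0 s q hn, laxOdd_last1]
    field_simp; ring
  · intro i hi
    by_cases h0 : i = 0 <;> by_cases h1 : i + 1 = n
    · subst h0
      simp only [laxBCoord, nfCoord, pw_zero, laxOdd_one]
      rw [zero_add] at h1
      subst h1
      simp only [pw_last le_rfl, laxOdd_last0 s q le_rfl, laxOdd_last1, zero_add, Nat.cast_one]
      refine ⟨?_, ?_, ?_, ?_⟩ <;> field_simp <;> ring
    · subst h0
      simp only [laxBCoord, nfCoord, pw_zero, laxOdd_one,
        pw_mid (n := n) (i := 0 + 1) (by omega) (by omega),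
        laxOdd_mid (n := n) s q (i := 0 + 1) (by omega) (by omega), zero_add]
      refine ⟨?_, ?_, ?_, ?_⟩ <;> field_simp <;> ring
    · subst h1
      simp only [laxBCoord, nfCoord, pw_last (n := i + 1) (by omega),
        laxOdd_last0 (n := i + 1) s q (by omega), laxOdd_last1,
        pw_mid (n := i + 1) (i := i) (by omega) (by omega),
        laxOdd_mid (n := i + 1) s q (i := i) (by omega) (by omega)]
      generalize (2 : ℂ) * ((i + 1 : ℕ) : ℂ) + 2 = N at hN ⊢
      refine ⟨?_, ?_, ?_, ?_⟩ <;> field_simp <;> ring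
    · simp only [laxBCoord, nfCoord, pw_mid (n := n) (i := i) (by omega) (by omega),
        pw_mid (n := n) (i := i + 1) (by omega) (by omega),
        laxOdd_mid (n := n) s q (i := i) (by omega) (by omega),
        laxOdd_mid (n := n) s q (i := i + 1) (by omega) (by omega)]
      refine ⟨?_, ?_, ?_, ?_⟩ <;> field_simp <;> ring

end laxEquation

/-! ### The Lax equation is Sasano's system -/

section laxSasano
variable {n : ℕ} {α : ℕ → ℂ} {s : ℂ} {q p x x' F F' Q P : ℕ → ℂ}

lemma LaxAlg.congr (hn : 1 ≤ n) (h : LaxAlg n α s q p x F)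
    (hF : ∀ k < 2 * n + 3, F' k = F k) : LaxAlg n α s q p x F' where
  first00 := by rw [hF _ (by omega)]; exact h.first00
  first01 := h.first01
  first11 := by rw [hF _ (by omega), hF _ (by omega)]; exact h.first11
  mid01 i h1 h2 := by
    rw [hF _ (by omega), hF _ (by omega)]
    exact h.mid01 i h1 h2
  mid10 i h1 h2 := by
    rw [hF _ (by omega), hF _ (by omega)]
    exact h.mid10 i h1 h2
  mid11 := h.mid11
  last10 := by rw [hF _ (by omega), hF _ (by omega)]; exact h.last10
  last11 := by rw [hF _ (by omega), hF _ (by omega)]; exact h.last11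

lemma LaxDyn.congr (hn : 1 ≤ n) (h : LaxDyn n α s q p x F Q P)
    (hF : ∀ k < 2 * n + 3, F' k = F k) : LaxDyn n α s q p x F' Q P where
  even i h1 h2 := by rw [hF _ (by omega)]; exact h.even i h1 h2
  first := by rw [hF _ (by omega)]; exact h.first
  mid i h1 h2 := by rw [hF _ (by omega)]; exact h.mid i h1 h2
  last00 := by rw [hF _ (by omega)]; exact h.last00
  last01 := by rw [hF _ (by omega)]; exact h.last01

/-- If `laxM` is differentiable, then so are the functions `q_i` and `p_i`. -/
lemma exists_hasDerivAt_of_laxM (hn : 1 ≤ n) {κ : ℕ → ℂ} {κd : ℂ} {q p : ℕ → ℂ → ℂ} {M' : AffD n}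
    (h : HasDerivW (fun z => laxM n κ κd z (fun i => q i z) (fun i => p i z)) M' s) :
    ∃ q' p' : ℕ → ℂ, ∀ i, 1 ≤ i → i ≤ n →
      HasDerivAt (q i) (q' i) s ∧ HasDerivAt (p i) (p' i) s := by
  have hN := natCast_ne_zero n
  have key (σ : Slot) (i : ℕ) (hi : σ.Valid n i) := h (entry hn (key n σ i))
  simp only [laxM_eq hn] at key
  have hp (i : ℕ) (h1 : 1 ≤ i) (h2 : i ≤ n) : ∃ p', HasDerivAt (p i) p' s := by
    have := (key Slot.e i ⟨h1, h2⟩).neg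
    simp only [entry_elt hn (σ := Slot.e) ⟨h1, h2⟩, Coord.coef, nfCoord] at this
    refine ⟨_, this.congr_of_eventuallyEq (Filter.Eventually.of_forall fun z => ?_)⟩
    simp
  have hq (i : ℕ) (h1 : 1 ≤ i) : i ≤ n → ∃ q', HasDerivAt (q i) q' s := by
    induction i, h1 using Nat.le_induction with
    | base =>
      intro _
      have := ((key Slot.w10 0 (Nat.zero_le n)).const_mul (2 * n + 2 : ℂ)⁻¹).fun_add
        (hasDerivAt_id s)
      simp only [entry_elt hn (σ := Slot.w10) (Nat.zero_le n), Coord.coef, nfCoord, pw_zero,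
        laxOdd_one, inv_mul_cancel_left₀ hN, id, sub_add_cancel] at this
      exact ⟨_, this⟩
    | succ i h1 ih =>
      intro h2
      obtain ⟨q', hq'⟩ := ih (by omega)
      have := ((key Slot.w00 i (by change i ≤ n; omega)).const_mul (2 * n + 2 : ℂ)⁻¹).fun_add hq'
      simp only [entry_elt hn (σ := Slot.w00) (show i ≤ n by omega), Coord.coef, nfCoord,
        pw_mid h1 (show i < n by omega), laxOdd_mid (n := n) _ _ h1 (show i < n by omega),
        inv_mul_cancel_left₀ hN, sub_add_cancel] at this
      exact ⟨_, this⟩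
  have h' (i : ℕ) : ∃ r : ℂ × ℂ, 1 ≤ i → i ≤ n →
      HasDerivAt (q i) r.1 s ∧ HasDerivAt (p i) r.2 s := by
    by_cases hi : 1 ≤ i ∧ i ≤ n
    · obtain ⟨q', hq'⟩ := hq i hi.1 hi.2
      obtain ⟨p', hp'⟩ := hp i hi.1 hi.2
      exact ⟨(q', p'), fun _ _ => ⟨hq', hp'⟩⟩
    · exact ⟨0, fun h1 h2 => absurd ⟨h1, h2⟩ hi⟩
  choose r hr using h'
  exact ⟨fun i => (r i).1, fun i => (r i).2, hr⟩

/-- `s(s-1)` times the derivative of `laxM` along differentiable functions. -/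
lemma hasDerivW_laxM (hn : 1 ≤ n) {κ : ℕ → ℂ} {κd : ℂ} {q p : ℕ → ℂ → ℂ} {q' p' : ℕ → ℂ}
    (h : ∀ i, 1 ≤ i → i ≤ n → HasDerivAt (q i) (q' i) s ∧ HasDerivAt (p i) (p' i) s) :
    ∃ M', HasDerivW (fun z => laxM n κ κd z (fun i => q i z) (fun i => p i z)) M' s ∧
      (s * (s - 1)) • M' =
        elt n (laxMDeriv n s (fun i => s * (s - 1) * q' i) (fun i => s * (s - 1) * p' i)) := by
  obtain ⟨X', hX'⟩ : ∃ X' : Coord, X' = ⟨0, 0, fun i => -p' i, 0,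
    pw n 0 (fun i => (2 * n + 2) * (q' (i + 1) - q' i)) ((2 * n + 2) * -q' n),
    pw n 0 (fun _ => 0) ((2 * n + 2) * -q' n),
    pw n ((2 * n + 2) * (q' 1 - 1)) (fun _ => 0) 0, 0⟩ := ⟨_, rfl⟩
  have pwd {a b : ℂ} {f : ℕ → ℂ} {A B : ℂ → ℂ} {G : ℂ → ℕ → ℂ} (hA : HasDerivAt A a s)
      (hB : HasDerivAt B b s)
      (hG : ∀ i, 1 ≤ i → i < n → HasDerivAt (fun z => G z i) (f i) s) :
      ∀ i ≤ n, HasDerivAt (fun z => pw n (A z) (G z) (B z) i) (pw n a f b i) s := by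
    refine (forall_le_split _).2 ⟨?_, ?_, ?_⟩
    · simpa only [pw_zero] using hA
    · intro i h1 h2
      simpa only [pw_mid h1 h2] using hG i h1 h2
    · simpa only [pw_last hn] using hB
  have hc (r : ℂ) : HasDerivAt (fun _ : ℂ => r) 0 s := hasDerivAt_const s r
  have hX : HasDerivC n (fun z => nfCoord n κ κd (fun i => -p i z) (laxOdd n z fun i => q i z))
      X' s := by
    rw [hX']
    refine ⟨fun k _ => hc _, hc _, fun i h1 h2 => (h i h1 h2).2.fun_neg, fun i _ _ => hc _, ?_, ?_,
      ?_, ?_⟩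
    · simp only [nfCoord, laxOdd_last0 _ _ hn]
      refine pwd (hc 1) (((h n hn le_rfl).1.const_sub 1).const_mul _) fun i h1 h2 => ?_
      simp only [laxOdd_mid (n := n) _ _ h1 h2]
      exact ((h (i + 1) (by omega) h2).1.fun_sub (h i h1 h2.le).1).const_mul _
    · simp only [nfCoord, laxOdd_last1]
      exact pwd (hc 0) ((h n hn le_rfl).1.fun_neg.const_mul _) fun i h1 h2 => hc 1
    · simp only [nfCoord, laxOdd_one]
      exact pwd (((h 1 le_rfl hn).1.fun_sub (hasDerivAt_id s)).const_mul _) (hc 1)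
        fun i h1 h2 => hc 1
    · intro i _
      exact hc _
  refine ⟨elt n X', ?_, ?_⟩
  · simp only [laxM_eq hn]
    exact hX.hasDerivW
  · rw [← elt_smul, hX']
    apply elt_congr
    · intro k _
      simp [laxMDeriv]
    · simp [laxMDeriv]
    · intro i _ _
      simp [laxMDeriv]
    · intro i _ _
      simp [laxMDeriv]
    · intro i _
      simp only [laxMDeriv, Coord.smul_c00, Coord.smul_c01, Coord.smul_c10, Coord.smul_c11,
        Pi.smul_apply, smul_eq_mul, pw, Pi.zero_apply]
      refine ⟨?_, ?_, ?_, mul_zero _⟩ <;> split_ifs <;> ring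

/-- The Lax equation at a point, in terms of the derivatives of `q_i` and `p_i`. -/
lemma lax_eq_iff (hn : 1 ≤ n) (κ : ℕ → ℂ) (κd : ℂ) (u x : ℕ → ℂ) :
    elt n (laxMDeriv n s Q P) = ⁅elt n (laxBCoord n u x s q), laxM n κ κd s q p⁆ ↔
      LaxAlg n (alph n κ κd) s q p x (hForm n u 0) ∧
        LaxDyn n (alph n κ κd) s q p x (hForm n u 0) Q P := by
  rw [laxM_eq hn, lie_elt rfl rfl, laxB_degOne_lie _ _ _ _ _ hn, add_zero,
    laxMDeriv_eq_iff _ _ _ _ _ hn]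

/-- From left to right the functions are differentiable because they are coordinates of `laxM`, and the
dynamical part of the Lax equation is the Hamiltonian vector field. From right to left, a Cartan
element with the prescribed values at all simple roots is needed: it exists because the prescribed
values vanish at the imaginary root. -/
theorem isLaxSolution_iff_isSasanoSolution (hn : 1 ≤ n) (κ : ℕ → ℂ) (κd : ℂ)
    (hκ : Normalized n (alph n κ κd)) (U : Set ℂ) (q p : ℕ → ℂ → ℂ) :
    IsLaxSolution n U κ κd q p ↔ IsSasanoSolution n U (alph n κ κd) q p := by
  rw [isSasanoSolution_iff]
  constructor
  · intro h s hs
    obtain ⟨B, M', ⟨u, hu, rfl⟩, hM, hlax⟩ := h s hs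
    obtain ⟨q', p', hqp⟩ := exists_hasDerivAt_of_laxM hn hM
    obtain ⟨M'', hM'', he⟩ := hasDerivW_laxM hn (κ := κ) (κd := κd) hqp
    rw [hM.unique hM'', he, laxB_eq hn, lax_eq_iff hn] at hlax
    have hd := (hlax.2.congr hn fun k hk => (hu k (mem_range.2 hk)).symm).eq_ham _ _ _ hn hκ
    exact fun i h1 h2 => ⟨q' i, p' i, (hqp i h1 h2).1, (hqp i h1 h2).2, hd i h1 h2⟩
  · intro h s hs
    have h' (i : ℕ) : ∃ r : ℂ × ℂ, 1 ≤ i → i ≤ n →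
        HasDerivAt (q i) r.1 s ∧ HasDerivAt (p i) r.2 s ∧
        s * (s - 1) * r.1 = hamP n (alph n κ κd) s (fun j => q j s) (fun j => p j s) i ∧
        s * (s - 1) * r.2 = -hamQ n (alph n κ κd) s (fun j => q j s) (fun j => p j s) i := by
      by_cases hi : 1 ≤ i ∧ i ≤ n
      · obtain ⟨q', p', hqp⟩ := h s hs i hi.1 hi.2
        exact ⟨(q', p'), fun _ _ => hqp⟩
      · exact ⟨0, fun h1 h2 => absurd ⟨h1, h2⟩ hi⟩
    choose r hr using h'
    obtain ⟨M', hM', he⟩ := hasDerivW_laxM hn (κ := κ) (κd := κd)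
      fun i h1 h2 => ⟨(hr i h1 h2).1, (hr i h1 h2).2.1⟩
    obtain ⟨u, hu⟩ := exists_hForm_eq hn _
      (sum_uForm hn (alph n κ κd) s (fun i => q i s) (fun i => p i s))
    refine ⟨_, M', ⟨u, fun k hk => hu k (mem_range.1 hk), rfl⟩, hM', ?_⟩
    rw [he, laxB_eq hn, lax_eq_iff hn]
    refine ⟨(laxAlg_uForm _ _ _ _ hn).congr hn hu, LaxDyn.congr hn ?_ hu⟩
    have hd := laxDyn_ham s (fun i => q i s) (fun i => p i s) hn hκ
    have hQ (i : ℕ) (h1 : 1 ≤ i) (h2 : i ≤ n) := (hr i h1 h2).2.2.1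
    constructor
    · intro i h1 h2
      rw [(hr i h1 h2).2.2.2]
      exact hd.even i h1 h2
    · rw [hQ 1 le_rfl hn]
      exact hd.first
    · intro i h1 h2
      rw [hQ i h1 h2.le, hQ (i + 1) (by omega) h2]
      exact hd.mid i h1 h2
    · rw [hQ n hn le_rfl]
      exact hd.last00
    · rw [hQ n hn le_rfl]
      exact hd.last01

end laxSasano

/-! ### The scalar form of the normalization -/

/-- The equations by which the values `E k` of the torus element `exp(Γ₂)` at the simple roots
bring `exp(ad Γ₁)(-t₁Λ₁ - t₂Λ₂)` to the normal form with coefficients `b`. -/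
structure NormalEqs (n : ℕ) (t : Fin 2 → ℂ) (E b : ℕ → ℂ) : Prop where
  first00 : E 0 * -t 0 = 1
  first10 : E 1 * -t 1 = b 1
  first11 : E 1 * E 2 * (-t 0 + gam t 1 * t 1) = 1
  mid00 : ∀ i, 1 ≤ i → i < n → E (2 * i + 1) * -t 0 = b (2 * i + 1)
  mid01 : ∀ i, 1 ≤ i → i < n →
    E (2 * i + 1) * E (2 * i + 2) * (-t 1 + gam t (i + 1) * t 0) = 1
  mid10 : ∀ i, 1 ≤ i → i < n → E (2 * i) * E (2 * i + 1) * (-t 1 - gam t i * t 0) = 1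
  last00 : E (2 * n + 1) * -t 0 = b (2 * n + 1)
  last01 : E (2 * n + 2) * -t 1 = b (2 * n + 2)
  last10 : E (2 * n) * E (2 * n + 1) * (-t 1 - gam t n * t 0) = 1
  last11 : E (2 * n) * E (2 * n + 2) * (-t 0 - gam t n * t 1) = 1

namespace NormalEqs

section algebra
variable {n : ℕ} {t : Fin 2 → ℂ} {E b : ℕ → ℂ} (h : NormalEqs n t E b)
include h

lemma t0_ne : t 0 ≠ 0 := fun h0 => by simpa [h0] using h.first00

lemma gam_one_mul : gam t 1 * t 0 = t 1 := div_mul_cancel₀ _ h.t0_ne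

lemma even_mul_odd {i : ℕ} (h1 : 1 ≤ i) (h2 : i ≤ n) :
    E (2 * i) * E (2 * i + 1) * (-t 1 - gam t i * t 0) = 1 := by
  by_cases hi : i = n
  · exact hi ▸ h.last10
  · exact h.mid10 i h1 (by omega)

lemma odd_mul {i : ℕ} (h1 : 1 ≤ i) (h2 : i ≤ n) : E (2 * i + 1) * -t 0 = b (2 * i + 1) := by
  by_cases hi : i = n
  · exact hi ▸ h.last00
  · exact h.mid00 i h1 (by omega)

lemma den_ne {i : ℕ} (h1 : 1 ≤ i) (h2 : i ≤ n) : t 1 + t 0 * gam t i ≠ 0 := fun h0 => by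
  have := h.even_mul_odd h1 h2
  rw [show -t 1 - gam t i * t 0 = -(t 1 + t 0 * gam t i) by ring, h0] at this
  simp at this

lemma num_ne : t 0 + t 1 * gam t n ≠ 0 := fun h0 => by
  have := h.last11
  rw [show -t 0 - gam t n * t 1 = -(t 0 + t 1 * gam t n) by ring, h0] at this
  simp at this

omit h in
lemma gam_add_two (i : ℕ) :
    gam t (i + 2) = (t 0 + t 1 * gam t (i + 1)) / (t 1 + t 0 * gam t (i + 1)) := rfl

lemma gam_succ_mul {i : ℕ} (h1 : 1 ≤ i) (h2 : i ≤ n) :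
    gam t (i + 1) * (t 1 + t 0 * gam t i) = t 0 + t 1 * gam t i := by
  have := h.den_ne h1 h2
  obtain ⟨i, rfl⟩ := Nat.exists_eq_add_of_le' h1
  rw [gam_add_two, div_mul_cancel₀ _ this]

lemma E1_ne : E 1 ≠ 0 := fun h0 => by simpa [h0] using h.first11

/-- The quantity `-t₁ E₁` is the common scale of the coefficients `b`. -/
lemma scale_ne : -t 0 * E 1 ≠ 0 := mul_ne_zero (neg_ne_zero.2 h.t0_ne) h.E1_ne

lemma odd_of_even {i : ℕ} (h1 : 1 ≤ i) (h2 : i ≤ n)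
    (he : -t 0 * E 1 * E (2 * i) * (1 - gam t i ^ 2) = 1) :
    -t 0 * E (2 * i + 1) = -t 0 * E 1 * (gam t (i + 1) - gam t i) := by
  have hE : E (2 * i) * (t 1 + t 0 * gam t i) ≠ 0 :=
    mul_ne_zero (fun h0 => by simp [h0] at he) (h.den_ne h1 h2)
  refine mul_left_cancel₀ hE ?_
  linear_combination t 0 * h.even_mul_odd h1 h2 - t 0 * he
    + t 0 * E 1 * E (2 * i) * h.gam_succ_mul h1 h2

/-- The scale `G = -t₁ E₁` determines the values of the torus element at the even simple roots:
`G E_{2i} (1 - γ_{2i}²) = 1`. -/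
lemma even_mul_scale {i : ℕ} (h1 : 1 ≤ i) :
    i ≤ n → -t 0 * E 1 * E (2 * i) * (1 - gam t i ^ 2) = 1 := by
  induction i, h1 using Nat.le_induction with
  | base =>
    intro _
    linear_combination h.first11 + E 1 * E 2 * gam t 1 * h.gam_one_mul
  | succ i h1 ih =>
    intro h2
    have ho := h.odd_of_even h1 (by omega) (ih (by omega))
    refine mul_left_cancel₀ h.t0_ne ?_
    rw [show 2 * (i + 1) = 2 * i + 2 by ring]
    linear_combination t 0 * h.mid01 i h1 h2
      + E (2 * i + 2) * (t 0 * gam t (i + 1) - t 1) * ho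
      + t 0 * E 1 * E (2 * i + 2) * h.gam_succ_mul h1 (by omega : i ≤ n)

lemma odd_mul_scale {i : ℕ} (h1 : 1 ≤ i) (h2 : i ≤ n) :
    -t 0 * E (2 * i + 1) = -t 0 * E 1 * (gam t (i + 1) - gam t i) :=
  h.odd_of_even h1 h2 (h.even_mul_scale h1 h2)

lemma b_one : b 1 = -t 0 * E 1 * gam t 1 := by
  linear_combination -h.first10 + E 1 * h.gam_one_mul

/-- With the scale `G = -t₁ E₁` the coefficients telescope: `b_{2i+1} = G (γ_{2i+2} - γ_{2i})`. -/
lemma b_odd {i : ℕ} (h1 : 1 ≤ i) (h2 : i ≤ n) :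
    b (2 * i + 1) = -t 0 * E 1 * (gam t (i + 1) - gam t i) := by
  rw [← h.odd_mul_scale h1 h2, ← h.odd_mul h1 h2]
  ring

lemma sum_b {i : ℕ} (h1 : 1 ≤ i) : i ≤ n →
    ∑ j ∈ Ico 1 i, b (2 * j + 1) = -t 0 * E 1 * (gam t i - gam t 1) := by
  induction i, h1 using Nat.le_induction with
  | base => simp
  | succ i h1 ih =>
    intro h2
    rw [sum_Ico_succ_top h1, ih (by omega), h.b_odd h1 (by omega)]
    ring

lemma gam_last_ne (hn : 1 ≤ n) : gam t (n + 1) ≠ 0 := fun h0 => by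
  have := h.gam_succ_mul hn le_rfl
  rw [h0, zero_mul] at this
  exact h.num_ne this.symm

lemma last_mul (hn : 1 ≤ n) : (-t 0 * E (2 * n + 2)) * gam t (n + 1) =
    -t 0 * E 1 * (gam t (n + 1) - gam t n) := by
  rw [← h.odd_mul_scale hn le_rfl]
  have hE : E (2 * n) * (t 1 + t 0 * gam t n) ≠ 0 :=
    mul_ne_zero (fun h0 => by simpa [h0] using h.last10) (h.den_ne hn le_rfl)
  refine mul_left_cancel₀ hE ?_
  linear_combination t 0 * h.last11 - t 0 * h.last10
    - t 0 * E (2 * n) * E (2 * n + 2) * h.gam_succ_mul hn le_rfl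

lemma b_last (hn : 1 ≤ n) : b (2 * n + 2) * gam t (n + 1) =
    -t 0 * E 1 * (1 - gam t n * gam t (n + 1)) := by
  rw [← h.last01]
  refine mul_left_cancel₀ h.t0_ne ?_
  linear_combination t 1 * h.last_mul hn - t 0 * E 1 * h.gam_succ_mul hn le_rfl

/-- `(2n+2) s₁ γ_{2n+2} = -G` for the scale `G = -t₁ E₁`. -/
lemma s1_mul (hn : 1 ≤ n) : (2 * n + 2) * s1 n b * gam t (n + 1) = t 0 * E 1 := by
  rw [s1, mul_div_cancel₀ _ (natCast_ne_zero n), cc, cc, if_neg (by omega), if_pos rfl,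
    h.sum_b hn le_rfl, h.b_one]
  linear_combination -h.b_last hn

/-- `(2n+2)(s₁ - s₂) = -G γ_{2n+2}`. Together with `s1_mul`, this gives
`(s₁ - s₂) / s₁ = γ_{2n+2}²` and `(2n+2)² s₁ (s₁ - s₂) = G²`. -/
lemma s1_sub_s2 (hn : 1 ≤ n) :
    (2 * n + 2) * (s1 n b - s2 n b) = t 0 * E 1 * gam t (n + 1) := by
  rw [s1, s2, mul_sub, mul_div_cancel₀ _ (natCast_ne_zero n), mul_div_cancel₀ _ (natCast_ne_zero n)]
  simp only [cc, if_neg (show ¬2 * n + 2 = 1 by omega), if_neg (show ¬2 * n + 1 = 1 by omega),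
    if_true]
  rw [h.sum_b hn le_rfl, h.b_one, h.b_odd hn le_rfl]
  ring

/-- The coordinate `q_i - s`, up to the factor `2n+2`. -/
lemma mul_q_sub (η : ℕ → ℂ) {i : ℕ} (h1 : 1 ≤ i) (h2 : i ≤ n) :
    (cc n b (2 * n + 2) - lam b η i) - (2 * n + 2) * s1 n b = -t 0 * E 1 * gam t i - η i := by
  rw [s1, mul_div_cancel₀ _ (natCast_ne_zero n), lam, h.sum_b h1 h2]
  simp only [cc, if_true, h.b_one]
  ring

/-- The values of the torus element at the even and odd simple roots up to `2i` multiply to a power of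
`t₂² - t₁²`, up to boundary factors. -/
lemma prod_even {i : ℕ} (h1 : 1 ≤ i) : i ≤ n →
    E 1 * (∏ j ∈ Icc 2 (2 * i), E j ^ 2) * (t 1 ^ 2 - t 0 ^ 2) ^ i = E (2 * i) * t 0 := by
  induction i, h1 using Nat.le_induction with
  | base =>
    intro _
    rw [mul_one, Icc_self, prod_singleton]
    linear_combination t 0 * E 2 * h.first11 - E 1 * E 2 ^ 2 * t 1 * h.gam_one_mul
  | succ i h1 ih =>
    intro h2
    rw [show 2 * (i + 1) = 2 * i + 1 + 1 by ring, prod_Icc_succ_top (by omega),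
      prod_Icc_succ_top (by omega)]
    have e1 := h.mid10 i h1 h2
    have e2 := h.mid01 i h1 h2
    have e3 := h.gam_succ_mul h1 (by omega : i ≤ n)
    have e5 : E (2 * i) * E (2 * i + 1) * (-t 1 - gam t i * t 0) *
        (E (2 * i + 1) * E (2 * i + 2) * (-t 1 + gam t (i + 1) * t 0)) = 1 := by
      rw [e1, e2, mul_one]
    have e4 : E (2 * i) * E (2 * i + 1) * (E (2 * i + 1) * E (2 * i + 1 + 1))
        * (t 1 ^ 2 - t 0 ^ 2) = 1 := by
      linear_combination e5
        + E (2 * i) * E (2 * i + 1) * (E (2 * i + 1) * E (2 * i + 2)) * t 0 * e3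
    linear_combination E (2 * i + 1) ^ 2 * E (2 * i + 1 + 1) ^ 2 * (t 1 ^ 2 - t 0 ^ 2)
      * ih (by omega) + t 0 * E (2 * i + 1 + 1) * e4

/-- The value of the torus element at `δ` is constant, which gives `s₂` as a function of `t`. -/
lemma s2_eq (hn : 1 ≤ n) : (2 * n + 2) * s2 n b =
    E 0 * E 1 * (∏ j ∈ Icc 2 (2 * n), E j ^ 2) * E (2 * n + 1) * E (2 * n + 2)
      * (t 1 ^ 2 - t 0 ^ 2) ^ (n + 1) := by
  have e := h.prod_even hn le_rfl
  rw [s2, mul_div_cancel₀ _ (natCast_ne_zero n)]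
  simp only [cc, if_neg (show ¬2 * n + 2 = 1 by omega), if_neg (show ¬2 * n + 1 = 1 by omega)]
  rw [← h.last00, ← h.last01]
  linear_combination -E 0 * E (2 * n + 1) * E (2 * n + 2) * (t 1 ^ 2 - t 0 ^ 2) * e
    + E (2 * n) * E (2 * n + 1) * E (2 * n + 2) * (t 1 ^ 2 - t 0 ^ 2) * h.first00
    - t 1 * E (2 * n + 2) * h.last10 + t 0 * E (2 * n + 1) * h.last11

end algebra

end NormalEqs

/-! ### The operators of the similarity reduction in coordinates -/

/-- An element whose part of degree one is `r Λ₁ + r' Λ₂`. -/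
noncomputable def dsCoord (h : ℕ → ℂ) (d : ℂ) (x y : ℕ → ℂ) (r r' : ℂ) : Coord :=
  ⟨h, d, x, y, fun _ => r, fun _ => r', fun _ => r', fun _ => r⟩

section operators
variable {n : ℕ}

lemma dsCoord_lin (h h' : ℕ → ℂ) (d d' : ℂ) (x x' y y' : ℕ → ℂ) (r r' r₁ r₁' a b : ℂ) :
    a • dsCoord h d x y r r' + b • dsCoord h' d' x' y' r₁ r₁' =
      dsCoord (fun k => a * h k + b * h' k) (a * d + b * d') (fun k => a * x k + b * x' k)
        (fun k => a * y k + b * y' k) (a * r + b * r₁) (a * r' + b * r₁') := by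
  ext <;> simp [dsCoord]

lemma elt_dsCoord (hn : 1 ≤ n) (h : ℕ → ℂ) (d : ℂ) (x y : ℕ → ℂ) (r r' : ℂ) :
    elt n (dsCoord h d x y r r') =
      hElt n h d + evenE n x + evenF n y + (r • Lam n 0 + r' • Lam n 1) := by
  have h1 : r • Lam n 0 + r' • Lam n 1 = elt n (dsCoord 0 0 0 0 r r') := by
    have (k : Fin 2) : Lam n k = elt n (dsCoord 0 0 0 0 (if k = 0 then 1 else 0)
        (if k = 0 then 0 else 1)) := by
      rw [Lam_eq hn]
      simp [elt, dsCoord, hElt_zero, evenE_zero, evenF_zero]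
    rw [this, this, ← elt_smul, ← elt_smul, ← elt_add, dsCoord_lin]
    simp [dsCoord, Pi.zero_def]
  rw [h1]
  simp [elt, dsCoord, hElt_zero, evenE_zero, evenF_zero]

/-- The coordinates of `opB`. -/
noncomputable def opBCoord (u x y : Fin 2 → ℕ → (Fin 2 → ℂ) → ℂ) (k : Fin 2) (t : Fin 2 → ℂ) :
    Coord :=
  dsCoord (fun i => u k i t) 0 (fun i => x k (2 * i) t) (fun i => y k (2 * i) t)
    (if k = 0 then 1 else 0) (if k = 0 then 0 else 1)

lemma opB_eq (hn : 1 ≤ n) (u x y : Fin 2 → ℕ → (Fin 2 → ℂ) → ℂ) (k : Fin 2) (t : Fin 2 → ℂ) :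
    opB n u x y k t = elt n (opBCoord u x y k t) := by
  rw [opBCoord, elt_dsCoord hn, opB, hElt, evenE, evenF, sum_add_distrib, zero_smul, add_zero]
  fin_cases k <;> simp [add_assoc]

/-- The coordinates of `opM`. -/
noncomputable def opMCoord (c : ℕ → ℂ) (a : ℂ) (u x y : Fin 2 → ℕ → (Fin 2 → ℂ) → ℂ)
    (t : Fin 2 → ℂ) : Coord :=
  dsCoord (fun i => c i - t 0 * u 0 i t - t 1 * u 1 i t) a
    (fun i => -t 0 * x 0 (2 * i) t - t 1 * x 1 (2 * i) t)
    (fun i => -t 0 * y 0 (2 * i) t - t 1 * y 1 (2 * i) t) (-t 0) (-t 1)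

lemma opM_eq (hn : 1 ≤ n) (c : ℕ → ℂ) (a : ℂ) (u x y : Fin 2 → ℕ → (Fin 2 → ℂ) → ℂ)
    (t : Fin 2 → ℂ) : opM n c a u x y t = elt n (opMCoord c a u x y t) := by
  have e : opMCoord c a u x y t = (1 : ℂ) • ((1 : ℂ) • dsCoord c a 0 0 0 0
      + (-t 0) • opBCoord u x y 0 t) + (-t 1) • opBCoord u x y 1 t := by
    rw [opBCoord, opBCoord, dsCoord_lin, dsCoord_lin, opMCoord]
    simp [sub_eq_add_neg]
  rw [e, elt_add, elt_smul, elt_add, elt_smul, elt_smul, elt_smul, ← opB_eq hn, ← opB_eq hn,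
    elt_dsCoord hn, opM, Fin.sum_univ_two]
  simp only [evenE_zero, evenF_zero, one_smul, zero_smul, add_zero, neg_smul]
  abel

variable (F γ h : ℕ → ℂ) (d : ℂ) (x y : ℕ → ℂ) (r r' : ℂ)

/-- The block coefficients of `exp(ad Γ₂) exp(ad Γ₁) (r Λ₁ + r' Λ₂)` at the first vertices of the
Dynkin diagram. -/
lemma gauge_dsCoord_first (hn : 1 ≤ n) {Y : Coord}
    (hY : Y = expH n F (expE n γ (dsCoord h d x y r r'))) :
    Y.c00 0 = Complex.exp (F 0) * r ∧
    Y.c01 0 = Complex.exp (F 0) * Complex.exp (F 2) * (r' - γ 1 * r) ∧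
    Y.c10 0 = Complex.exp (F 1) * r' ∧
    Y.c11 0 = Complex.exp (F 1) * Complex.exp (F 2) * (r - γ 1 * r') := by
  have t0 : tr n γ (0 + 1) = γ 1 := tr_of_mem le_rfl hn
  simp only [hY, expH, expE, dsCoord, wt00, wt01, wt10, wt11, if_true, t0, tr_zero,
    ← Complex.exp_add, zero_mul, add_zero, sub_zero, and_self]

lemma gauge_dsCoord_mid {i : ℕ} (h1 : 1 ≤ i) (h2 : i < n) {Y : Coord}
    (hY : Y = expH n F (expE n γ (dsCoord h d x y r r'))) :
    Y.c00 i = Complex.exp (F (2 * i + 1)) * r ∧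
    Y.c01 i = Complex.exp (F (2 * i + 1)) * Complex.exp (F (2 * i + 2)) * (r' - γ (i + 1) * r) ∧
    Y.c10 i = Complex.exp (F (2 * i)) * Complex.exp (F (2 * i + 1)) * (r' + γ i * r) ∧
    Y.c11 i = Complex.exp (F (2 * i)) * Complex.exp (F (2 * i + 1)) * Complex.exp (F (2 * i + 2)) *
      (r + γ i * r' - γ (i + 1) * r' - γ i * γ (i + 1) * r) := by
  have t0 : tr n γ i = γ i := tr_of_mem h1 h2.le
  have t1 : tr n γ (i + 1) = γ (i + 1) := tr_of_mem (by omega) h2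
  simp only [hY, expH, expE, dsCoord, wt00, wt01, wt10, wt11, if_neg (by omega : i ≠ 0),
    if_neg h2.ne, t0, t1, ← Complex.exp_add, add_assoc, and_self]

lemma gauge_dsCoord_last (hn : 1 ≤ n) {Y : Coord}
    (hY : Y = expH n F (expE n γ (dsCoord h d x y r r'))) :
    Y.c00 n = Complex.exp (F (2 * n + 1)) * r ∧
    Y.c01 n = Complex.exp (F (2 * n + 2)) * r' ∧
    Y.c10 n = Complex.exp (F (2 * n)) * Complex.exp (F (2 * n + 1)) * (r' + γ n * r) ∧
    Y.c11 n = Complex.exp (F (2 * n)) * Complex.exp (F (2 * n + 2)) * (r + γ n * r') := by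
  have t0 : tr n γ n = γ n := tr_of_mem hn le_rfl
  have t1 : tr n γ (n + 1) = 0 := tr_of_gt (Nat.lt_succ_self n)
  simp only [hY, expH, expE, dsCoord, wt00, wt01, wt10, wt11, if_neg (by omega : n ≠ 0),
    if_true, t0, t1, ← Complex.exp_add, zero_mul, mul_zero, sub_zero, and_self]

variable {F γ h d x y}

/-- The normalization of the gauge, read off in coordinates. -/
lemma normal_coords (hn : 1 ≤ n) {t : Fin 2 → ℂ} {g b : ℕ → ℂ} {gd : ℂ}
    (h : expAd n (hElt n g gd) (expAd n (evenE n (gam t)) (-(∑ k : Fin 2, t k • Lam n k))) =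
      normalForm n b) :
    ∀ i ≤ n, ∀ Y, Y = expH n (hForm n g gd) (expE n (gam t) (dsCoord 0 0 0 0 (-t 0) (-t 1))) →
      Y.c00 i = (nfCoord n 0 0 0 b).c00 i ∧ Y.c01 i = (nfCoord n 0 0 0 b).c01 i ∧
      Y.c10 i = (nfCoord n 0 0 0 b).c10 i ∧ Y.c11 i = (nfCoord n 0 0 0 b).c11 i := by
  have e1 : -(∑ k : Fin 2, t k • Lam n k) = elt n (dsCoord 0 0 0 0 (-t 0) (-t 1)) := by
    rw [elt_dsCoord hn, Fin.sum_univ_two, hElt_zero, evenE_zero, evenF_zero]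
    module
  have e2 : normalForm n b = elt n (nfCoord n 0 0 0 b) := by
    rw [← normalForm_eq hn, hElt_zero, evenE_zero, zero_add, zero_add]
  rw [e1, e2, expAd_evenE_elt, expAd_hElt_elt] at h
  rintro i hi Y rfl
  exact ⟨coef_eq_of_elt_eq hn h (σ := Slot.w00) hi, coef_eq_of_elt_eq hn h (σ := Slot.w01) hi,
    coef_eq_of_elt_eq hn h (σ := Slot.w10) hi, coef_eq_of_elt_eq hn h (σ := Slot.w11) hi⟩

lemma normalEqs_of_normal (hn : 1 ≤ n) {t : Fin 2 → ℂ} {g b : ℕ → ℂ} {gd : ℂ}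
    (h : expAd n (hElt n g gd) (expAd n (evenE n (gam t)) (-(∑ k : Fin 2, t k • Lam n k))) =
      normalForm n b) : NormalEqs n t (fun k => Complex.exp (hForm n g gd k)) b := by
  have hc := normal_coords hn h
  have h0 := hc 0 (Nat.zero_le n) _ rfl
  have hl := hc n le_rfl _ rfl
  obtain ⟨a1, a2, a3, a4⟩ := gauge_dsCoord_first (hForm n g gd) (gam t) 0 0 0 0 (-t 0) (-t 1) hn rfl
  obtain ⟨b1, b2, b3, b4⟩ := gauge_dsCoord_last (hForm n g gd) (gam t) 0 0 0 0 (-t 0) (-t 1) hn rfl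
  rw [a1, a2, a3, a4] at h0
  rw [b1, b2, b3, b4] at hl
  simp only [nfCoord, pw_zero, pw_last hn] at h0 hl
  have hm (i : ℕ) (h1 : 1 ≤ i) (h2 : i < n) := by
    have hi := hc i h2.le _ rfl
    obtain ⟨c1, c2, c3, -⟩ :=
      gauge_dsCoord_mid (hForm n g gd) (gam t) 0 0 0 0 (-t 0) (-t 1) h1 h2 rfl
    rw [c1, c2, c3] at hi
    simpa only [nfCoord, pw_mid h1 h2] using hi
  refine ⟨h0.1, h0.2.2.1, ?_, fun i h1 h2 => (hm i h1 h2).1, ?_, ?_, hl.1, hl.2.1, ?_, ?_⟩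
  · rw [← h0.2.2.2]
    ring
  · intro i h1 h2
    rw [← (hm i h1 h2).2.1]
    ring
  · intro i h1 h2
    rw [← (hm i h1 h2).2.2.1]
    ring
  · rw [← hl.2.2.1]
    ring
  · rw [← hl.2.2.2]
    ring

end operators

/-! ### Derivatives along curves -/

lemma pd_eq_fderiv {f : (Fin 2 → ℂ) → ℂ} {t : Fin 2 → ℂ} (hf : DifferentiableAt ℂ f t) (k : Fin 2) :
    pd k f t = fderiv ℂ f t (Pi.single k 1) := by
  have h1 : HasDerivAt (Function.update t k) (Pi.single k 1) (t k) := hasDerivAt_update t k (t k)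
  have h2 : HasFDerivAt f (fderiv ℂ f t) (Function.update t k (t k)) := by
    rw [Function.update_eq_self]
    exact hf.hasFDerivAt
  exact (h2.comp_hasDerivAt (t k) h1).deriv

/-- The chain rule for a function of two variables along a curve. -/
lemma hasDerivAt_comp_curve {f : (Fin 2 → ℂ) → ℂ} {T : ℂ → Fin 2 → ℂ} {T' : Fin 2 → ℂ} {s : ℂ}
    (hf : DifferentiableAt ℂ f (T s)) (hT : HasDerivAt T T' s) :
    HasDerivAt (fun z => f (T z)) (T' 0 * pd 0 f (T s) + T' 1 * pd 1 f (T s)) s := by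
  have h : T' = T' 0 • Pi.single 0 1 + T' 1 • Pi.single 1 1 := by
    ext i
    fin_cases i <;> simp
  have := hf.hasFDerivAt.comp_hasDerivAt s hT
  rw [pd_eq_fderiv hf, pd_eq_fderiv hf, ← smul_eq_mul, ← smul_eq_mul, ← map_smul, ← map_smul,
    ← map_add, ← h]
  exact this

/-- The coordinates of `X` which enter `elt n X` are differentiable at `t`. -/
structure DifferentiableC (n : ℕ) (X : (Fin 2 → ℂ) → Coord) (t : Fin 2 → ℂ) : Prop where
  h : ∀ k < 2 * n + 3, DifferentiableAt ℂ (fun r => (X r).h k) t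
  d : DifferentiableAt ℂ (fun r => (X r).d) t
  x : ∀ i, 1 ≤ i → i ≤ n → DifferentiableAt ℂ (fun r => (X r).x i) t
  y : ∀ i, 1 ≤ i → i ≤ n → DifferentiableAt ℂ (fun r => (X r).y i) t
  c00 : ∀ i ≤ n, DifferentiableAt ℂ (fun r => (X r).c00 i) t
  c01 : ∀ i ≤ n, DifferentiableAt ℂ (fun r => (X r).c01 i) t
  c10 : ∀ i ≤ n, DifferentiableAt ℂ (fun r => (X r).c10 i) t
  c11 : ∀ i ≤ n, DifferentiableAt ℂ (fun r => (X r).c11 i) t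

/-- The coordinatewise partial derivative. -/
noncomputable def pdCoord (k : Fin 2) (X : (Fin 2 → ℂ) → Coord) (t : Fin 2 → ℂ) : Coord where
  h i := pd k (fun r => (X r).h i) t
  d := pd k (fun r => (X r).d) t
  x i := pd k (fun r => (X r).x i) t
  y i := pd k (fun r => (X r).y i) t
  c00 i := pd k (fun r => (X r).c00 i) t
  c01 i := pd k (fun r => (X r).c01 i) t
  c10 i := pd k (fun r => (X r).c10 i) t
  c11 i := pd k (fun r => (X r).c11 i) t

lemma hasDerivAt_update_curve (t : Fin 2 → ℂ) (k : Fin 2) :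
    HasDerivAt (fun z => Function.update t k z) (Pi.single k 1) (t k) := hasDerivAt_update t k (t k)

section curves
variable {n : ℕ} {T : ℂ → Fin 2 → ℂ} {T' : Fin 2 → ℂ} {s : ℂ}

lemma DifferentiableC.hasDerivC {X : (Fin 2 → ℂ) → Coord} (hX : DifferentiableC n X (T s))
    (hT : HasDerivAt T T' s) :
    HasDerivC n (fun z => X (T z)) (T' 0 • pdCoord 0 X (T s) + T' 1 • pdCoord 1 X (T s)) s where
  h k hk := hasDerivAt_comp_curve (hX.h k hk) hT
  d := hasDerivAt_comp_curve hX.d hT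
  x i h1 h2 := hasDerivAt_comp_curve (hX.x i h1 h2) hT
  y i h1 h2 := hasDerivAt_comp_curve (hX.y i h1 h2) hT
  c00 i hi := hasDerivAt_comp_curve (hX.c00 i hi) hT
  c01 i hi := hasDerivAt_comp_curve (hX.c01 i hi) hT
  c10 i hi := hasDerivAt_comp_curve (hX.c10 i hi) hT
  c11 i hi := hasDerivAt_comp_curve (hX.c11 i hi) hT

lemma pdCoord_unique {X : (Fin 2 → ℂ) → Coord} {t : Fin 2 → ℂ} (hX : DifferentiableC n X t)
    {k : Fin 2} {v : AffD n} (h : HasPartialW k (fun r => elt n (X r)) v t) :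
    elt n (pdCoord k X t) = v := by
  have hX' : DifferentiableC n X (Function.update t k (t k)) := by
    rwa [Function.update_eq_self]
  have h1 := (hX'.hasDerivC (hasDerivAt_update_curve t k)).hasDerivW
  rw [Function.update_eq_self] at h1
  rw [← HasDerivW.unique h1 h, elt_add, elt_smul, elt_smul]
  fin_cases k <;> simp

lemma differentiableAt_spread {t : Fin 2 → ℂ} {v : (Fin 2 → ℂ) → ℕ → ℂ}
    (hv : ∀ i, 1 ≤ i → i ≤ n → DifferentiableAt ℂ (fun r => v r i) t) (k : ℕ) :
    DifferentiableAt ℂ (fun r => spread n (v r) k) t := by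
  unfold spread tr
  split_ifs with h1 h2
  · exact hv _ h2.1 h2.2
  · exact differentiableAt_const _
  · exact differentiableAt_const _

lemma differentiableAt_hForm {t : Fin 2 → ℂ} {v : (Fin 2 → ℂ) → ℕ → ℂ} (a : ℂ)
    (hv : ∀ k < 2 * n + 3, DifferentiableAt ℂ (fun r => v r k) t) (j : ℕ) :
    DifferentiableAt ℂ (fun r => hForm n (v r) a j) t := by
  unfold hForm
  exact (DifferentiableAt.fun_sum fun k hk => (hv k (mem_range.1 hk)).mul_const _).add_const _

end curves

/-! ### The gauged operators -/

/-- The coordinates of `gaugedM`. -/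
noncomputable def gaugedMCoord (n : ℕ) (c : ℕ → ℂ) (a : ℂ) (u x y : Fin 2 → ℕ → (Fin 2 → ℂ) → ℂ)
    (g : ℕ → (Fin 2 → ℂ) → ℂ) (gd : ℂ) (η : ℕ → (Fin 2 → ℂ) → ℂ) (t : Fin 2 → ℂ) : Coord :=
  expF n (fun i => η i t) (expH n (hForm n (fun k => g k t) gd)
    (expE n (gam t) (opMCoord c a u x y t)))

/-- The coordinates of `gaugedB`. -/
noncomputable def gaugedBCoord (n : ℕ) (u x y : Fin 2 → ℕ → (Fin 2 → ℂ) → ℂ)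
    (g : ℕ → (Fin 2 → ℂ) → ℂ) (gd : ℂ) (η : ℕ → (Fin 2 → ℂ) → ℂ) (k : Fin 2) (t : Fin 2 → ℂ) :
    Coord :=
  gaugeCoord n (gam t) (fun i => pd k (fun r => gam r i) t) (fun j => g j t)
    (fun j => pd k (g j) t) gd (fun i => η i t) (fun i => pd k (η i) t) (opBCoord u x y k t)

section gauged
variable {n : ℕ} {D : Set (Fin 2 → ℂ)} {c : ℕ → ℂ} {a : ℂ} {u x y : Fin 2 → ℕ → (Fin 2 → ℂ) → ℂ}
  {g : ℕ → (Fin 2 → ℂ) → ℂ} {gd : ℂ} {b η : ℕ → (Fin 2 → ℂ) → ℂ}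

lemma gaugedM_eq (hn : 1 ≤ n) (t : Fin 2 → ℂ) :
    gaugedM n c a u x y g gd η t = elt n (gaugedMCoord n c a u x y g gd η t) := by
  rw [gaugedM, opM_eq hn, expAd_evenE_elt, expAd_hElt_elt, expAd_evenF_elt, gaugedMCoord]

lemma gaugedB_eq (hn : 1 ≤ n) (k : Fin 2) (t : Fin 2 → ℂ) :
    gaugedB n u x y g gd η k t = elt n (gaugedBCoord n u x y g gd η k t) := by
  rw [gaugedB, opB_eq hn, elt_gaugeCoord, gaugedBCoord]

lemma NormalEqs.differentiableAt_gam {E b : ℕ → ℂ} {t : Fin 2 → ℂ} (h : NormalEqs n t E b) {i : ℕ}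
    (h1 : 1 ≤ i) : i ≤ n + 1 → DifferentiableAt ℂ (fun r => gam r i) t := by
  have d (j : Fin 2) : DifferentiableAt ℂ (fun r : Fin 2 → ℂ => r j) t := differentiableAt_apply j t
  induction i, h1 using Nat.le_induction with
  | base => exact fun _ => (d 1).fun_mul ((d 0).fun_inv h.t0_ne)
  | succ i h1 ih =>
    intro h2
    have hi := ih (by omega)
    have hd := h.den_ne h1 (by omega)
    obtain ⟨i, rfl⟩ := Nat.exists_eq_add_of_le' h1
    exact ((d 0).fun_add ((d 1).fun_mul hi)).fun_mul
      (((d 1).fun_add ((d 0).fun_mul hi)).fun_inv hd)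

lemma differentiableC_opMCoord (hD : IsOpen D) (hS : IsSimilarityReduction n D c a u x y)
    {t : Fin 2 → ℂ} (ht : t ∈ D) :
    DifferentiableC n (opMCoord c a u x y) t := by
  have hD' := hD.mem_nhds ht
  have d (j : Fin 2) : DifferentiableAt ℂ (fun r : Fin 2 → ℂ => r j) t := differentiableAt_apply j t
  have hu (j : Fin 2) (k : ℕ) (hk : k < 2 * n + 3) : DifferentiableAt ℂ (u j k) t :=
    (hS.diff_u j k (mem_range.2 hk)).differentiableAt hD'
  have hx (j : Fin 2) (i : ℕ) (h1 : 1 ≤ i) (h2 : i ≤ n) : DifferentiableAt ℂ (x j (2 * i)) t :=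
    (hS.diff_x j i (mem_Icc.2 ⟨h1, h2⟩)).differentiableAt hD'
  have hy (j : Fin 2) (i : ℕ) (h1 : 1 ≤ i) (h2 : i ≤ n) : DifferentiableAt ℂ (y j (2 * i)) t :=
    (hS.diff_y j i (mem_Icc.2 ⟨h1, h2⟩)).differentiableAt hD'
  refine ⟨fun k hk => ?_, differentiableAt_const _, fun i h1 h2 => ?_, fun i h1 h2 => ?_,
    fun i _ => (d 0).fun_neg, fun i _ => (d 1).fun_neg, fun i _ => (d 1).fun_neg,
    fun i _ => (d 0).fun_neg⟩
  · exact ((differentiableAt_const _).fun_sub ((d 0).fun_mul (hu 0 k hk))).fun_sub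
      ((d 1).fun_mul (hu 1 k hk))
  · exact ((d 0).fun_neg.fun_mul (hx 0 i h1 h2)).fun_sub ((d 1).fun_mul (hx 1 i h1 h2))
  · exact ((d 0).fun_neg.fun_mul (hy 0 i h1 h2)).fun_sub ((d 1).fun_mul (hy 1 i h1 h2))

variable (hn : 1 ≤ n) (hD : IsOpen D) (hS : IsSimilarityReduction n D c a u x y)
  (hG : IsBorelGauge n D c a u x y g gd b η)
include hn hD hS hG

/-- Along a curve the gauged operator satisfies a Lax equation. -/
lemma exists_hasDerivC_gaugedM {T : ℂ → Fin 2 → ℂ} {T' : Fin 2 → ℂ} {s : ℂ} (hs : T s ∈ D)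
    (hT : HasDerivAt T T' s) :
    ∃ Z, HasDerivC n (fun z => gaugedMCoord n c a u x y g gd η (T z)) Z s ∧
      elt n Z = ⁅elt n (T' 0 • gaugedBCoord n u x y g gd η 0 (T s)
        + T' 1 • gaugedBCoord n u x y g gd η 1 (T s)),
        elt n (gaugedMCoord n c a u x y g gd η (T s))⁆ := by
  have hD' := hD.mem_nhds hs
  have hM := differentiableC_opMCoord (n := n) hD hS hs
  have hlax (k : Fin 2) : elt n (pdCoord k (opMCoord c a u x y) (T s)) =
      ⁅elt n (opBCoord u x y k (T s)), elt n (opMCoord c a u x y (T s))⁆ := by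
    refine pdCoord_unique hM ?_
    have := hS.lax (T s) hs k
    rw [opB_eq hn, opM_eq hn] at this
    simpa only [HasPartialW, opM_eq hn] using this
  have h1 := hM.hasDerivC hT
  have h2 : elt n (T' 0 • pdCoord 0 (opMCoord c a u x y) (T s)
      + T' 1 • pdCoord 1 (opMCoord c a u x y) (T s)) =
      ⁅elt n (T' 0 • opBCoord u x y 0 (T s) + T' 1 • opBCoord u x y 1 (T s)),
        elt n (opMCoord c a u x y (T s))⁆ := by
    rw [elt_add, elt_add, elt_smul, elt_smul, elt_smul, elt_smul, hlax, hlax, add_lie, smul_lie,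
      smul_lie]
  have hN := normalEqs_of_normal hn (hG.normal _ hs)
  have h3 := exists_hasDerivC_gauge h1 h2 gd
    (fun i h1 h2 => hasDerivAt_comp_curve (hN.differentiableAt_gam h1 (by omega)) hT)
    (fun k hk => hasDerivAt_comp_curve
      ((hG.diff_g k (mem_range.2 hk)).differentiableAt hD') hT)
    (fun i h1 h2 => hasDerivAt_comp_curve
      ((hG.diff_η i (mem_Icc.2 ⟨h1, h2⟩)).differentiableAt hD') hT)
  rw [gaugeCoord_lin] at h3
  exact h3

lemma hasPartialW_gaugedM {t : Fin 2 → ℂ} (ht : t ∈ D) (k : Fin 2) :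
    HasPartialW k (gaugedM n c a u x y g gd η)
      ⁅gaugedB n u x y g gd η k t, gaugedM n c a u x y g gd η t⁆ t := by
  obtain ⟨Z, hZ, he⟩ := exists_hasDerivC_gaugedM hn hD hS hG (T := Function.update t k)
    (s := t k) (by rwa [Function.update_eq_self]) (hasDerivAt_update_curve t k)
  rw [Function.update_eq_self] at he
  have h := hZ.hasDerivW
  rw [he, elt_add, elt_smul, elt_smul, ← gaugedM_eq hn, ← gaugedB_eq hn, ← gaugedB_eq hn] at h
  have e : (Pi.single k 1 : Fin 2 → ℂ) 0 • gaugedB n u x y g gd η 0 t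
      + (Pi.single k 1 : Fin 2 → ℂ) 1 • gaugedB n u x y g gd η 1 t = gaugedB n u x y g gd η k t := by
    fin_cases k <;> simp
  rw [e] at h
  simpa only [HasPartialW, gaugedM_eq hn] using h

end gauged

/-! ### The gauged operator in the Borel subalgebra -/

/-- The part of `X` without the components at the `f_{2i}`. -/
def Coord.noF (X : Coord) : Coord := { X with y := 0 }

section borelForm
variable {n : ℕ} {D : Set (Fin 2 → ℂ)} {c : ℕ → ℂ} {a : ℂ} {u x y : Fin 2 → ℕ → (Fin 2 → ℂ) → ℂ}
  {g : ℕ → (Fin 2 → ℂ) → ℂ} {gd : ℂ} {b η : ℕ → (Fin 2 → ℂ) → ℂ}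

lemma elt_noF (hn : 1 ≤ n) {X : Coord} (hX : elt n X ∈ borel n) : elt n X.noF = elt n X :=
  elt_congr (fun _ _ => rfl) rfl (fun _ _ _ => rfl)
    (fun _ h1 h2 => (coord_y_eq_zero hn hX ⟨h1, h2⟩).symm) fun _ _ => ⟨rfl, rfl, rfl, rfl⟩

lemma hElt_eq_of_elt_eq (hn : 1 ≤ n) {X Y : Coord} (h : elt n X = elt n Y) :
    hElt n X.h X.d = hElt n Y.h Y.d := by
  have h' : elt n { X with h := 0, d := 0 } = elt n { Y with h := 0, d := 0 } :=
    elt_congr (fun _ _ => rfl) rfl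
      (fun i h1 h2 => coef_eq_of_elt_eq hn h (σ := Slot.e) ⟨h1, h2⟩)
      (fun i h1 h2 => coef_eq_of_elt_eq hn h (σ := Slot.f) ⟨h1, h2⟩)
      fun i hi => ⟨coef_eq_of_elt_eq hn h (σ := Slot.w00) hi,
        coef_eq_of_elt_eq hn h (σ := Slot.w01) hi, coef_eq_of_elt_eq hn h (σ := Slot.w10) hi,
        coef_eq_of_elt_eq hn h (σ := Slot.w11) hi⟩
  have e (X : Coord) : elt n X = hElt n X.h X.d + elt n { X with h := 0, d := 0 } := by
    simp only [elt, hElt_zero, zero_add, add_assoc]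
  rw [e X, e Y, h'] at h
  exact add_right_cancel h

/-- The bracket of two elements of the Borel subalgebra has no component in the Cartan
subalgebra. -/
lemma hElt_eq_zero_of_lie (hn : 1 ≤ n) {B M Z : Coord} (hB : elt n B ∈ borel n)
    (hM : elt n M ∈ borel n) (h : elt n Z = ⁅elt n B, elt n M⁆) : hElt n Z.h Z.d = 0 := by
  rw [← elt_noF hn hB, ← elt_noF hn hM, lie_elt rfl rfl] at h
  rw [hElt_eq_of_elt_eq hn (elt_eq_of_elt_eq_add hn h)]
  exact hElt_zero

lemma smul_add_smul_mem_borel {B B' : Coord} (r r' : ℂ) (h : elt n B ∈ borel n)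
    (h' : elt n B' ∈ borel n) : elt n (r • B + r' • B') ∈ borel n := by
  rw [elt_add, elt_smul, elt_smul]
  exact add_mem (Submodule.smul_mem _ _ h) (Submodule.smul_mem _ _ h')

lemma borelOdd_one (l c : ℕ → ℂ) : borelOdd n l c 1 = c 1 - l 1 := if_pos rfl

lemma borelOdd_mid (l c : ℕ → ℂ) {i : ℕ} (h1 : 1 ≤ i) (h2 : i < n) :
    borelOdd n l c (2 * i + 1) = l i - l (i + 1) := by
  rw [borelOdd, if_neg (by omega), if_neg (by omega), if_neg (by omega),
    show (2 * i + 1) / 2 = i by omega]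

lemma borelOdd_last0 (hn : 1 ≤ n) (l c : ℕ → ℂ) :
    borelOdd n l c (2 * n + 1) = l n - c (2 * n + 1) := by
  rw [borelOdd, if_neg (by omega), if_pos rfl]

lemma borelOdd_last1 (l c : ℕ → ℂ) : borelOdd n l c (2 * n + 2) = l n - c (2 * n + 2) := by
  rw [borelOdd, if_neg (by omega), if_neg (by omega), if_pos rfl]

/-- The part of degree one of the gauged operator. -/
lemma gaugedMCoord_blocks (hn : 1 ≤ n) {t : Fin 2 → ℂ}
    (h : expAd n (hElt n (fun k => g k t) gd)
      (expAd n (evenE n (gam t)) (-(∑ k : Fin 2, t k • Lam n k))) = normalForm n fun j => b j t)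
    (κ : ℕ → ℂ) (κd : ℂ) (μ : ℕ → ℂ) (Y Y' : Coord) (hY : Y = gaugedMCoord n c a u x y g gd η t)
    (hY' : Y' = nfCoord n κ κd μ (borelOdd n (lam (fun j => b j t) fun j => η j t)
      (cc n fun j => b j t))) :
    ∀ i ≤ n, Y.c00 i = Y'.c00 i ∧ Y.c01 i = Y'.c01 i ∧ Y.c10 i = Y'.c10 i ∧ Y.c11 i = Y'.c11 i := by
  have key (i : ℕ) (hi : i ≤ n) := normal_coords hn h i hi _ rfl
  subst hY hY'
  have hc (i : ℕ) (hi : i ≤ n) :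
      (gaugedMCoord n c a u x y g gd η t).c00 i =
        (expF n (fun i => η i t) (nfCoord n 0 0 0 fun j => b j t)).c00 i ∧
      (gaugedMCoord n c a u x y g gd η t).c01 i =
        (expF n (fun i => η i t) (nfCoord n 0 0 0 fun j => b j t)).c01 i ∧
      (gaugedMCoord n c a u x y g gd η t).c10 i =
        (expF n (fun i => η i t) (nfCoord n 0 0 0 fun j => b j t)).c10 i ∧
      (gaugedMCoord n c a u x y g gd η t).c11 i =
        (expF n (fun i => η i t) (nfCoord n 0 0 0 fun j => b j t)).c11 i := by
    obtain ⟨k1, k2, k3, k4⟩ := key i hi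
    simp only [expF]
    rw [← k1, ← k2, ← k3, ← k4]
    exact ⟨rfl, rfl, rfl, rfl⟩
  have t0 (v : ℕ → ℂ) : tr n v (0 + 1) = v 1 := tr_of_mem le_rfl hn
  have tl (v : ℕ → ℂ) : tr n v (n + 1) = 0 := tr_of_gt (Nat.lt_succ_self n)
  have tn (v : ℕ → ℂ) : tr n v n = v n := tr_of_mem hn le_rfl
  have h1 : ¬2 * n + 1 = 1 := by omega
  have h2 : ¬2 * n + 2 = 1 := by omega
  refine (forall_le_split _).2 ⟨?_, fun i hi hi' => ?_, ?_⟩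
  · rw [(hc 0 (Nat.zero_le n)).1, (hc 0 (Nat.zero_le n)).2.1, (hc 0 (Nat.zero_le n)).2.2.1,
      (hc 0 (Nat.zero_le n)).2.2.2]
    simp only [expF, nfCoord, pw_zero, t0, tr_zero, borelOdd_one, cc, lam, if_true, Ico_self,
      sum_empty]
    refine ⟨?_, ?_, ?_, ?_⟩ <;> first | trivial | ring1
  · rw [(hc i hi'.le).1, (hc i hi'.le).2.1, (hc i hi'.le).2.2.1, (hc i hi'.le).2.2.2]
    have ti (v : ℕ → ℂ) : tr n v i = v i := tr_of_mem hi hi'.le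
    have ti' (v : ℕ → ℂ) : tr n v (i + 1) = v (i + 1) := tr_of_mem (by omega) hi'
    simp only [expF, nfCoord, pw_mid hi hi', ti, ti', borelOdd_mid _ _ hi hi', lam,
      sum_Ico_succ_top hi]
    refine ⟨?_, ?_, ?_, ?_⟩ <;> first | trivial | ring1
  · rw [(hc n le_rfl).1, (hc n le_rfl).2.1, (hc n le_rfl).2.2.1, (hc n le_rfl).2.2.2]
    simp only [expF, nfCoord, pw_last hn, tn, tl, borelOdd_last0 hn, borelOdd_last1, lam, cc,
      if_neg h1, if_neg h2]
    refine ⟨?_, ?_, ?_, ?_⟩ <;> first | trivial | ring1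

/-- The gauged operator consists of its Cartan part, its coefficients at the `e_{2i}`, and a part of
degree one which `Γ₃` changes from the coefficients `b` to differences of `λ` and `c`. -/
lemma gaugedM_eq_nfCoord (hn : 1 ≤ n) (hG : IsBorelGauge n D c a u x y g gd b η) {t : Fin 2 → ℂ}
    (ht : t ∈ D) : gaugedM n c a u x y g gd η t =
      hElt n (gaugedMCoord n c a u x y g gd η t).h a +
        elt n (nfCoord n 0 0 (gaugedMCoord n c a u x y g gd η t).x
          (borelOdd n (lam (fun j => b j t) fun j => η j t) (cc n fun j => b j t))) := by
  have hm := hG.mem_M t ht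
  rw [gaugedM_eq hn] at hm ⊢
  rw [← elt_inH, ← elt_add]
  refine elt_congr (fun k _ => ?_) ?_ (fun i _ _ => ?_) (fun i h1 h2 => ?_) fun i hi => ?_
  · simp [nfCoord]
  · simp only [Coord.add_d, nfCoord, add_zero]
    rfl
  · simp [nfCoord]
  · rw [coord_y_eq_zero hn hm ⟨h1, h2⟩]
    simp [nfCoord]
  · have := gaugedMCoord_blocks (c := c) (a := a) (u := u) (x := x) (y := y) (η := η) hn
      (hG.normal t ht) 0 0 (gaugedMCoord n c a u x y g gd η t).x _ _ rfl rfl i hi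
    simpa using this

/-- The values of `ϑ` at the simple roots sum up, with the marks of the imaginary root, to `2n+2`. -/
lemma theta_d (hn : 1 ≤ n) (h : IsTheta n c a) : a = 2 * n + 2 := by
  obtain ⟨h1, h2, h3, h4⟩ := h
  rw [← sum_hForm_mul_deltaCoef hn c a, sum_range_parity, sum_range_split hn]
  have e1 : ∑ i ∈ Icc 1 n, hForm n c a (2 * i) * deltaCoef n (2 * i) = 0 :=
    sum_eq_zero fun i hi => by rw [h1 i hi, zero_mul]
  have e2 : ∑ i ∈ Ico 1 n, hForm n c a (2 * i + 1) * deltaCoef n (2 * i + 1) = (n - 1) * 2 := by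
    rw [sum_congr rfl (g := fun _ => (2 : ℂ)) fun i hi => by
      rw [mem_Ico] at hi
      rw [h3 i (by rw [mem_Icc]; omega), deltaCoef, if_neg (by omega), one_mul]]
    rw [sum_const, Nat.card_Ico, nsmul_eq_mul, Nat.cast_sub hn, Nat.cast_one]
  have d0 : deltaCoef n 0 = 1 := if_pos (by omega)
  have d1 : deltaCoef n 1 = 1 := if_pos (by omega)
  have d2 : deltaCoef n (2 * n + 1) = 1 := if_pos (by omega)
  have d3 : deltaCoef n (2 * n + 2) = 1 := if_pos (by omega)
  have f1 := h3 0 (by simp)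
  have f2 := h3 n (by simp)
  simp only [mul_zero, zero_add] at f1 ⊢
  rw [e1, e2, h2, f1, f2, h4, d0, d1, d2, d3]
  ring

variable (hn : 1 ≤ n) (hD : IsOpen D) (hS : IsSimilarityReduction n D c a u x y)
  (hG : IsBorelGauge n D c a u x y g gd b η)
include hn hD hS hG

/-- The Cartan coordinates, spelled out, are polynomials in differentiable functions. -/
lemma differentiableAt_gaugedMCoord_h {t : Fin 2 → ℂ} (ht : t ∈ D) {k : ℕ} (hk : k < 2 * n + 3) :
    DifferentiableAt ℂ (fun r => (gaugedMCoord n c a u x y g gd η r).h k) t := by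
  have hD' := hD.mem_nhds ht
  have hM := differentiableC_opMCoord (n := n) hD hS ht
  have hN := normalEqs_of_normal hn (hG.normal _ ht)
  have hγ (i : ℕ) (h1 : 1 ≤ i) (h2 : i ≤ n) := hN.differentiableAt_gam h1 (by omega : i ≤ n + 1)
  have hη (i : ℕ) (h1 : 1 ≤ i) (h2 : i ≤ n) :=
    (hG.diff_η i (mem_Icc.2 ⟨h1, h2⟩)).differentiableAt hD'
  have hF := differentiableAt_hForm (n := n) (v := fun r k => g k r) gd fun k hk =>
    (hG.diff_g k (mem_range.2 hk)).differentiableAt hD'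
  have hF' := differentiableAt_hForm (n := n) a hM.h
  have hh := ((hM.h k hk).fun_add (differentiableAt_spread
    (fun i h1 h2 => (hγ i h1 h2).fun_mul (hM.y i h1 h2)) k)).fun_sub (differentiableAt_spread
    (fun i h1 h2 => (hη i h1 h2).fun_mul ((hF (2 * i)).cexp.fun_mul
      (((hM.x i h1 h2).fun_sub ((hγ i h1 h2).fun_mul (hF' (2 * i)))).fun_sub
        (((hγ i h1 h2).fun_pow 2).fun_mul (hM.y i h1 h2))))) k)
  exact hh

/-- The Cartan part of the gauged operator is constant. -/
lemma hElt_gaugedMCoord_eq (hc : IsPreconnected D) {t t' : Fin 2 → ℂ} (ht : t ∈ D) (ht' : t' ∈ D) :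
    hElt n (gaugedMCoord n c a u x y g gd η t).h a =
      hElt n (gaugedMCoord n c a u x y g gd η t').h a := by
  refine eq_of_forall_dual fun φ => ?_
  have hd (t : Fin 2 → ℂ) (ht : t ∈ D) :
      DifferentiableAt ℂ (fun r => φ (hElt n (gaugedMCoord n c a u x y g gd η r).h a)) t := by
    simp only [hElt, map_add, map_sum, map_smul, smul_eq_mul]
    exact (DifferentiableAt.fun_sum fun k hk => (differentiableAt_gaugedMCoord_h hn hD hS hG ht
      (mem_range.1 hk)).mul_const _).add_const _
  have hp (t : Fin 2 → ℂ) (ht : t ∈ D) (k : Fin 2) :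
      fderiv ℂ (fun r => φ (hElt n (gaugedMCoord n c a u x y g gd η r).h a)) t
        (Pi.single k 1) = 0 := by
    rw [← pd_eq_fderiv (hd t ht)]
    have hu : Function.update t k (t k) ∈ D := by rwa [Function.update_eq_self]
    obtain ⟨Z, hZ, he⟩ := exists_hasDerivC_gaugedM hn hD hS hG hu (hasDerivAt_update_curve t k)
    have hB (j : Fin 2) := hG.mem_B _ hu j
    have hM := hG.mem_M _ hu
    simp only [gaugedB_eq hn] at hB
    rw [gaugedM_eq hn] at hM
    have h0 := hElt_eq_zero_of_lie hn (smul_add_smul_mem_borel _ _ (hB 0) (hB 1)) hM he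
    have hZ' : HasDerivC n (fun z => ⟨(gaugedMCoord n c a u x y g gd η (Function.update t k z)).h,
        a, 0, 0, 0, 0, 0, 0⟩) ⟨Z.h, Z.d, 0, 0, 0, 0, 0, 0⟩ (t k) :=
      ⟨hZ.h, hZ.d, fun _ _ _ => hasDerivAt_const _ _, fun _ _ _ => hasDerivAt_const _ _,
        fun _ _ => hasDerivAt_const _ _, fun _ _ => hasDerivAt_const _ _,
        fun _ _ => hasDerivAt_const _ _, fun _ _ => hasDerivAt_const _ _⟩
    have := hZ'.hasDerivW φ
    rw [elt_inH, h0, map_zero] at this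
    simp only [elt_inH] at this
    exact this.deriv
  refine hD.is_const_of_fderiv_eq_zero (𝕜 := ℂ) hc
    (fun t ht => (hd t ht).differentiableWithinAt) (fun t ht => ?_) ht ht'
  ext v
  have hv : v = v 0 • Pi.single 0 1 + v 1 • Pi.single 1 1 := by
    ext i
    fin_cases i <;> simp
  rw [hv, map_add, map_smul, map_smul, hp t ht, hp t ht]
  simp

end borelForm

/-! ### The restriction to `s₂ = 1` -/

section restriction
open Filter Topology

variable {n : ℕ}

/-- The value of the torus element `exp(Γ₂)` at the imaginary root depends only on the constant
coefficient `gd`. -/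
lemma exp_hForm_prod (hn : 1 ≤ n) (g : ℕ → ℂ) (gd : ℂ) :
    Complex.exp (hForm n g gd 0) * Complex.exp (hForm n g gd 1)
      * (∏ j ∈ Icc 2 (2 * n), Complex.exp (hForm n g gd j) ^ 2)
      * Complex.exp (hForm n g gd (2 * n + 1)) * Complex.exp (hForm n g gd (2 * n + 2)) =
    Complex.exp gd := by
  conv_rhs => rw [← hForm_delta hn g gd]
  rw [Complex.exp_add, Complex.exp_add, Complex.exp_add, Complex.exp_add, Complex.exp_sum]
  congr 3
  refine prod_congr rfl fun j _ => ?_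
  rw [two_mul, Complex.exp_add, sq]

/-- The functions `γ_{2i}` along a curve on which `t₂² - t₁²` is stationary. -/
lemma hasDerivAt_gam {T : ℂ → Fin 2 → ℂ} {s τ : ℂ} {E b : ℕ → ℂ}
    (h0 : HasDerivAt (fun z => T z 0) (τ * T s 1) s)
    (h1 : HasDerivAt (fun z => T z 1) (τ * T s 0) s) (hN : NormalEqs n (T s) E b) {i : ℕ}
    (hi : 1 ≤ i) : i ≤ n + 1 →
    HasDerivAt (fun z => gam (T z) i) (i * τ * (1 - gam (T s) i ^ 2)) s := by
  have t0 := hN.t0_ne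
  induction i, hi using Nat.le_induction with
  | base =>
    intro _
    refine (h1.fun_div h0 t0).congr_deriv ?_
    rw [show gam (T s) 1 = T s 1 / T s 0 from rfl]
    field_simp
    push_cast
    ring
  | succ i hi ih =>
    intro h2
    have hg := ih (by omega)
    have hd := hN.den_ne hi (by omega)
    obtain ⟨i, rfl⟩ := Nat.exists_eq_add_of_le' hi
    simp only [NormalEqs.gam_add_two]
    refine ((h0.fun_add (h1.fun_mul hg)).fun_div (h1.fun_add (h0.fun_mul hg)) hd).congr_deriv ?_
    field_simp
    push_cast
    ring

/-- The velocity of a curve on which `s₁` is the parameter and `s₂ = 1`. -/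
lemma curve_velocity (hn : 1 ≤ n) {T : ℂ → Fin 2 → ℂ} {T' : Fin 2 → ℂ} {s K : ℂ}
    {E b : ℂ → ℕ → ℂ} (hT : HasDerivAt T T' s)
    (hN : ∀ᶠ z in 𝓝 s, NormalEqs n (T z) (E z) (b z))
    (hK : ∀ᶠ z in 𝓝 s, E z 0 * E z 1 * (∏ j ∈ Icc 2 (2 * n), E z j ^ 2) * E z (2 * n + 1)
      * E z (2 * n + 2) = K)
    (hs1 : ∀ᶠ z in 𝓝 s, s1 n (b z) = z) (hs2 : ∀ᶠ z in 𝓝 s, s2 n (b z) = 1) :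
    T' 0 * (-T s 0 * E s 1) = -T s 1 ∧ T' 1 * (-T s 0 * E s 1) = -T s 0 := by
  have hn0 := natCast_ne_zero n
  have hTi := hasDerivAt_pi.1 hT
  have N := hN.self_of_nhds
  have t0 := N.t0_ne
  have eK : ∀ᶠ z in 𝓝 s, K * (T z 1 ^ 2 - T z 0 ^ 2) ^ (n + 1) = 2 * n + 2 := by
    filter_upwards [hN, hK, hs2] with z h1 h2 h3
    rw [← h2, ← h1.s2_eq hn, h3, mul_one]
  have eK0 := eK.self_of_nhds
  have hK0 : K ≠ 0 := fun h => hn0 (by rw [← eK0, h, zero_mul])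
  have hδ : T s 1 ^ 2 - T s 0 ^ 2 ≠ 0 := fun h => hn0 (by
    rw [← eK0, h, zero_pow (Nat.succ_ne_zero n), mul_zero])
  -- `s₂ = 1` makes `t₂² - t₁²` stationary
  have hstat : T s 1 * T' 1 = T s 0 * T' 0 := by
    have d1 := ((((hTi 1).fun_pow 2).fun_sub ((hTi 0).fun_pow 2)).fun_pow (n + 1)).const_mul K
    have d2 := (hasDerivAt_const s (2 * n + 2 : ℂ)).congr_of_eventuallyEq eK
    have h := d1.unique d2
    have h2 : (n + 1 : ℂ) ≠ 0 := by exact_mod_cast Nat.succ_ne_zero n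
    simp only [Nat.add_sub_cancel, Nat.cast_add, Nat.cast_one, mul_eq_zero, hK0, h2,
      pow_ne_zero n hδ, false_or] at h
    norm_num at h
    linear_combination h / 2
  obtain ⟨τ, hτ⟩ : ∃ τ, τ = T' 1 / T s 0 := ⟨_, rfl⟩
  have h1 : T' 1 = τ * T s 0 := by rw [hτ, div_mul_cancel₀ _ t0]
  have h0 : T' 0 = τ * T s 1 := mul_left_cancel₀ t0 (by
    rw [← hstat, h1]
    ring)
  have hw := hasDerivAt_gam (h0 ▸ hTi 0) (h1 ▸ hTi 1) N (i := n + 1) (by omega) le_rfl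
  -- the quotient `(s - 1) / s` is the square of the last of the functions `γ`
  have ew : ∀ᶠ z in 𝓝 s, z * gam (T z) (n + 1) ^ 2 = z - 1 := by
    filter_upwards [hN, hs1, hs2] with z a1 a2 a3
    have e1 := a1.s1_mul hn
    have e2 := a1.s1_sub_s2 hn
    rw [a2] at e1
    rw [a2, a3] at e2
    refine mul_left_cancel₀ hn0 ?_
    linear_combination gam (T z) (n + 1) * e1 - e2
  have ew0 := ew.self_of_nhds
  have d1 := (hasDerivAt_id s).fun_mul (hw.fun_pow 2)
  have d2 := ((hasDerivAt_id s).sub_const 1).congr_of_eventuallyEq ew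
  have h := d1.unique d2
  have e1 := N.s1_mul hn
  rw [hs1.self_of_nhds] at e1
  generalize gam (T s) (n + 1) = w at *
  have hw1 : 1 - w ^ 2 ≠ 0 := fun h' => by
    have : (0 : ℂ) = -1 := by linear_combination s * h' + ew0
    norm_num at this
  have hτ' : (2 * n + 2) * s * w * τ = 1 := by
    refine mul_right_cancel₀ hw1 ?_
    norm_num at h
    linear_combination h
  rw [e1] at hτ'
  rw [h0, h1]
  constructor
  · linear_combination -T s 1 * hτ'
  · linear_combination -T s 0 * hτ'

namespace NormalEqs

variable {t : Fin 2 → ℂ} {E b : ℕ → ℂ} (h : NormalEqs n t E b) {N G r r' : ℂ}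
  (hG : G = -t 0 * E 1) (hr : N ^ 2 * r = -t 1 * G) (hr' : N ^ 2 * r' = -t 0 * G)
include h hG hr hr'

/-- The part of degree one of `exp(ad Γ₂) exp(ad Γ₁) (r Λ₁ + r' Λ₂)` for the velocity
`(r, r') = -(G / N²)(t₂, t₁)` of the curve, at the first vertices of the Dynkin diagram. -/
lemma coef_first : N ^ 2 * (E 0 * r) = G * gam t 1 ∧
    N ^ 2 * (E 0 * E 2 * (r' - gam t 1 * r)) = 1 ∧ N ^ 2 * (E 1 * r') = G ^ 2 ∧
    N ^ 2 * (E 1 * E 2 * (r - gam t 1 * r')) = 0 := by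
  have e1 := h.first00
  have e2 := h.first11
  have e3 := h.gam_one_mul
  refine ⟨?_, ?_, ?_, ?_⟩
  · linear_combination E 0 * hr + E 0 * G * e3 + gam t 1 * G * e1
  · have : G * E 0 = E 1 := by
      rw [hG]
      linear_combination E 1 * e1
    linear_combination e2 + E 0 * E 2 * hr' - E 0 * E 2 * gam t 1 * hr
      + E 2 * (-t 0 + gam t 1 * t 1) * this
  · rw [mul_left_comm, hr', hG]
    ring
  · linear_combination E 1 * E 2 * hr - E 1 * E 2 * gam t 1 * hr' + E 1 * E 2 * G * e3

omit hr' in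
lemma coef_odd {i : ℕ} (h1 : 1 ≤ i) (h2 : i ≤ n) :
    N ^ 2 * (E (2 * i + 1) * r) = G ^ 2 * (1 - gam t i * gam t (i + 1)) := by
  have e1 := h.odd_mul_scale h1 h2
  have e2 := h.gam_succ_mul h1 h2
  rw [← hG] at e1
  refine mul_left_cancel₀ h.t0_ne ?_
  linear_combination t 0 * E (2 * i + 1) * hr + t 1 * G * e1 + G ^ 2 * e2

omit hG in
lemma coef_even_odd {i : ℕ} (h1 : 1 ≤ i) (h2 : i ≤ n) :
    N ^ 2 * (E (2 * i) * E (2 * i + 1) * (r' + gam t i * r)) = G * gam t (i + 1) := by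
  have e1 := h.even_mul_odd h1 h2
  have e2 := h.gam_succ_mul h1 h2
  linear_combination E (2 * i) * E (2 * i + 1) * hr' + E (2 * i) * E (2 * i + 1) * gam t i * hr
    + G * gam t (i + 1) * e1 + E (2 * i) * E (2 * i + 1) * G * e2

lemma coef_mid {i : ℕ} (h1 : 1 ≤ i) (h2 : i < n) :
    N ^ 2 * (E (2 * i + 1) * E (2 * i + 2) * (r' - gam t (i + 1) * r)) = -(G * gam t i) ∧
    N ^ 2 * (E (2 * i) * E (2 * i + 1) * E (2 * i + 2) *
      (r + gam t i * r' - gam t (i + 1) * r' - gam t i * gam t (i + 1) * r)) = 1 := by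
  have e1 := h.mid01 i h1 h2
  have e2 := h.gam_succ_mul h1 h2.le
  have e3 := h.mid10 i h1 h2
  have e4 := h.even_mul_scale (i := i + 1) (by omega) h2
  rw [← hG, show 2 * (i + 1) = 2 * i + 2 by ring] at e4
  constructor
  · linear_combination E (2 * i + 1) * E (2 * i + 2) * hr'
      - E (2 * i + 1) * E (2 * i + 2) * gam t (i + 1) * hr - G * gam t i * e1
      + E (2 * i + 1) * E (2 * i + 2) * G * e2
  · linear_combination E (2 * i) * E (2 * i + 1) * E (2 * i + 2) *
        ((1 - gam t i * gam t (i + 1)) * hr + (gam t i - gam t (i + 1)) * hr')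
      + G * E (2 * i + 2) * (1 - gam t (i + 1) ^ 2) * e3 + e4
      - E (2 * i) * E (2 * i + 1) * E (2 * i + 2) * G * gam t (i + 1) * e2

lemma coef_last (hn : 1 ≤ n) :
    gam t (n + 1) * (N ^ 2 * (E (2 * n + 2) * r')) = G ^ 2 * (gam t (n + 1) - gam t n) ∧
    gam t (n + 1) * (N ^ 2 * (E (2 * n) * E (2 * n + 2) * (r + gam t n * r'))) = G := by
  have e1 := h.last_mul hn
  have e2 := h.gam_succ_mul hn le_rfl
  rw [← hG] at e1
  constructor
  · linear_combination gam t (n + 1) * E (2 * n + 2) * hr' + G * e1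
  · linear_combination gam t (n + 1) * E (2 * n) * E (2 * n + 2) * (hr + gam t n * hr')
      + G * h.last11 - E (2 * n) * E (2 * n + 2) * G * e2

end NormalEqs

end restriction

/-! ### The similarity reduction restricted to `s₂ = 1` -/

section final
open Filter Topology

variable {n : ℕ} {c : ℕ → ℂ} {a : ℂ} {u x y : Fin 2 → ℕ → (Fin 2 → ℂ) → ℂ}
  {g : ℕ → (Fin 2 → ℂ) → ℂ} {gd : ℂ} {b η : ℕ → (Fin 2 → ℂ) → ℂ}

/-- The part of degree one of a combination of the gauged operators `B_k⁺` is obtained from that of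
`r Λ₁ + r' Λ₂`. -/
lemma gaugedBCoord_blocks (t : Fin 2 → ℂ) (r r' : ℂ) : ∃ Y : Coord,
    Y = expH n (hForm n (fun k => g k t) gd) (expE n (gam t) (dsCoord 0 0 0 0 r r')) ∧
    ∀ W, W = r • gaugedBCoord n u x y g gd η 0 t + r' • gaugedBCoord n u x y g gd η 1 t → W.d = 0 ∧
      ∀ i, W.c00 i = (expF n (fun i => η i t) Y).c00 i ∧
        W.c01 i = (expF n (fun i => η i t) Y).c01 i ∧
        W.c10 i = (expF n (fun i => η i t) Y).c10 i ∧
        W.c11 i = (expF n (fun i => η i t) Y).c11 i := by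
  refine ⟨_, rfl, ?_⟩
  rintro W rfl
  simp only [gaugedBCoord]
  rw [← gaugeCoord_lin, opBCoord, opBCoord, dsCoord_lin]
  simp [gaugeCoord, expF, expH, expE, dsCoord]

/-- The part of degree one of `s(s-1) ∑ T_k' B_k⁺` is that of the operator `B`. -/
lemma gaugedBCoord_blocks_eq (hn : 1 ≤ n) {t : Fin 2 → ℂ} {s r r' : ℂ} {q v w : ℕ → ℂ}
    (hN : NormalEqs n t (fun k => Complex.exp (hForm n (fun k => g k t) gd k)) fun j => b j t)
    (hs1 : s1 n (fun j => b j t) = s) (hs2 : s2 n (fun j => b j t) = 1)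
    (hr : (2 * n + 2) ^ 2 * r = -t 1 * (-t 0 * Complex.exp (hForm n (fun k => g k t) gd 1)))
    (hr' : (2 * n + 2) ^ 2 * r' = -t 0 * (-t 0 * Complex.exp (hForm n (fun k => g k t) gd 1)))
    (hq : ∀ i, 1 ≤ i → i ≤ n → q i =
      (cc n (fun j => b j t) (2 * n + 2) - lam (fun j => b j t) (fun j => η j t) i) / (2 * n + 2))
    (W : Coord)
    (hW : W = r • gaugedBCoord n u x y g gd η 0 t + r' • gaugedBCoord n u x y g gd η 1 t)
    (W' : Coord) (hW' : W' = laxBCoord n v w s q) :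
    ∀ i ≤ n, W.c00 i = W'.c00 i ∧ W.c01 i = W'.c01 i ∧ W.c10 i = W'.c10 i ∧ W.c11 i = W'.c11 i := by
  have hn0 := natCast_ne_zero n
  obtain ⟨Y, hY, hWY⟩ := gaugedBCoord_blocks (n := n) (u := u) (x := x) (y := y) (g := g) (gd := gd)
    (η := η) t r r'
  obtain ⟨-, hWY⟩ := hWY W hW
  obtain ⟨G, hG⟩ : ∃ G, G = -t 0 * Complex.exp (hForm n (fun k => g k t) gd 1) := ⟨_, rfl⟩
  rw [← hG] at hr hr'
  have hq' (i : ℕ) (h1 : 1 ≤ i) (h2 : i ≤ n) :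
      (2 * n + 2) * (q i - s) = G * gam t i - η i t := by
    rw [hG, ← hN.mul_q_sub (fun j => η j t) h1 h2, hs1, hq i h1 h2, mul_sub,
      mul_div_cancel₀ _ hn0]
  have e1 := hN.s1_mul hn
  have e2 := hN.s1_sub_s2 hn
  have hw := hN.gam_last_ne hn
  have f1 := hN.coef_first hG hr hr'
  have fo {i : ℕ} (h1 : 1 ≤ i) (h2 : i ≤ n) := hN.coef_odd hG hr h1 h2
  have fe {i : ℕ} (h1 : 1 ≤ i) (h2 : i ≤ n) := hN.coef_even_odd hr hr' h1 h2
  have fm {i : ℕ} (h1 : 1 ≤ i) (h2 : i < n) := hN.coef_mid hG hr hr' h1 h2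
  have fl := hN.coef_last hG hr hr' hn
  rw [hs1] at e1
  rw [hs1, hs2] at e2
  have e1' : (2 * n + 2) * s * gam t (n + 1) = -G := by rw [e1, hG]; ring
  have e2' : (2 * n + 2) * (s - 1) = -(G * gam t (n + 1)) := by rw [e2, hG]; ring
  have ess : (2 * n + 2) ^ 2 * (s * (s - 1)) = G ^ 2 := by
    refine mul_left_cancel₀ hw ?_
    linear_combination (2 * n + 2) * (s - 1) * e1' - G * e2'
  have key {A A' : ℂ} (h : (2 * n + 2) ^ 2 * A = (2 * n + 2) ^ 2 * A') : A = A' :=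
    mul_left_cancel₀ (pow_ne_zero 2 hn0) h
  have key' {A A' : ℂ} (h : gam t (n + 1) * ((2 * n + 2) ^ 2 * A) =
      gam t (n + 1) * ((2 * n + 2) ^ 2 * A')) : A = A' := key (mul_left_cancel₀ hw h)
  have d1 (z : ℂ) : (2 * n + 2) ^ 2 * (z / (2 * n + 2)) = (2 * n + 2) * z := by
    field_simp
  have d2 : (2 * n + 2 : ℂ) ^ 2 * (1 / (2 * n + 2) ^ 2) = 1 := by
    field_simp
  have t0 (v : ℕ → ℂ) : tr n v (0 + 1) = v 1 := tr_of_mem le_rfl hn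
  have tl (v : ℕ → ℂ) : tr n v (n + 1) = 0 := tr_of_gt (Nat.lt_succ_self n)
  have tn (v : ℕ → ℂ) : tr n v n = v n := tr_of_mem hn le_rfl
  subst hW'
  refine (forall_le_split _).2 ⟨?_, fun i hi hi' => ?_, ?_⟩
  · rw [(hWY 0).1, (hWY 0).2.1, (hWY 0).2.2.1, (hWY 0).2.2.2]
    obtain ⟨g1, g2, g3, g4⟩ := gauge_dsCoord_first _ _ _ _ _ _ _ _ hn hY
    simp only [expF, laxBCoord, pw_zero, t0, tr_zero, g1, g2, g3, g4]
    have h1 := hq' 1 le_rfl hn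
    obtain ⟨f1, f2, f3, f4⟩ := f1
    refine ⟨key ?_, key ?_, key ?_, key ?_⟩
    · linear_combination f1 - η 1 t * f2 - h1 - d1 (q 1 - s)
    · linear_combination f2 - d2
    · linear_combination f3 - η 1 t * f4 - ess
    · linear_combination f4
  · rw [(hWY i).1, (hWY i).2.1, (hWY i).2.2.1, (hWY i).2.2.2]
    obtain ⟨g1, g2, g3, g4⟩ := gauge_dsCoord_mid _ _ _ _ _ _ _ _ hi hi' hY
    have ti (v : ℕ → ℂ) : tr n v i = v i := tr_of_mem hi hi'.le
    have ti' (v : ℕ → ℂ) : tr n v (i + 1) = v (i + 1) := tr_of_mem (by omega) hi'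
    simp only [expF, laxBCoord, pw_mid hi hi', ti, ti', g1, g2, g3, g4]
    have h1 := hq' i hi hi'.le
    have h2 := hq' (i + 1) (by omega) hi'
    have f1 := fo hi hi'.le
    have f3 := fe hi hi'.le
    obtain ⟨f2, f4⟩ := fm hi hi'
    refine ⟨key ?_, key ?_, key ?_, key ?_⟩
    · linear_combination f1 + η i t * f3 - η (i + 1) t * f2 - η i t * η (i + 1) t * f4 - ess
        + (2 * n + 2) * (q (i + 1) - s) * h1 + (G * gam t i - η i t) * h2
    · linear_combination f2 + η i t * f4 + h1 - d1 (-(q i - s))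
    · linear_combination f3 - η (i + 1) t * f4 - h2 - d1 (q (i + 1) - s)
    · linear_combination f4 - d2
  · rw [(hWY n).1, (hWY n).2.1, (hWY n).2.2.1, (hWY n).2.2.2]
    obtain ⟨g1, g2, g3, g4⟩ := gauge_dsCoord_last _ _ _ _ _ _ _ _ hn hY
    simp only [expF, laxBCoord, pw_last hn, tn, tl, g1, g2, g3, g4]
    have h1 := hq' n hn le_rfl
    have f1 := fo hn le_rfl
    have f3 := fe hn le_rfl
    obtain ⟨f2, f4⟩ := fl
    refine ⟨key ?_, key' ?_, key ?_, key' ?_⟩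
    · linear_combination f1 + η n t * f3 - ess - (2 * n + 2) * (s - 1) * h1
        - (G * gam t n - η n t) * e2'
    · linear_combination f2 + η n t * f4 - gam t (n + 1) * ess
        - (2 * n + 2) * s * gam t (n + 1) * h1 - (G * gam t n - η n t) * e1'
    · linear_combination f3 - d1 (-(s - 1)) + e2'
    · linear_combination f4 - gam t (n + 1) * d1 (-s) + e1'

/-- With the coordinates `q`, `p` the gauged operator is the operator `laxM`. -/
lemma borelM_eq_laxM (hn : 1 ≤ n) {κ β μ l : ℕ → ℂ} {κd s : ℂ} {q p : ℕ → ℂ}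
    (hs1 : s1 n β = s) (hs2 : s2 n β = 1)
    (hq : ∀ i, 1 ≤ i → i ≤ n → q i = (cc n β (2 * n + 2) - l i) / (2 * n + 2))
    (hp : ∀ i, 1 ≤ i → i ≤ n → p i = -μ i) :
    borelM n κ κd μ l (cc n β) = laxM n κ κd s q p := by
  have hn0 := natCast_ne_zero n
  have hq' (i : ℕ) (h1 : 1 ≤ i) (h2 : i ≤ n) : (2 * n + 2) * q i = cc n β (2 * n + 2) - l i := by
    rw [hq i h1 h2, mul_div_cancel₀ _ hn0]
  have e1 : (2 * n + 2) * s = cc n β (2 * n + 2) - cc n β 1 := by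
    rw [← hs1, s1, mul_div_cancel₀ _ hn0]
  have e2 : (2 * n + 2 : ℂ) = cc n β (2 * n + 2) - cc n β (2 * n + 1) := by
    rw [← mul_div_cancel₀ (cc n β (2 * n + 2) - cc n β (2 * n + 1)) hn0, ← s2, hs2, mul_one]
  rw [borelM_eq hn, laxM_eq hn]
  refine elt_congr (fun _ _ => rfl) rfl (fun i h1 h2 => ?_) (fun _ _ _ => rfl)
    ((forall_le_split _).2 ⟨?_, fun i h1 h2 => ?_, ?_⟩)
  · simp only [nfCoord, hp i h1 h2, neg_neg]
  · simp only [nfCoord, pw_zero, borelOdd_one, laxOdd_one, true_and, and_true]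
    linear_combination e1 - hq' 1 le_rfl hn
  · simp only [nfCoord, pw_mid h1 h2, borelOdd_mid _ _ h1 h2, laxOdd_mid _ _ h1 h2, and_true]
    linear_combination hq' i h1 h2.le - hq' (i + 1) (by omega) h2
  · simp only [nfCoord, pw_last hn, borelOdd_last0 hn, laxOdd_last0 _ _ hn, borelOdd_last1,
      laxOdd_last1, and_true]
    have := hq' n hn le_rfl
    constructor
    · linear_combination this - e2
    · linear_combination this

variable {D : Set (Fin 2 → ℂ)} {κ : ℕ → ℂ}

/-- Along a curve on which `s₁` is the parameter and `s₂ = 1`, the gauged similarity reduction is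
the Lax equation. -/
lemma isLaxB_of_curve (hn : 1 ≤ n) (hD : IsOpen D)
    (hS : IsSimilarityReduction n D c a u x y) (hG : IsBorelGauge n D c a u x y g gd b η)
    {μ : ℕ → (Fin 2 → ℂ) → ℂ}
    (hM : ∀ t ∈ D, gaugedM n c a u x y g gd η t =
      borelM n κ a (fun i => μ i t) (lam (fun j => b j t) (fun i => η i t)) (cc n fun j => b j t))
    {U : Set ℂ} (hU : IsOpen U) {T : ℂ → Fin 2 → ℂ} (hT : DifferentiableOn ℂ T U)
    (hTD : Set.MapsTo T U D) (hs1 : ∀ s ∈ U, s1 n (fun j => b j (T s)) = s)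
    (hs2 : ∀ s ∈ U, s2 n (fun j => b j (T s)) = 1) {q p : ℕ → ℂ → ℂ}
    (hq : ∀ i ∈ Icc 1 n, ∀ s ∈ U, q i s = (cc n (fun j => b j (T s)) (2 * n + 2)
      - lam (fun j => b j (T s)) (fun j => η j (T s)) i) / (2 * n + 2))
    (hp : ∀ i ∈ Icc 1 n, ∀ s ∈ U, p i s = -μ i (T s)) {s : ℂ} (hs : s ∈ U) :
    gaugedM n c a u x y g gd η (T s) = laxM n κ a s (fun i => q i s) (fun i => p i s) ∧
    IsLaxB n (alph n κ a) s (fun i => q i s) (fun i => p i s)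
      ((s * (s - 1)) • ∑ k : Fin 2, deriv T s k • gaugedB n u x y g gd η k (T s)) ∧
    ∃ M', HasDerivW (fun z => laxM n κ a z (fun i => q i z) (fun i => p i z)) M' s ∧
      (s * (s - 1)) • M' =
        ⁅(s * (s - 1)) • ∑ k : Fin 2, deriv T s k • gaugedB n u x y g gd η k (T s),
          laxM n κ a s (fun i => q i s) (fun i => p i s)⁆ := by
  have hn0 := natCast_ne_zero n
  have hUs := hU.mem_nhds hs
  have hlax (z : ℂ) (hz : z ∈ U) : gaugedM n c a u x y g gd η (T z) =
      laxM n κ a z (fun i => q i z) (fun i => p i z) := by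
    rw [hM _ (hTD hz)]
    exact borelM_eq_laxM hn (hs1 z hz) (hs2 z hz)
      (fun i h1 h2 => hq i (mem_Icc.2 ⟨h1, h2⟩) z hz) fun i h1 h2 => hp i (mem_Icc.2 ⟨h1, h2⟩) z hz
  have hTs : HasDerivAt T (deriv T s) s := (hT.differentiableAt hUs).hasDerivAt
  have hN (z : ℂ) (hz : z ∈ U) := normalEqs_of_normal hn (hG.normal _ (hTD hz))
  obtain ⟨v0, v1⟩ := curve_velocity hn hTs (eventually_of_mem hUs hN)
    (K := Complex.exp gd) (Eventually.of_forall fun z => exp_hForm_prod hn (fun k => g k (T z)) gd)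
    (eventually_of_mem hUs hs1) (eventually_of_mem hUs hs2)
  obtain ⟨G, hGd⟩ : ∃ G, G = -T s 0 * Complex.exp (hForm n (fun k => g k (T s)) gd 1) := ⟨_, rfl⟩
  simp only [← hGd] at v0 v1
  have hGne : G ≠ 0 := hGd ▸ (hN s hs).scale_ne
  have hss : (2 * n + 2) ^ 2 * (s * (s - 1)) = G ^ 2 := by
    have e1 := (hN s hs).s1_mul hn
    have e2 := (hN s hs).s1_sub_s2 hn
    rw [hs1 s hs] at e1
    rw [hs1 s hs, hs2 s hs] at e2
    refine mul_left_cancel₀ ((hN s hs).gam_last_ne hn) ?_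
    rw [hGd]
    linear_combination (2 * n + 2) * (s - 1) * e1
      + T s 0 * Complex.exp (hForm n (fun k => g k (T s)) gd 1) * e2
  have hr (k j : Fin 2) (hv : deriv T s k * G = -T s j) :
      (2 * n + 2) ^ 2 * (s * (s - 1) * deriv T s k) = -T s j * G := by
    rw [← mul_assoc, hss, ← hv]
    ring
  obtain ⟨Z, hZ, hZe⟩ := exists_hasDerivC_gaugedM hn hD hS hG (hTD hs) hTs
  obtain ⟨W, hW⟩ : ∃ W, W = (s * (s - 1) * deriv T s 0) • gaugedBCoord n u x y g gd η 0 (T s)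
      + (s * (s - 1) * deriv T s 1) • gaugedBCoord n u x y g gd η 1 (T s) := ⟨_, rfl⟩
  have hWs : (s * (s - 1)) • ∑ k : Fin 2, deriv T s k • gaugedB n u x y g gd η k (T s) =
      elt n W := by
    rw [hW, Fin.sum_univ_two, smul_add, smul_smul, smul_smul, gaugedB_eq hn, gaugedB_eq hn,
      elt_add, elt_smul, elt_smul]
  have hWb : elt n W ∈ borel n := by
    have hB (j : Fin 2) := hG.mem_B _ (hTD hs) j
    simp only [gaugedB_eq hn] at hB
    rw [hW]
    exact smul_add_smul_mem_borel _ _ (hB 0) (hB 1)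
  have hWlax (v : ℕ → ℂ) (hv : ∀ i, 1 ≤ i → i ≤ n → W.x i = v i) :
      elt n W = elt n (laxBCoord n W.h v s fun i => q i s) := by
    refine elt_congr (fun _ _ => rfl) ?_ hv
      (fun i h1 h2 => coord_y_eq_zero hn hWb ⟨h1, h2⟩) ?_
    · obtain ⟨Y, -, hY⟩ := gaugedBCoord_blocks (n := n) (u := u) (x := x) (y := y) (g := g)
        (gd := gd) (η := η) (T s) (s * (s - 1) * deriv T s 0) (s * (s - 1) * deriv T s 1)
      exact (hY W hW).1
    · exact gaugedBCoord_blocks_eq hn (hN s hs) (hs1 s hs) (hs2 s hs) (hGd ▸ hr 0 1 v0)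
        (hGd ▸ hr 1 0 v1) (fun i h1 h2 => hq i (mem_Icc.2 ⟨h1, h2⟩) s hs) W hW _ rfl
  have hM' : HasDerivW (fun z => laxM n κ a z (fun i => q i z) (fun i => p i z)) (elt n Z) s := by
    refine hZ.hasDerivW.congr ?_
    filter_upwards [hUs] with z hz
    rw [← gaugedM_eq hn, hlax z hz]
  have hlie : (s * (s - 1)) • elt n Z =
      ⁅elt n W, laxM n κ a s (fun i => q i s) (fun i => p i s)⁆ := by
    rw [hZe, ← gaugedM_eq hn, hlax s hs, hW, ← smul_lie, elt_add, elt_add, elt_smul, elt_smul,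
      elt_smul, elt_smul, smul_add, smul_smul, smul_smul]
  refine ⟨hlax s hs, ?_, elt n Z, hM', hWs ▸ hlie⟩
  rw [hWs]
  obtain ⟨q', p', hqp⟩ := exists_hasDerivAt_of_laxM hn hM'
  obtain ⟨M'', hM'', he⟩ := hasDerivW_laxM hn (κ := κ) (κd := a) hqp
  rw [hM'.unique hM'', he, hWlax W.x fun _ _ _ => rfl, lax_eq_iff hn] at hlie
  have halg := laxAlg_uForm (alph n κ a) s (fun i => q i s) (fun i => p i s) hn
  obtain ⟨hx, hu⟩ := LaxAlg.unique hn hlie.1 halg (by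
    rw [sum_hForm_mul_deltaCoef hn, sum_uForm hn])
  refine ⟨W.h, fun k hk => hu k (mem_range.1 hk), ?_⟩
  rw [laxB_eq hn]
  exact hWlax _ hx

end final

end CoupledPVI


theorem mainTheorem1 (n : ℕ) (hn : 1 ≤ n) :
    -- every admissible choice of parameters comes from an element `κ` of the Cartan subalgebra
    (∀ α : ℕ → ℂ, Normalized n α →
      ∃ (κ : ℕ → ℂ) (κd : ℂ), ∀ j ∈ Finset.range (2 * n + 3), alph n κ κd j = α j) ∧
    -- the ordinary differential equation is equivalent to the Hamiltonian system
    (∀ (κ : ℕ → ℂ) (κd : ℂ), Normalized n (alph n κ κd) →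
      ∀ (U : Set ℂ), IsOpen U → ∀ q p : ℕ → ℂ → ℂ,
        IsLaxSolution n U κ κd q p ↔ IsSasanoSolution n U (alph n κ κd) q p) ∧
    -- the ordinary differential equation is what the similarity reduction becomes
    (∀ (D : Set (Fin 2 → ℂ)), IsOpen D → IsPreconnected D →
      ∀ (c : ℕ → ℂ) (a : ℂ), IsTheta n c a →
      ∀ u x y : Fin 2 → ℕ → (Fin 2 → ℂ) → ℂ, IsSimilarityReduction n D c a u x y →
      ∀ (g : ℕ → (Fin 2 → ℂ) → ℂ) (gd : ℂ) (b η : ℕ → (Fin 2 → ℂ) → ℂ),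
        IsBorelGauge n D c a u x y g gd b η →
      ∃ (κ : ℕ → ℂ) (κd : ℂ) (μ : ℕ → (Fin 2 → ℂ) → ℂ),
        Normalized n (alph n κ κd) ∧
        (∀ t ∈ D, gaugedM n c a u x y g gd η t =
          borelM n κ κd (fun i => μ i t) (lam (fun j => b j t) (fun i => η i t))
            (cc n fun j => b j t)) ∧
        (∀ t ∈ D, ∀ k, HasPartialW k (gaugedM n c a u x y g gd η)
          ⁅gaugedB n u x y g gd η k t, gaugedM n c a u x y g gd η t⁆ t) ∧
        ∀ (U : Set ℂ), IsOpen U → (0 : ℂ) ∉ U → (1 : ℂ) ∉ U →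
        ∀ T : ℂ → Fin 2 → ℂ, DifferentiableOn ℂ T U → Set.MapsTo T U D →
          (∀ s ∈ U, s1 n (fun j => b j (T s)) = s) →
          (∀ s ∈ U, s2 n (fun j => b j (T s)) = 1) →
        ∀ q p : ℕ → ℂ → ℂ,
          (∀ i ∈ Finset.Icc 1 n, ∀ s ∈ U, q i s =
            (cc n (fun j => b j (T s)) (2 * n + 2)
              - lam (fun j => b j (T s)) (fun j => η j (T s)) i) / (2 * n + 2)) →
          (∀ i ∈ Finset.Icc 1 n, ∀ s ∈ U, p i s = -μ i (T s)) →
          (∀ s ∈ U,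
            gaugedM n c a u x y g gd η (T s)
              = laxM n κ κd s (fun i => q i s) (fun i => p i s) ∧
            IsLaxB n (alph n κ κd) s (fun i => q i s) (fun i => p i s)
              ((s * (s - 1)) • ∑ k : Fin 2, deriv T s k • gaugedB n u x y g gd η k (T s))) ∧
          IsLaxSolution n U κ κd q p ∧ IsSasanoSolution n U (alph n κ κd) q p) := by
  refine ⟨fun α _ => exists_alph_eq hn α, fun κ κd hκ U _ q p =>
    isLaxSolution_iff_isSasanoSolution hn κ κd hκ U q p, ?_⟩
  intro D hD hDc c a hθ u x y hS g gd b η hG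
  -- `κ` is the Cartan part at a base point, which is arbitrary if `D` is empty.
  obtain ⟨t₀, ht₀⟩ : ∃ t₀ : Fin 2 → ℂ, ∀ t ∈ D, t₀ ∈ D := by
    by_cases h : D.Nonempty
    · exact ⟨h.some, fun _ _ => h.some_mem⟩
    · exact ⟨0, fun t ht => absurd ⟨t, ht⟩ h⟩
  have hκ : Normalized n (alph n (gaugedMCoord n c a u x y g gd η t₀).h a) :=
    (normalized_iff hn _ _).2 (theta_d hn hθ)
  have hM (t : Fin 2 → ℂ) (ht : t ∈ D) : gaugedM n c a u x y g gd η t =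
      borelM n (gaugedMCoord n c a u x y g gd η t₀).h a
        (fun i => (gaugedMCoord n c a u x y g gd η t).x i)
        (lam (fun j => b j t) (fun i => η i t)) (cc n fun j => b j t) := by
    rw [gaugedM_eq_nfCoord hn hG ht, hElt_gaugedMCoord_eq hn hD hS hG hDc ht (ht₀ t ht),
      borelM_eq hn, ← normalForm_eq hn, ← normalForm_eq hn, hElt_zero, zero_add, add_assoc]
  refine ⟨(gaugedMCoord n c a u x y g gd η t₀).h, a,
    fun i t => (gaugedMCoord n c a u x y g gd η t).x i, hκ, hM,
    fun t ht k => hasPartialW_gaugedM hn hD hS hG ht k, ?_⟩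
  intro U hU _ _ T hT hTD hs1 hs2 q p hq hp
  have key {s : ℂ} (hs : s ∈ U) := isLaxB_of_curve hn hD hS hG hM hU hT hTD hs1 hs2 hq hp hs
  have hL : IsLaxSolution n U (gaugedMCoord n c a u x y g gd η t₀).h a q p := fun s hs => by
    obtain ⟨-, hB, M', hM', he⟩ := key hs
    exact ⟨_, M', hB, hM', he⟩
  exact ⟨fun s hs => ⟨(key hs).1, (key hs).2.1⟩, hL,
    (isLaxSolution_iff_isSasanoSolution hn _ _ hκ U q p).1 hL⟩
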